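/- **Setting.** For a symmetric real $9\times 9$ matrix $B$ let $M_B$ be the 11-dimensional Cahen–Wallach space, i.e. $\mathbb R^{11}$ with coordinates $(x^+,x^-,x^1,\dots,x^9)$ and metric $$g=2\,dx^+dx^--\sum_{i,j}B_{ij}x^ix^j(dx^-)^2+\sum_i(dx^i)^2 .$$ Let $S$ be an irreducible complex Clifford module with $\Gamma_A\Gamma_C+\Gamma_C\Gamma_A=-2g_{AC}$, where $\Gamma_+,\Gamma_-,\Gamma_1,\dots,\Gamma_9$ belong to the frame $e_+=\partial_+$, $e_-=\partial_-+\tfrac12\sum B_{ij}x^ix^j\partial_+$, $e_i=\partial_i$, in which $g_{+-}=1$, $g_{ij}=\delta_{ij}$ and the other components vanish; this frame trivialises the spinor bundle. Put $\sigma_\pm=-\tfrac12\Gamma_\mp\Gamma_\pm$, $S_\pm=\sigma_\pm S$, $\xi_1=\sigma_-\xi$, $\xi_2=\sigma_+\xi$. The Clifford algebra of $V=\mathbb R^9$ acts on $S=S_-\oplus S_+$ so as to commute with $\Gamma_\pm$: $e_i$ acts by $\gamma_i:=\Gamma_i$ on $S_-$ and $\gamma_i:=-\Gamma_i$ on $S_+$;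 put $\gamma_{123}=\gamma_1\gamma_2\gamma_3$, $\gamma_{ij}=\gamma_i\gamma_j$ for $i\ne j$. Let $C$ be a charge conjugation, i.e. a non-degenerate skew-symmetric bilinear form on $S$ with $C(\Gamma_A\xi,\eta)=-C(\xi,\Gamma_A\eta)$. Let $\nabla$ be the Levi-Civita connection (also on spinors) and, for Killing fields $X$, let $\mathcal L_X\xi=\nabla_X\xi-\Gamma(\nabla X)\xi$ be the spinorial Lie derivative, where $\Gamma(F)$ is the image of a skew endomorphism $F$ under the spin representation. Let $\alpha,\beta\in\mathbb C$ be such that $(\alpha-\beta)^2$ and $(\alpha+\beta)^2$ are real and non-zero (for instance real with $\alpha\neq\pm\beta$), let $$B=B_{\alpha,\beta}=-\mathrm{diag}\big((\alpha-\beta)^2\mathbb 1_3,(\alpha+\beta)^2\mathbb 1_6\big)=\mathrm{diag}(\lambda_1^2,\dots,\lambda_9^2),$$ with $\lambda_i=-\mathrm i(\alpha-\beta)$ for $i\le3$ and $\lambda_i=-\mathrm i(\alpha+\beta)$ for $i\ge4$, let $(c,d)=(\alpha\gamma_{123},\beta\gamma_{123})$, and let $D$ be the connection on spinors $$D_+\xi=\nabla_+\xi,\qquad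 D_-\xi=\nabla_-\xi-c\,\xi_1-d\,\xi_2,\qquad D_i\xi=\nabla_i\xi-\tfrac12\Gamma_+(c\gamma_i-\gamma_id)\,\xi_2 .$$ Let $\mathcal K_0$ be the complex span of $$K_{(+)}=-\partial_+,\quad K_{(-)}=-\partial_-,\quad K_{(i)}=\cos(\lambda_ix^-)\partial_i+\lambda_i\sin(\lambda_ix^-)x^i\partial_+,\quad K_{(i^*)}=-\lambda_i\sin(\lambda_ix^-)\partial_i+\lambda_i^2\cos(\lambda_ix^-)x^i\partial_+,$$ and $K_{(ij)}=x^j\partial_i-x^i\partial_j$ with $i,j$ both in $\{1,2,3\}$ or both in $\{4,\dots,9\}$. A *geometric superalgebra* for $(M_B,D)$ consists of a Lie algebra $\mathcal K_0$ of (complexified) Killing fields, a space $\mathcal K_1$ of $D$-parallel spinors, a linear map $\mathcal L:\mathcal K_0\to\mathrm{End}(\mathcal K_1)$ with $[\mathcal L_X,\mathcal L_Y]=\mathcal L_{[X,Y]}$, and a symmetric bilinear map $\{\cdot,\cdot\}:\mathcal K_1\times\mathcal K_1\to\mathcal K_0$ with $2\{\mathcal L_X\xi,\xi\}=[X,\{\xi,\xi\}]$.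 It is *irreducible* ($N=1$) if $S$ is an irreducible Clifford module and *non-restricted* if $\mathcal K_1$ contains all $D$-parallel spinors; $\nu=\dim\mathcal K_1/\dim S$. **Proposition.** For all $(\alpha,\beta)$ as above: 1. $D$ is flat; if $\alpha\beta\ne0$, then $\mathcal K_0$ is the algebra of all complexified smooth Killing fields of $M_B$. 2. $\mathcal K_0$, the space $\mathcal K_1$ of all $D$-parallel spinors, the spinorial Lie derivative $\mathcal L$, and the polarisation of $$\{\xi,\xi\}=\{\xi,\xi\}^+K_{(+)}+\{\xi,\xi\}^-K_{(-)}+\sum_i\{\xi,\xi\}^iK_{(i)}+\sum_i\{\xi,\xi\}^{i^*}K_{(i^*)}+\tfrac12\sum_{i,j}\{\xi,\xi\}^{ij}K_{(ij)},$$ where, with $\xi_1^0=\xi_1(0)$ and $\xi_2^0=\xi_2(0)$, $$\{\xi,\xi\}^+=C(\xi_1^0,\Gamma_-\xi_1^0),\quad\{\xi,\xi\}^-=C(\xi_2^0,\Gamma_+\xi_2^0),\quad\{\xi,\xi\}^i=2C(\xi_1^0,\gamma_i\xi_2^0),\quad\{\xi,\xi\}^{i^*}=\tfrac{2\mathrm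 i}{\lambda_i}C(\xi_1^0,\gamma_{123}\gamma_i\xi_2^0),$$ $$\{\xi,\xi\}^{ij}=\begin{cases}-\mathrm i\lambda_i\,C(\xi_2^0,\Gamma_+\gamma_{123}\gamma_{ij}\xi_2^0)& i,j\in\{1,2,3\},\\ \ \ \mathrm i\lambda_i\,C(\xi_2^0,\Gamma_+\gamma_{123}\gamma_{ij}\xi_2^0)& i,j\in\{4,\dots,9\},\\ \ \ 0&\text{otherwise,}\end{cases}$$ form a non-restricted irreducible ($N=1$) geometric superalgebra with $\nu=1$. 3. Up to the identification of isometric spaces this is a 1-parameter family: $M_{B_{\alpha,\beta}}$ and $M_{B_{\alpha',\beta'}}$ are isometric if and only if $(\alpha',\beta')=t(\alpha,\beta)$ or $(\alpha',\beta')=t(\beta,\alpha)$ for some real $t\neq0$; and the superalgebras of $(\alpha,\beta)$ and $t(\alpha,\beta)$ are isomorphic for every real $t\ne0$. -/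

import Mathlib

open scoped ContDiff

noncomputable section

namespace CW

/-- Index set of the coordinates `(x⁺, x⁻, x¹, …, x⁹)`: `inl 0` is `+`, `inl 1` is `-`. -/
abbrev Ix : Type := Fin 2 ⊕ Fin 9

abbrev ip : Ix := Sum.inl 0
abbrev im : Ix := Sum.inl 1
abbrev iv (i : Fin 9) : Ix := Sum.inr i

/-- The manifold underlying an 11-dimensional Cahen–Wallach space, in its global coordinates. -/
abbrev Pt : Type := Ix → ℝ

/-- Vector fields with complex coefficients, in coordinate components. -/
abbrev VField : Type := Pt → Ix → ℂ

/-- Sections of the trivialised bundle with fibre `S`. -/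
abbrev Field (S : Type*) : Type _ := Pt → S

/-- Partial derivative in the coordinate direction `A`. -/
def pd {E : Type*} [NormedAddCommGroup E] [NormedSpace ℝ E] (A : Ix) (f : Pt → E) (x : Pt) : E :=
  fderiv ℝ f x (Pi.single A 1)

/-! ### The Cahen–Wallach metric and its Killing fields -/

/-- The quadratic function `∑ B_{ij} x^i x^j`. -/
def quad (B : Matrix (Fin 9) (Fin 9) ℝ) (x : Pt) : ℝ :=
  ∑ i, ∑ j, B i j * x (iv i) * x (iv j)

/-- `g = 2 dx⁺ dx⁻ - ∑ B_{ij} x^i x^j (dx⁻)² + ∑ (dx^i)²`. -/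
def metric (B : Matrix (Fin 9) (Fin 9) ℝ) (x : Pt) : Matrix Ix Ix ℝ :=
  Matrix.fromBlocks !![0, 1; 1, -quad B x] 0 0 1

/-- The constant metric of the frame `e₊, e₋, e₁, …, e₉`. -/
def eta : Matrix Ix Ix ℝ :=
  Matrix.fromBlocks !![0, 1; 1, 0] 0 0 1

/-- Lie bracket of vector fields. -/
def lieBr (X Y : VField) : VField := fun x C =>
  ∑ A, (X x A * pd A (fun y => Y y C) x - Y x A * pd A (fun y => X y C) x)

/-- Smooth (complexified) Killing vector fields: `L_X g = 0`. -/
def IsKilling (B : Matrix (Fin 9) (Fin 9) ℝ) (X : VField) : Prop :=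
  ContDiff ℝ ∞ X ∧ ∀ (x : Pt) (A C : Ix),
    ∑ E, (X x E * ((pd E (fun y => metric B y A C) x : ℝ) : ℂ)
      + (metric B x E C : ℂ) * pd A (fun y => X y E) x
      + (metric B x A E : ℂ) * pd C (fun y => X y E) x) = 0

/-- Christoffel symbols `Γ^C_{AE}` of the Levi-Civita connection. -/
def christoffel (B : Matrix (Fin 9) (Fin 9) ℝ) (x : Pt) (C A E : Ix) : ℝ :=
  (1 / 2) * ∑ F, (metric B x)⁻¹ C F *
    (pd A (fun y => metric B y E F) x + pd E (fun y => metric B y A F) x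
      - pd F (fun y => metric B y A E) x)

/-- Components of the Levi-Civita derivative `∇_{∂_A} X`. -/
def nablaVec (B : Matrix (Fin 9) (Fin 9) ℝ) (A : Ix) (X : VField) (x : Pt) : Ix → ℂ := fun C =>
  pd A (fun y => X y C) x + ∑ E, (christoffel B x C A E : ℂ) * X x E

/-- The frame `e₊ = ∂₊`, `e₋ = ∂₋ + ½ ∑ B_{ij} x^i x^j ∂₊`, `e_i = ∂_i`, in which the metric
is `eta`. -/
def frame (B : Matrix (Fin 9) (Fin 9) ℝ) : Ix → VField
  | Sum.inl k => fun x =>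
      if k = 0 then Pi.single ip 1 else Pi.single im 1 + ((quad B x : ℂ) / 2) • Pi.single ip 1
  | Sum.inr i => fun _ => Pi.single (iv i) 1

/-- Frame components of a vector given by its coordinate components. -/
def coframe (B : Matrix (Fin 9) (Fin 9) ℝ) (x : Pt) (v : Ix → ℂ) : Ix → ℂ :=
  v - (v im * (quad B x : ℂ) / 2) • Pi.single ip 1

/-- Isometry of Cahen–Wallach spaces: a smooth diffeomorphism pulling back one metric to the
other. -/
def Isometric (B B' : Matrix (Fin 9) (Fin 9) ℝ) : Prop :=
  ∃ φ : Pt ≃ Pt, ContDiff ℝ ∞ φ ∧ ContDiff ℝ ∞ φ.symm ∧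
    ∀ (x : Pt) (v w : Ix → ℝ),
      fderiv ℝ φ x v ⬝ᵥ (metric B' (φ x)).mulVec (fderiv ℝ φ x w)
        = v ⬝ᵥ (metric B x).mulVec w

/-! ### Spinors -/

section Spinors

variable {S : Type*} [NormedAddCommGroup S] [NormedSpace ℂ S]

/-- Clifford relation `Γ_A Γ_C + Γ_C Γ_A = -2 g_{AC}`. -/
def IsClifford (Γ : Ix → S →L[ℂ] S) : Prop :=
  ∀ A C, Γ A * Γ C + Γ C * Γ A = (-2 * (eta A C : ℂ)) • (1 : S →L[ℂ] S)

/-- Irreducibility as a Clifford module. -/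
def IsIrred (Γ : Ix → S →L[ℂ] S) : Prop :=
  Nontrivial S ∧ ∀ p : Submodule ℂ S, (∀ A, ∀ s ∈ p, Γ A s ∈ p) → p = ⊥ ∨ p = ⊤

/-- A charge conjugation: a non-degenerate skew-symmetric bilinear form for which Clifford
multiplication by vectors is skew-adjoint. -/
def IsChargeConj (Γ : Ix → S →L[ℂ] S) (C : S →ₗ[ℂ] S →ₗ[ℂ] ℂ) : Prop :=
  (∀ s, (∀ t, C s t = 0) → s = 0) ∧ (∀ s t, C s t = -C t s) ∧
    ∀ A s t, C (Γ A s) t = -C s (Γ A t)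

/-- Projection `σ₋ = -½ Γ₊ Γ₋` to `S₋`; `ξ₁ = σ₋ ξ`. -/
def sigmaM (Γ : Ix → S →L[ℂ] S) : S →L[ℂ] S := (-(1 / 2) : ℂ) • (Γ ip * Γ im)

/-- Projection `σ₊ = -½ Γ₋ Γ₊` to `S₊`; `ξ₂ = σ₊ ξ`. -/
def sigmaP (Γ : Ix → S →L[ℂ] S) : S →L[ℂ] S := (-(1 / 2) : ℂ) • (Γ im * Γ ip)

/-- The action of `e_i` as an element of the Clifford algebra of `V = ℝ⁹`. The two summands are
identified by `Γ₊ : S₊ → S₋`, so it commutes with `Γ_±`: it is `Γ_i` on `S₋` and `-Γ_i` on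
`S₊`. -/
def gam (Γ : Ix → S →L[ℂ] S) (i : Fin 9) : S →L[ℂ] S := Γ (iv i) * (sigmaM Γ - sigmaP Γ)

/-- `Γ₁₂₃` as an element of the Clifford algebra of `V`. -/
def gam123 (Γ : Ix → S →L[ℂ] S) : S →L[ℂ] S := gam Γ 0 * gam Γ 1 * gam Γ 2

/-- Clifford multiplication by a vector given by its coordinate components at `x`. -/
def cliff (B : Matrix (Fin 9) (Fin 9) ℝ) (Γ : Ix → S →L[ℂ] S) (x : Pt) (v : Ix → ℂ) :
    S →L[ℂ] S :=
  ∑ A, coframe B x v A • Γ A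

/-- The index of the vector metrically dual to a frame vector: `+` and `-` are exchanged. -/
def dualIx : Ix → Ix := Sum.map Fin.rev id

/-- The image under the spin representation of the skew endomorphism `F` with `F e_A = v A`:
`Γ(F) = -¼ ∑_A Γ(F e_A) Γ(e^A)`, which is characterised up to scalars by
`[Γ(F), Γ(w)] = Γ(F w)`. -/
def spinLift (B : Matrix (Fin 9) (Fin 9) ℝ) (Γ : Ix → S →L[ℂ] S) (x : Pt) (v : Ix → Ix → ℂ) :
    S →L[ℂ] S :=
  (-(1 / 4) : ℂ) • ∑ A, cliff B Γ x (v A) * Γ (dualIx A)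

/-- A connection on the spinor bundle, through its connection form in the trivialisation given by
the frame. -/
abbrev Conn (S : Type*) [NormedAddCommGroup S] [NormedSpace ℂ S] : Type _ :=
  Ix → Pt → S →L[ℂ] S

/-- Covariant derivative in the coordinate direction `A`. -/
def covD (ϖ : Conn S) (A : Ix) (ξ : Field S) : Field S := fun x => pd A ξ x + ϖ A x (ξ x)

/-- The spinorial Levi-Civita connection. -/
def leviCivita (B : Matrix (Fin 9) (Fin 9) ℝ) (Γ : Ix → S →L[ℂ] S) : Conn S := fun A x =>
  spinLift B Γ x (fun E => nablaVec B A (frame B E) x)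

/-- The part of the connection `D` determined by the pair `(c, d)`:
`D₋ ξ = ∇₋ ξ - c ξ₁ - d ξ₂`, `D_i ξ = ∇_i ξ - ½ Γ₊ (c e_i - e_i d) ξ₂`. -/
def pairForm (Γ : Ix → S →L[ℂ] S) (c d : S →L[ℂ] S) : Conn S
  | Sum.inl k => fun _ => if k = 0 then 0 else -(c * sigmaM Γ + d * sigmaP Γ)
  | Sum.inr i => fun _ =>
      (-(1 / 2) : ℂ) • (Γ ip * (c * gam Γ i - gam Γ i * d) * sigmaP Γ)

/-- The connection `D` for the pair `(c, d)`. -/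
def connD (B : Matrix (Fin 9) (Fin 9) ℝ) (Γ : Ix → S →L[ℂ] S) (c d : S →L[ℂ] S) : Conn S :=
  leviCivita B Γ + pairForm Γ c d

/-- The smooth spinor fields that are parallel for a connection. -/
def parallel (ϖ : Conn S) : Submodule ℂ (Field S) where
  carrier := {ξ | ContDiff ℝ ∞ ξ ∧ ∀ A x, covD ϖ A ξ x = 0}
  zero_mem' := by
    refine ⟨contDiff_const (c := (0 : S)), fun A x => ?_⟩
    have h : fderiv ℝ (0 : Field S) x = 0 := fderiv_const_apply (0 : S)
    simp [covD, pd, h]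
  add_mem' := by
    rintro ξ η ⟨h1, h2⟩ ⟨h3, h4⟩
    refine ⟨h1.add h3, fun A x => ?_⟩
    have e := fderiv_add (h1.differentiable (by simp) x) (h3.differentiable (by simp) x)
    have a := h2 A x
    have b := h4 A x
    simp only [covD, pd] at a b ⊢
    rw [e]
    simp only [add_apply, Pi.add_apply, map_add]
    rw [add_add_add_comm, a, b, add_zero]
  smul_mem' := by
    rintro z ξ ⟨h1, h2⟩
    refine ⟨h1.const_smul z, fun A x => ?_⟩
    have e := fderiv_const_smul (h1.differentiable (by simp) x) z
    have a := h2 A x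
    simp only [covD, pd] at a ⊢
    rw [e]
    simp only [smul_apply, Pi.smul_apply, map_smul]
    rw [← smul_add, a, smul_zero]

/-- Flatness: covariant derivatives in the coordinate directions commute. -/
def IsFlat (ϖ : Conn S) : Prop :=
  ∀ ξ : Field S, ContDiff ℝ ∞ ξ → ∀ A C x, covD ϖ A (covD ϖ C ξ) x = covD ϖ C (covD ϖ A ξ) x

/-- The spinorial Lie derivative `L_X ξ = ∇_X ξ - Γ(∇X) ξ`. -/
def spinorLie (B : Matrix (Fin 9) (Fin 9) ℝ) (Γ : Ix → S →L[ℂ] S) (X : VField) (ξ : Field S) :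
    Field S := fun x =>
  (∑ A, X x A • covD (leviCivita B Γ) A ξ x)
    - spinLift B Γ x (fun A => ∑ E, frame B A x E • nablaVec B E X x) (ξ x)

/-- Geometric superalgebras on the Cahen–Wallach space of `B` for a connection `ϖ` on the spinor
bundle with fibre `S`. -/
structure GeomSuperalgebra (B : Matrix (Fin 9) (Fin 9) ℝ) (ϖ : Conn S) where
  /-- The even part, a Lie algebra of Killing fields. -/
  even : Submodule ℂ VField
  even_killing : ∀ X ∈ even, IsKilling B X
  even_lie : ∀ X ∈ even, ∀ Y ∈ even, lieBr X Y ∈ even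
  /-- The odd part, consisting of parallel spinors. -/
  odd : Submodule ℂ (Field S)
  odd_parallel : odd ≤ parallel ϖ
  /-- The even-odd bracket. -/
  L : even →ₗ[ℂ] Module.End ℂ odd
  L_lie : ∀ X Y : even, L X * L Y - L Y * L X = L ⟨lieBr X Y, even_lie X X.2 Y Y.2⟩
  /-- The odd-odd bracket. -/
  br : odd →ₗ[ℂ] odd →ₗ[ℂ] even
  br_symm : ∀ ξ η, br ξ η = br η ξ
  compat : ∀ (X : even) (ξ : odd),
    2 • br (L X ξ) ξ = ⟨lieBr X (br ξ ξ), even_lie X X.2 _ (br ξ ξ).2⟩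

/-- All parallel spinors belong to the odd part. -/
def GeomSuperalgebra.NonRestricted {B : Matrix (Fin 9) (Fin 9) ℝ} {ϖ : Conn S}
    (G : GeomSuperalgebra B ϖ) : Prop :=
  parallel ϖ ≤ G.odd

/-- `ν = dim K₁ / dim S`. -/
def GeomSuperalgebra.nu {B : Matrix (Fin 9) (Fin 9) ℝ} {ϖ : Conn S}
    (G : GeomSuperalgebra B ϖ) : ℚ :=
  (Module.finrank ℂ G.odd : ℚ) / (Module.finrank ℂ S : ℚ)

/-- Isomorphism of geometric superalgebras: linear isomorphisms of the even and odd parts that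
respect the three brackets. -/
def GeomSuperalgebra.Iso {B B' : Matrix (Fin 9) (Fin 9) ℝ} {ϖ ϖ' : Conn S}
    (G : GeomSuperalgebra B ϖ) (G' : GeomSuperalgebra B' ϖ') : Prop :=
  ∃ (e₀ : G.even ≃ₗ[ℂ] G'.even) (e₁ : G.odd ≃ₗ[ℂ] G'.odd),
    (∀ X Y : G.even,
      (e₀ ⟨lieBr X Y, G.even_lie X X.2 Y Y.2⟩ : VField) = lieBr (e₀ X) (e₀ Y)) ∧
    (∀ (X : G.even) (ξ : G.odd), e₁ (G.L X ξ) = G'.L (e₀ X) (e₁ ξ)) ∧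
    ∀ ξ η : G.odd, e₀ (G.br ξ η) = G'.br (e₁ ξ) (e₁ η)

end Spinors

/-! ### The family -/

/-- `B = -diag((α-β)² 1₃, (α+β)² 1₆)`, for `α, β` such that both squares are real. -/
def famB (α β : ℂ) : Matrix (Fin 9) (Fin 9) ℝ :=
  -Matrix.diagonal fun i => if i.val < 3 then ((α - β) ^ 2).re else ((α + β) ^ 2).re

/-- `λ_i = -i (α ∓ β)`, so that `B = diag(λ_i²)`. -/
def lam (α β : ℂ) (i : Fin 9) : ℂ :=
  if i.val < 3 then -Complex.I * (α - β) else -Complex.I * (α + β)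

/-- The parameters of the family: `B` is real and non-degenerate. -/
def Admissible (α β : ℂ) : Prop :=
  ((α - β) ^ 2).im = 0 ∧ ((α + β) ^ 2).im = 0 ∧ α ≠ β ∧ α ≠ -β

/-- `K₍₊₎ = -∂₊`. -/
def Kp : VField := fun _ => -Pi.single ip 1

/-- `K₍₋₎ = -∂₋`. -/
def Km : VField := fun _ => -Pi.single im 1

/-- `K₍ᵢ₎ = cos(λ_i x⁻) ∂_i + λ_i sin(λ_i x⁻) x^i ∂₊`. -/
def Kv (l : Fin 9 → ℂ) (i : Fin 9) : VField := fun x =>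
  Complex.cos (l i * x im) • Pi.single (iv i) 1
    + (l i * Complex.sin (l i * x im) * x (iv i)) • Pi.single ip 1

/-- `K₍ᵢ*₎ = -λ_i sin(λ_i x⁻) ∂_i + λ_i² cos(λ_i x⁻) x^i ∂₊`. -/
def Ks (l : Fin 9 → ℂ) (i : Fin 9) : VField := fun x =>
  (-(l i) * Complex.sin (l i * x im)) • Pi.single (iv i) 1
    + (l i ^ 2 * Complex.cos (l i * x im) * x (iv i)) • Pi.single ip 1

/-- `K₍ᵢⱼ₎ = x^j ∂_i - x^i ∂_j`. -/
def Kr (i j : Fin 9) : VField := fun x =>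
  (x (iv j) : ℂ) • Pi.single (iv i) 1 - (x (iv i) : ℂ) • Pi.single (iv j) 1

/-- The Killing algebra: the span of `K₍₊₎, K₍₋₎, K₍ᵢ₎, K₍ᵢ*₎`, and the `K₍ᵢⱼ₎` with `i, j` both in
`{1,2,3}` or both in `{4,…,9}`. -/
def killingAlg (α β : ℂ) : Submodule ℂ VField :=
  Submodule.span ℂ ({Kp, Km} ∪ Set.range (Kv (lam α β)) ∪ Set.range (Ks (lam α β))
    ∪ {X | ∃ i j : Fin 9, (i.val < 3 ↔ j.val < 3) ∧ X = Kr i j})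

section Family

variable {S : Type*} [NormedAddCommGroup S] [NormedSpace ℂ S]

/-- The connection `D` with `(c, d) = (α Γ₁₂₃, β Γ₁₂₃)`. -/
def famD (Γ : Ix → S →L[ℂ] S) (α β : ℂ) : Conn S :=
  connD (famB α β) Γ (α • gam123 Γ) (β • gam123 Γ)

/-- The component `{ξ,ξ}^{ij}`; `v` is the constant spinor `ξ₂⁰`. For `i = j` it is irrelevant, as
`K₍ᵢᵢ₎ = 0`. -/
def brRot (Γ : Ix → S →L[ℂ] S) (C : S →ₗ[ℂ] S →ₗ[ℂ] ℂ) (α β : ℂ) (v : S) (i j : Fin 9) : ℂ :=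
  if i.val < 3 ∧ j.val < 3 then
    -Complex.I * lam α β i * C v (Γ ip (gam123 Γ (gam Γ i (gam Γ j v))))
  else if 3 ≤ i.val ∧ 3 ≤ j.val then
    Complex.I * lam α β i * C v (Γ ip (gam123 Γ (gam Γ i (gam Γ j v))))
  else 0

/-- The vector field `{ξ,ξ}` for the constant spinors `u = ξ₁⁰`, `v = ξ₂⁰`. -/
def brField (Γ : Ix → S →L[ℂ] S) (C : S →ₗ[ℂ] S →ₗ[ℂ] ℂ) (α β : ℂ) (u v : S) : VField :=
  C u (Γ im u) • Kp + C v (Γ ip v) • Km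
    + (∑ i, (2 * C u (gam Γ i v)) • Kv (lam α β) i)
    + (∑ i, (2 * Complex.I / lam α β i * C u (gam123 Γ (gam Γ i v))) • Ks (lam α β) i)
    + (1 / 2 : ℂ) • ∑ i, ∑ j, brRot Γ C α β v i j • Kr i j

end Family

end CW

end

open scoped ContDiff

noncomputable section

namespace CW

/-! ### Calculus of coordinate derivatives -/

section Calculus

variable {E : Type*} [NormedAddCommGroup E] [NormedSpace ℝ E]

/-! Everything reduces to constant operators on `S` and to the values of spinors at the origin. The
twisted generators γ_i commute with Γ₊ and Γ₋, the element γ₁₂₃ squares to 1, and γ_i commutes with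
γ₁₂₃ up to the sign ε_i = `sgn i`, which is +1 on the first three indices and -1 on the other six.
The identity behind the whole construction is α - ε_i β = i λ_i (`sub_sgn_mul`).

Flatness. In the trivialisation, D has the connection form 0 along ∂₊, N + ∑ b_i x^i Z_i along ∂₋
and P_i along ∂_i, with the constant operators N = `opN`, P_i = `opP`, Z_i = `opZ`. Products of P's
and Z's vanish because Γ₊² = 0, and the identity above gives [N, P_i] = λ_i² Z_i and [N, Z_i] =
-P_i. The curvature is therefore (b_i - λ_i²) Z_i up to sign, which is zero. The gauge
transformation exp(x⁻ N)(1 + ∑ x^i P_i) trivialises D, so parallel spinors correspond to their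
values at the origin (`evalEquiv`), and ν = 1.

Even-odd bracket. A field in the Killing algebra is a `killField` with parameters a, b, p, q, w. On
a parallel spinor its Lie derivative is an algebraic operator, because ∇ξ can be replaced by the
terms in c and d; this operator is D-parallel as an endomorphism field, so it preserves parallel
spinors. At the origin it is b N - ∑ p_i P_i + ∑ λ_i² q_i Z_i + R(w). Comparing `lieBr_killField`
with `opGen_commutator` shows that this is a representation.

Odd-odd bracket. Each component of the bracket of spinors is a symmetric form C(s, T t) with T
skew-adjoint. If A is the operator of a Killing field and A* its adjoint, then compatibility says
that A* T + T A is the combination of such operators T prescribed by the Lie bracket of Killing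
fields. This is a finite table of Clifford identities, assembled in `two_smul_brKill`; `brKill_self`
identifies the result with the given formula.

All Killing fields. Cross-differentiating the Killing equations forces X⁻ to be constant, the
transverse part to be a constant rotation plus solutions of v'' = -b_i v in x⁻, and X⁺ to be
determined up to a constant. Rotations mixing the two blocks would need λ_i² = λ_j² across the
blocks, and the difference of these squares is ±4αβ.

Isometry classes. For an isometry Φ, the differential of x⁻ ∘ Φ is parallel, hence equal to s dx⁻
with s constant and non-zero. The pulled back metric then forces a constant orthogonal transverse
Jacobian R with B = s² Rᵀ B' R. The multiplicities 3 and 6 differ, so power sums recover the two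
eigenvalues individually, and the signs of the square roots give the cases t(α, β) and t(β, α).
Conversely, rescaling x⁺ and x⁻ by t and t⁻¹ is an isometry, and it lifts to spinors through a
complex square root of t (`superalgebra_iso`). -/

theorem contDiff_pd {f : Pt → E} (hf : ContDiff ℝ ∞ f) (A : Ix) : ContDiff ℝ ∞ (pd A f) :=
  (hf.fderiv_right (m := ∞) (by simp)).clm_apply contDiff_const

theorem differentiable_of_smooth {f : Pt → E} (hf : ContDiff ℝ ∞ f) : Differentiable ℝ f :=
  hf.differentiable (by simp)

/-- The source of every integrability condition below: for flatness, for Killing fields and for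
isometries. -/
theorem pd_comm {f : Pt → E} (hf : ContDiff ℝ ∞ f) (A C : Ix) (x : Pt) :
    pd A (pd C f) x = pd C (pd A f) x := by
  have hd : DifferentiableAt ℝ (fderiv ℝ f) x :=
    (hf.fderiv_right (m := ∞) (by simp)).differentiable (by simp) x
  have key : ∀ A C : Ix, pd A (pd C f) x
      = fderiv ℝ (fderiv ℝ f) x (Pi.single A 1) (Pi.single C 1) := by
    intro A C
    have h : fderiv ℝ (fun y => fderiv ℝ f y (Pi.single C 1)) x (Pi.single A 1)
        = fderiv ℝ (fderiv ℝ f) x (Pi.single A 1) (Pi.single C 1) := by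
      rw [fderiv_clm_apply hd (differentiableAt_const _)]
      simp
    exact h
  rw [key, key]
  have hs : IsSymmSndFDerivAt ℝ f x :=
    hf.contDiffAt.isSymmSndFDerivAt (by
      rw [minSmoothness_of_isRCLikeNormedField]; exact WithTop.coe_le_coe.2 le_top)
  exact hs.eq _ _

theorem pd_const (A : Ix) (c : E) (x : Pt) : pd A (fun _ => c) x = 0 := by
  simp [pd]

theorem pd_add (A : Ix) {f g : Pt → E} {x : Pt} (hf : DifferentiableAt ℝ f x)
    (hg : DifferentiableAt ℝ g x) : pd A (fun y => f y + g y) x = pd A f x + pd A g x := by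
  simp only [pd]
  rw [fderiv_fun_add hf hg]; rfl

theorem pd_sub (A : Ix) {f g : Pt → E} {x : Pt} (hf : DifferentiableAt ℝ f x)
    (hg : DifferentiableAt ℝ g x) : pd A (fun y => f y - g y) x = pd A f x - pd A g x := by
  simp only [pd]
  rw [fderiv_fun_sub hf hg]; rfl

theorem pd_neg (A : Ix) (f : Pt → E) (x : Pt) : pd A (fun y => -f y) x = -pd A f x := by
  simp only [pd]
  rw [fderiv_fun_neg]; rfl

theorem pd_sum {ι : Type*} (s : Finset ι) (A : Ix) {f : ι → Pt → E} {x : Pt}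
    (hf : ∀ i ∈ s, DifferentiableAt ℝ (f i) x) :
    pd A (fun y => ∑ i ∈ s, f i y) x = ∑ i ∈ s, pd A (f i) x := by
  simp only [pd]
  rw [fderiv_fun_sum hf]; simp

theorem pd_mul {𝔸 : Type*} [NormedRing 𝔸] [NormedAlgebra ℝ 𝔸] (A : Ix) {f g : Pt → 𝔸} {x : Pt}
    (hf : DifferentiableAt ℝ f x) (hg : DifferentiableAt ℝ g x) :
    pd A (fun y => f y * g y) x = f x * pd A g x + pd A f x * g x := by
  simp only [pd]
  rw [fderiv_fun_mul' hf hg]; simp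

theorem pd_const_mul {𝔸 : Type*} [NormedRing 𝔸] [NormedAlgebra ℝ 𝔸] (A : Ix) (c : 𝔸)
    {f : Pt → 𝔸} {x : Pt} (hf : DifferentiableAt ℝ f x) :
    pd A (fun y => c * f y) x = c * pd A f x := by
  rw [pd_mul A (differentiableAt_const c) hf, pd_const, zero_mul, add_zero]

theorem pd_smul {𝕜 : Type*} [NontriviallyNormedField 𝕜] [NormedAlgebra ℝ 𝕜]
    [NormedSpace 𝕜 E] [IsScalarTower ℝ 𝕜 E] (A : Ix) {f : Pt → 𝕜} {g : Pt → E} {x : Pt}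
    (hf : DifferentiableAt ℝ f x) (hg : DifferentiableAt ℝ g x) :
    pd A (fun y => f y • g y) x = f x • pd A g x + pd A f x • g x := by
  simp only [pd]
  rw [fderiv_fun_smul hf hg]; simp

/-- The derivative of a function of one coordinate. -/
theorem pd_comp_coord (A C : Ix) {h : ℝ → E} {h' : E} {x : Pt} (hh : HasDerivAt h h' (x C)) :
    pd A (fun y => h (y C)) x = if A = C then h' else 0 := by
  have h1 : HasFDerivAt (fun y : Pt => y C) (ContinuousLinearMap.proj (R := ℝ) C) x :=
    (ContinuousLinearMap.proj (R := ℝ) (φ := fun _ : Ix => ℝ) C).hasFDerivAt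
  have h2 := hh.hasFDerivAt.comp x h1
  have h3 : fderiv ℝ (fun y : Pt => h (y C)) x = _ := h2.fderiv
  simp only [pd, h3]
  by_cases hAC : A = C
  · subst hAC; simp
  · simp [hAC]

theorem pd_coord (A C : Ix) (x : Pt) : pd A (fun y => y C) x = if A = C then (1 : ℝ) else 0 :=
  pd_comp_coord A C (hasDerivAt_id _)

theorem pd_coord_complex (A C : Ix) (x : Pt) :
    pd A (fun y => (y C : ℂ)) x = if A = C then (1 : ℂ) else 0 :=
  pd_comp_coord A C (h := fun t : ℝ => (t : ℂ)) (hasDerivAt_id _).ofReal_comp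

theorem pd_cos (A C : Ix) (l : ℂ) (x : Pt) :
    pd A (fun y => Complex.cos (l * y C)) x
      = if A = C then -(l * Complex.sin (l * x C)) else 0 := by
  refine pd_comp_coord A C (h := fun t : ℝ => Complex.cos (l * t)) ?_
  have h : HasDerivAt (fun t : ℂ => Complex.cos (l * t)) (-Complex.sin (l * x C) * (l * 1))
      (x C : ℂ) := ((hasDerivAt_id _).const_mul l).ccos
  simpa [mul_comm] using h.comp_ofReal

theorem pd_sin (A C : Ix) (l : ℂ) (x : Pt) :
    pd A (fun y => Complex.sin (l * y C)) x
      = if A = C then l * Complex.cos (l * x C) else 0 := by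
  refine pd_comp_coord A C (h := fun t : ℝ => Complex.sin (l * t)) ?_
  have h : HasDerivAt (fun t : ℂ => Complex.sin (l * t)) (Complex.cos (l * x C) * (l * 1))
      (x C : ℂ) := ((hasDerivAt_id _).const_mul l).csin
  simpa [mul_comm] using h.comp_ofReal

@[fun_prop]
theorem contDiff_coord_complex (C : Ix) : ContDiff ℝ ∞ (fun y : Pt => (y C : ℂ)) :=
  Complex.ofRealCLM.contDiff.comp (contDiff_apply ℝ ℝ C)

@[fun_prop]
theorem contDiff_cos_coord (C : Ix) (l : ℂ) :
    ContDiff ℝ ∞ (fun y : Pt => Complex.cos (l * y C)) :=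
  (Complex.contDiff_cos.restrict_scalars ℝ).comp
    (contDiff_const.mul (contDiff_coord_complex C))

@[fun_prop]
theorem contDiff_sin_coord (C : Ix) (l : ℂ) :
    ContDiff ℝ ∞ (fun y : Pt => Complex.sin (l * y C)) :=
  (Complex.contDiff_sin.restrict_scalars ℝ).comp
    (contDiff_const.mul (contDiff_coord_complex C))

@[fun_prop]
theorem differentiable_coord_complex (C : Ix) : Differentiable ℝ (fun y : Pt => (y C : ℂ)) :=
  differentiable_of_smooth (contDiff_coord_complex C)

@[fun_prop]
theorem differentiable_cos_coord (C : Ix) (l : ℂ) :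
    Differentiable ℝ (fun y : Pt => Complex.cos (l * y C)) :=
  differentiable_of_smooth (contDiff_cos_coord C l)

@[fun_prop]
theorem differentiable_sin_coord (C : Ix) (l : ℂ) :
    Differentiable ℝ (fun y : Pt => Complex.sin (l * y C)) :=
  differentiable_of_smooth (contDiff_sin_coord C l)

theorem fderiv_eq_sum_pd (f : Pt → E) (x v : Pt) : fderiv ℝ f x v = ∑ A, v A • pd A f x := by
  conv_lhs => rw [← Finset.univ_sum_single v]
  rw [map_sum]
  refine Finset.sum_congr rfl fun A _ => ?_
  rw [pd, ← map_smul]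
  congr 1
  ext C
  by_cases h : C = A
  · subst h; simp
  · simp [h]

/-- A function all of whose coordinate derivatives vanish is constant. -/
theorem eq_of_pd_eq_zero {f : Pt → E} (hf : Differentiable ℝ f) (h : ∀ A x, pd A f x = 0)
    (x y : Pt) : f x = f y := by
  refine is_const_of_fderiv_eq_zero hf (fun z => ?_) x y
  ext v
  rw [fderiv_eq_sum_pd]
  simp [h]

end Calculus

theorem sum_Ix {M : Type*} [AddCommMonoid M] (f : Ix → M) :
    ∑ A, f A = f ip + f im + ∑ i, f (iv i) := by
  rw [Fintype.sum_sum_type, Fin.sum_univ_two]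

/-! ### The metric for diagonal `B` -/

section Metric

variable (b : Fin 9 → ℝ)

theorem quad_diagonal (x : Pt) : quad (Matrix.diagonal b) x = ∑ i, b i * x (iv i) ^ 2 := by
  unfold quad
  refine Finset.sum_congr rfl fun i _ => ?_
  rw [Finset.sum_eq_single i]
  · simp; ring
  · intro j _ hj; simp [Matrix.diagonal_apply_ne' _ hj]
  · simp

theorem contDiff_quad : ContDiff ℝ ∞ (quad (Matrix.diagonal b)) := by
  have : quad (Matrix.diagonal b) = fun x => ∑ i, b i * x (iv i) ^ 2 :=
    funext (quad_diagonal b)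
  rw [this]
  fun_prop

theorem pd_quad (A : Ix) (x : Pt) : pd A (quad (Matrix.diagonal b)) x
    = Sum.elim (fun _ => 0) (fun i => 2 * b i * x (iv i)) A := by
  have : quad (Matrix.diagonal b) = fun x => ∑ i, b i * x (iv i) ^ 2 :=
    funext (quad_diagonal b)
  rw [this, pd_sum _ _ (by intros; fun_prop)]
  have h : ∀ i, pd A (fun y : Pt => b i * y (iv i) ^ 2) x
      = if A = iv i then b i * (2 * x (iv i)) else 0 := by
    intro i
    refine pd_comp_coord A (iv i) (h := fun t : ℝ => b i * t ^ 2) ?_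
    simpa using ((hasDerivAt_id (x (iv i))).pow 2).const_mul (b i)
  simp only [h]
  rcases A with k | j
  · simp
  · simp only [Sum.inr.injEq, iv, Sum.elim_inr]
    simp; ring

theorem metric_inv (x : Pt) : (metric (Matrix.diagonal b) x)⁻¹
    = Matrix.fromBlocks !![quad (Matrix.diagonal b) x, 1; 1, 0] 0 0 1 := by
  apply Matrix.inv_eq_right_inv
  rw [metric, Matrix.fromBlocks_multiply, ← Matrix.fromBlocks_one]
  congr 1 <;> simp [Matrix.one_fin_two]

/-- Only the component g₋₋ depends on the point, and only through the transverse coordinates. -/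
theorem pd_metric (A C E : Ix) (x : Pt) :
    pd A (fun y => metric (Matrix.diagonal b) y C E) x
      = if C = im ∧ E = im then Sum.elim (fun _ => 0) (fun i => -(2 * b i * x (iv i))) A
        else 0 := by
  rcases C with k | i <;> rcases E with l | j
  · have : (fun y => metric (Matrix.diagonal b) y (Sum.inl k) (Sum.inl l))
        = fun y => !![0, 1; 1, -quad (Matrix.diagonal b) y] k l := by
      ext y; simp [metric]
    rw [this]
    fin_cases k <;> fin_cases l <;> simp [im, pd_const, pd_neg, pd_quad]
    cases A <;> simp
  all_goals simp [metric, im, pd_const]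

/-- The only Christoffel symbols are `Γ^k_{--} = b_k x^k` and `Γ^+_{-k} = -b_k x^k`. -/
theorem christoffel_diagonal (x : Pt) (C A E : Ix) :
    christoffel (Matrix.diagonal b) x C A E =
      match C, A, E with
      | Sum.inr k, Sum.inl 1, Sum.inl 1 => b k * x (iv k)
      | Sum.inl 0, Sum.inl 1, Sum.inr k => -(b k * x (iv k))
      | Sum.inl 0, Sum.inr k, Sum.inl 1 => -(b k * x (iv k))
      | _, _, _ => 0 := by
  unfold christoffel
  rw [sum_Ix, metric_inv]
  simp only [pd_metric]
  rcases C with k | i <;> rcases A with l | j <;> rcases E with n | o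
  all_goals try fin_cases k
  all_goals try fin_cases l
  all_goals try fin_cases n
  all_goals simp [im, ip, iv, Matrix.one_apply]
  all_goals try ring

/-- The Levi-Civita derivative for diagonal `B`, componentwise. -/
theorem nablaVec_diagonal (A : Ix) (X : VField) (x : Pt) (C : Ix) :
    nablaVec (Matrix.diagonal b) A X x C = pd A (fun y => X y C) x +
      match C, A with
      | Sum.inr k, Sum.inl 1 => b k * x (iv k) * X x im
      | Sum.inl 0, Sum.inl 1 => -∑ k, b k * x (iv k) * X x (iv k)
      | Sum.inl 0, Sum.inr k => -(b k * x (iv k) * X x im)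
      | _, _ => 0 := by
  unfold nablaVec
  congr 1
  rw [sum_Ix]
  simp only [christoffel_diagonal]
  rcases C with k | i <;> rcases A with l | j
  all_goals try fin_cases k
  all_goals try fin_cases l
  all_goals simp [im, ip, iv]

end Metric

/-! ### The Clifford algebra -/

section Clifford

variable {S : Type*} [NormedAddCommGroup S] [NormedSpace ℂ S] {Γ : Ix → S →L[ℂ] S}

theorem gammaP_mul_gammaM : Γ ip * Γ im = -(2 : ℂ) • sigmaM Γ := by
  rw [sigmaM, smul_smul]; norm_num

theorem gammaM_mul_gammaP : Γ im * Γ ip = -(2 : ℂ) • sigmaP Γ := by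
  rw [sigmaP, smul_smul]; norm_num

section Relations

variable (hΓ : IsClifford Γ)
include hΓ

theorem gammaP_sq : Γ ip * Γ ip = 0 := by
  have h := hΓ ip ip
  simp only [eta, Matrix.fromBlocks_apply₁₁] at h
  have h2 : (2 : ℂ) • (Γ ip * Γ ip) = 0 := by rw [two_smul, h]; simp
  exact (smul_eq_zero.1 h2).resolve_left two_ne_zero

theorem gammaM_sq : Γ im * Γ im = 0 := by
  have h := hΓ im im
  simp only [eta, Matrix.fromBlocks_apply₁₁] at h
  have h2 : (2 : ℂ) • (Γ im * Γ im) = 0 := by rw [two_smul, h]; simp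
  exact (smul_eq_zero.1 h2).resolve_left two_ne_zero

theorem gammaM_mul_gammaP_eq_sub : Γ im * Γ ip = -(2 : ℂ) • 1 - Γ ip * Γ im := by
  have h := hΓ im ip
  simp only [eta, Matrix.fromBlocks_apply₁₁] at h
  rw [eq_sub_iff_add_eq, h]; simp

theorem gammaV_mul_gammaP (i : Fin 9) : Γ (iv i) * Γ ip = -(Γ ip * Γ (iv i)) := by
  have h := hΓ (iv i) ip
  simp only [eta, Matrix.fromBlocks_apply₂₁] at h
  rw [eq_neg_iff_add_eq_zero, h]; simp

theorem gammaV_mul_gammaM (i : Fin 9) : Γ (iv i) * Γ im = -(Γ im * Γ (iv i)) := by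
  have h := hΓ (iv i) im
  simp only [eta, Matrix.fromBlocks_apply₂₁] at h
  rw [eq_neg_iff_add_eq_zero, h]; simp

theorem gammaV_mul_gammaV (i j : Fin 9) : Γ (iv i) * Γ (iv j)
    = (if i = j then -(2 : ℂ) else 0) • 1 - Γ (iv j) * Γ (iv i) := by
  have h := hΓ (iv i) (iv j)
  simp only [eta, Matrix.fromBlocks_apply₂₂, Matrix.one_apply] at h
  rw [eq_sub_iff_add_eq, h]
  split_ifs <;> simp

theorem sigmaM_add_sigmaP : sigmaM Γ + sigmaP Γ = 1 := by
  rw [sigmaM, sigmaP, ← smul_add, gammaM_mul_gammaP_eq_sub hΓ, add_sub_cancel, smul_smul]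
  norm_num

theorem sigmaP_eq : sigmaP Γ = 1 - sigmaM Γ := by
  rw [← sigmaM_add_sigmaP hΓ]; abel

theorem gammaP_mul_sigmaM : Γ ip * sigmaM Γ = 0 := by
  rw [sigmaM, mul_smul_comm, ← mul_assoc, gammaP_sq hΓ]; simp

theorem sigmaP_mul_gammaP : sigmaP Γ * Γ ip = 0 := by
  rw [sigmaP, smul_mul_assoc, mul_assoc, gammaP_sq hΓ]; simp

theorem gammaM_mul_sigmaP : Γ im * sigmaP Γ = 0 := by
  rw [sigmaP, mul_smul_comm, ← mul_assoc, gammaM_sq hΓ]; simp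

theorem sigmaM_mul_gammaM : sigmaM Γ * Γ im = 0 := by
  rw [sigmaM, smul_mul_assoc, mul_assoc, gammaM_sq hΓ]; simp

theorem gammaP_mul_sigmaP : Γ ip * sigmaP Γ = Γ ip := by
  rw [sigmaP_eq hΓ, mul_sub, gammaP_mul_sigmaM hΓ]; simp

theorem sigmaM_mul_gammaP : sigmaM Γ * Γ ip = Γ ip := by
  have h := sigmaP_mul_gammaP hΓ
  rw [sigmaP_eq hΓ, sub_mul, sub_eq_zero] at h
  rw [← h, one_mul]

theorem gammaM_mul_sigmaM : Γ im * sigmaM Γ = Γ im := by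
  have h := gammaM_mul_sigmaP hΓ
  rw [sigmaP_eq hΓ, mul_sub, sub_eq_zero] at h
  rw [← h, mul_one]

theorem sigmaP_mul_gammaM : sigmaP Γ * Γ im = Γ im := by
  rw [sigmaP_eq hΓ, sub_mul, sigmaM_mul_gammaM hΓ]; simp

theorem sigmaM_mul_sigmaM : sigmaM Γ * sigmaM Γ = sigmaM Γ := by
  conv_lhs => rw [sigmaM, smul_mul_assoc, mul_assoc, ← sigmaM, gammaM_mul_sigmaM hΓ, ← sigmaM]

theorem sigmaM_mul_sigmaP : sigmaM Γ * sigmaP Γ = 0 := by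
  rw [sigmaP_eq hΓ, mul_sub, sigmaM_mul_sigmaM hΓ]; simp

theorem sigmaP_mul_sigmaM : sigmaP Γ * sigmaM Γ = 0 := by
  rw [sigmaP_eq hΓ, sub_mul, sigmaM_mul_sigmaM hΓ]; simp

theorem sigmaP_mul_sigmaP : sigmaP Γ * sigmaP Γ = sigmaP Γ := by
  conv_lhs => rw [sigmaP_eq hΓ, sub_mul, ← sigmaP_eq hΓ, sigmaM_mul_sigmaP hΓ]
  simp

theorem gammaV_mul_sigmaM (i : Fin 9) : Γ (iv i) * sigmaM Γ = sigmaM Γ * Γ (iv i) := by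
  rw [sigmaM, mul_smul_comm, smul_mul_assoc, ← mul_assoc, gammaV_mul_gammaP hΓ, neg_mul,
    mul_assoc, gammaV_mul_gammaM hΓ, mul_neg, neg_neg, mul_assoc]

theorem gammaV_mul_sigmaP (i : Fin 9) : Γ (iv i) * sigmaP Γ = sigmaP Γ * Γ (iv i) := by
  rw [sigmaP_eq hΓ, mul_sub, sub_mul, gammaV_mul_sigmaM hΓ]; simp

theorem gam_commute_sigmaM (i : Fin 9) : Commute (gam Γ i) (sigmaM Γ) := by
  unfold Commute SemiconjBy
  rw [gam, mul_assoc, sub_mul, sigmaM_mul_sigmaM hΓ, sigmaP_mul_sigmaM hΓ, ← mul_assoc,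
    ← gammaV_mul_sigmaM hΓ, mul_assoc, mul_sub (sigmaM Γ), sigmaM_mul_sigmaM hΓ,
    sigmaM_mul_sigmaP hΓ]

theorem gam_commute_sigmaP (i : Fin 9) : Commute (gam Γ i) (sigmaP Γ) := by
  rw [sigmaP_eq hΓ]
  exact (Commute.one_right _).sub_right (gam_commute_sigmaM hΓ i)

theorem gammaP_mul_gam (i : Fin 9) : Γ ip * gam Γ i = -(Γ ip * Γ (iv i)) := by
  rw [gam, mul_sub, mul_sub, gammaV_mul_sigmaM hΓ, gammaV_mul_sigmaP hΓ, ← mul_assoc,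
    gammaP_mul_sigmaM hΓ, ← mul_assoc (Γ ip), gammaP_mul_sigmaP hΓ]
  simp

theorem gam_commute_gammaP (i : Fin 9) : Commute (gam Γ i) (Γ ip) := by
  unfold Commute SemiconjBy
  rw [gammaP_mul_gam hΓ, gam, mul_assoc, sub_mul, sigmaM_mul_gammaP hΓ, sigmaP_mul_gammaP hΓ,
    sub_zero, gammaV_mul_gammaP hΓ]

theorem gam_commute_gammaM (i : Fin 9) : Commute (gam Γ i) (Γ im) := by
  unfold Commute SemiconjBy
  have h : Γ im * gam Γ i = Γ im * Γ (iv i) := by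
    rw [gam, mul_sub, mul_sub, gammaV_mul_sigmaM hΓ, gammaV_mul_sigmaP hΓ, ← mul_assoc,
      gammaM_mul_sigmaM hΓ, ← mul_assoc (Γ im), gammaM_mul_sigmaP hΓ]
    simp
  rw [h, gam, mul_assoc, sub_mul, sigmaM_mul_gammaM hΓ, sigmaP_mul_gammaM hΓ, zero_sub, mul_neg,
    gammaV_mul_gammaM hΓ, neg_neg]

/-- The twist σ₋ - σ₊ commutes with Γ_i and squares to 1, so it cancels in products of two vectors.
Rotations therefore have the same spin lift in terms of Γ_i and of γ_i. -/
theorem gammaV_mul_gammaV_eq_gam (i j : Fin 9) : Γ (iv i) * Γ (iv j) = gam Γ i * gam Γ j := by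
  have h : (sigmaM Γ - sigmaP Γ) * (sigmaM Γ - sigmaP Γ) = 1 := by
    rw [mul_sub, sub_mul, sub_mul, sigmaM_mul_sigmaM hΓ, sigmaM_mul_sigmaP hΓ,
      sigmaP_mul_sigmaM hΓ, sigmaP_mul_sigmaP hΓ, ← sigmaM_add_sigmaP hΓ]
    abel
  have h2 : (sigmaM Γ - sigmaP Γ) * Γ (iv j) = Γ (iv j) * (sigmaM Γ - sigmaP Γ) := by
    rw [mul_sub, sub_mul, gammaV_mul_sigmaM hΓ, gammaV_mul_sigmaP hΓ]
  rw [gam, gam, mul_assoc, ← mul_assoc _ (Γ (iv j)), h2, mul_assoc (Γ (iv j)), h, mul_one]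

theorem gam_mul_gam (i j : Fin 9) : gam Γ i * gam Γ j
    = (if i = j then -(2 : ℂ) else 0) • 1 - gam Γ j * gam Γ i := by
  rw [← gammaV_mul_gammaV_eq_gam hΓ, ← gammaV_mul_gammaV_eq_gam hΓ, gammaV_mul_gammaV hΓ]

theorem gam_mul_self (i : Fin 9) : gam Γ i * gam Γ i = -1 := by
  have h := gam_mul_gam hΓ i i
  rw [eq_sub_iff_add_eq, ← two_smul ℂ, if_pos rfl] at h
  have h2 : (2 : ℂ) • (gam Γ i * gam Γ i - -1) = 0 := by
    rw [smul_sub, h]; simp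
  exact sub_eq_zero.1 ((smul_eq_zero.1 h2).resolve_left two_ne_zero)

theorem gam_mul_gam_of_ne {i j : Fin 9} (hij : i ≠ j) :
    gam Γ i * gam Γ j = -(gam Γ j * gam Γ i) := by
  rw [gam_mul_gam hΓ, if_neg hij]; simp

theorem gam123_commute_gammaP : Commute (gam123 Γ) (Γ ip) :=
  ((gam_commute_gammaP hΓ 0).mul_left (gam_commute_gammaP hΓ 1)).mul_left
    (gam_commute_gammaP hΓ 2)

theorem gam123_commute_gammaM : Commute (gam123 Γ) (Γ im) :=
  ((gam_commute_gammaM hΓ 0).mul_left (gam_commute_gammaM hΓ 1)).mul_left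
    (gam_commute_gammaM hΓ 2)

theorem gam123_commute_sigmaM : Commute (gam123 Γ) (sigmaM Γ) :=
  ((gam_commute_sigmaM hΓ 0).mul_left (gam_commute_sigmaM hΓ 1)).mul_left
    (gam_commute_sigmaM hΓ 2)

theorem gam123_commute_sigmaP : Commute (gam123 Γ) (sigmaP Γ) :=
  ((gam_commute_sigmaP hΓ 0).mul_left (gam_commute_sigmaP hΓ 1)).mul_left
    (gam_commute_sigmaP hΓ 2)

end Relations

/-- The sign with which `γ_i` commutes with `γ₁₂₃`. -/
def sgn (i : Fin 9) : ℂ := if i.val < 3 then 1 else -1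

theorem sgn_mul_self (i : Fin 9) : sgn i * sgn i = 1 := by
  unfold sgn; split_ifs <;> norm_num

section Relations

variable (hΓ : IsClifford Γ)
include hΓ

/-- Moving γ_i through three factors costs three signs when i lies outside {0, 1, 2}, but only two
when γ_i is itself one of the factors. -/
theorem gam123_mul_gam (i : Fin 9) : gam123 Γ * gam Γ i = sgn i • (gam Γ i * gam123 Γ) := by
  unfold gam123 sgn
  have sw : ∀ {i j : Fin 9}, i ≠ j → ∀ T : S →L[ℂ] S,
      gam Γ i * (gam Γ j * T) = -(gam Γ j * (gam Γ i * T)) := by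
    intro i j hij T
    rw [← mul_assoc, gam_mul_gam_of_ne hΓ hij, neg_mul, mul_assoc]
  by_cases h : i.val < 3
  · rw [if_pos h, one_smul]
    have : i = 0 ∨ i = 1 ∨ i = 2 := by omega
    rcases this with rfl | rfl | rfl
    · simp only [mul_assoc]
      rw [gam_mul_gam_of_ne hΓ (show (2 : Fin 9) ≠ 0 by decide), mul_neg, mul_neg,
        sw (show (1 : Fin 9) ≠ 0 by decide), mul_neg, neg_neg]
    · simp only [mul_assoc]
      rw [gam_mul_gam_of_ne hΓ (show (2 : Fin 9) ≠ 1 by decide), mul_neg, mul_neg,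
        sw (show (1 : Fin 9) ≠ 0 by decide)]
    · simp only [mul_assoc]
      rw [sw (show (2 : Fin 9) ≠ 0 by decide), sw (show (2 : Fin 9) ≠ 1 by decide), mul_neg,
        neg_neg]
  · rw [if_neg h, neg_smul, one_smul]
    have h0 : (0 : Fin 9) ≠ i := by rintro rfl; exact h (by decide)
    have h1 : (1 : Fin 9) ≠ i := by rintro rfl; exact h (by decide)
    have h2 : (2 : Fin 9) ≠ i := by rintro rfl; exact h (by decide)
    simp only [mul_assoc]
    rw [gam_mul_gam_of_ne hΓ h2, mul_neg, mul_neg, sw h1, mul_neg, sw h0, neg_neg]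

theorem gam_mul_gam123 (i : Fin 9) : gam Γ i * gam123 Γ = sgn i • (gam123 Γ * gam Γ i) := by
  rw [gam123_mul_gam hΓ, smul_smul, sgn_mul_self, one_smul]

theorem gam123_sq : gam123 Γ * gam123 Γ = 1 := by
  have h2 : gam123 Γ * gam Γ 2 = gam Γ 2 * gam123 Γ := by
    simpa [sgn] using gam123_mul_gam hΓ 2
  have h1 : gam123 Γ * gam Γ 1 = gam Γ 1 * gam123 Γ := by
    simpa [sgn] using gam123_mul_gam hΓ 1
  have h0 : gam123 Γ * gam Γ 0 = gam Γ 0 * gam123 Γ := by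
    simpa [sgn] using gam123_mul_gam hΓ 0
  have e0 := gam_mul_self hΓ 0
  have e1 := gam_mul_self hΓ 1
  have e2 := gam_mul_self hΓ 2
  have e01 := gam_mul_gam_of_ne hΓ (show (1 : Fin 9) ≠ 0 by decide)
  calc gam123 Γ * gam123 Γ = gam123 Γ * gam Γ 0 * gam Γ 1 * gam Γ 2 := by
        conv_lhs => rw [show gam123 Γ * gam123 Γ = gam123 Γ * (gam Γ 0 * gam Γ 1 * gam Γ 2) from rfl]
        simp only [mul_assoc]
    _ = gam Γ 0 * gam Γ 1 * gam123 Γ * gam Γ 2 := by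
        rw [h0, mul_assoc (gam Γ 0), h1, ← mul_assoc]
    _ = gam Γ 0 * (gam Γ 1 * gam Γ 0) * gam Γ 1 * (gam Γ 2 * gam Γ 2) := by
        rw [gam123]; simp only [mul_assoc]
    _ = (gam Γ 0 * gam Γ 0) * (gam Γ 1 * gam Γ 1) := by
        rw [e01, e2]; simp [mul_assoc]
    _ = 1 := by rw [e0, e1]; simp

end Relations

/-! ### Adjoints with respect to a charge conjugation -/

/-- `T'` is the adjoint of `T` with respect to the bilinear form `C`. -/
def IsAdj (C : S →ₗ[ℂ] S →ₗ[ℂ] ℂ) (T T' : S →L[ℂ] S) : Prop :=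
  ∀ s t, C (T s) t = C s (T' t)

namespace IsAdj

variable {C : S →ₗ[ℂ] S →ₗ[ℂ] ℂ} {T T' U U' : S →L[ℂ] S}

theorem mul (hT : IsAdj C T T') (hU : IsAdj C U U') : IsAdj C (T * U) (U' * T') := by
  intro s t
  exact (hT _ _).trans (hU _ _)

theorem add (hT : IsAdj C T T') (hU : IsAdj C U U') : IsAdj C (T + U) (T' + U') := by
  intro s t
  simp [hT s t, hU s t]

theorem sub (hT : IsAdj C T T') (hU : IsAdj C U U') : IsAdj C (T - U) (T' - U') := by
  intro s t
  simp [hT s t, hU s t]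

theorem smul (z : ℂ) (hT : IsAdj C T T') : IsAdj C (z • T) (z • T') := by
  intro s t
  simp [hT s t]

theorem sum {ι : Type*} (s : Finset ι) {T T' : ι → S →L[ℂ] S} (h : ∀ i ∈ s, IsAdj C (T i) (T' i)) :
    IsAdj C (∑ i ∈ s, T i) (∑ i ∈ s, T' i) := by
  intro x y
  simp only [sum_apply, map_sum, LinearMap.sum_apply]
  exact Finset.sum_congr rfl fun i hi => h i hi x y

/-- For a skew form, `C s (T t)` is symmetric if `T` is skew-adjoint. -/
theorem symm_of_neg (hT : IsAdj C T (-T)) (hC : ∀ s t, C s t = -C t s) (s t : S) :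
    C s (T t) = C t (T s) := by
  have h := hT s t
  rw [hC t (T s), h]; simp

end IsAdj

section Adjoints

variable {C : S →ₗ[ℂ] S →ₗ[ℂ] ℂ} (hC : IsChargeConj Γ C) (hΓ : IsClifford Γ)
include hC

theorem isAdj_gamma (A : Ix) : IsAdj C (Γ A) (-Γ A) := by
  intro s t
  rw [hC.2.2]; simp

theorem isAdj_sigmaM : IsAdj C (sigmaM Γ) (sigmaP Γ) := by
  have h := ((isAdj_gamma hC ip).mul (isAdj_gamma hC im)).smul (-(1 / 2))
  rwa [neg_mul_neg] at h

theorem isAdj_sigmaP : IsAdj C (sigmaP Γ) (sigmaM Γ) := by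
  have h := ((isAdj_gamma hC im).mul (isAdj_gamma hC ip)).smul (-(1 / 2))
  rwa [neg_mul_neg] at h

include hΓ

/-- The adjoint exchanges σ₋ and σ₊, so the twist changes sign and compensates the sign of the
skew-adjoint Γ_i. -/
theorem isAdj_gam (i : Fin 9) : IsAdj C (gam Γ i) (gam Γ i) := by
  have h := (isAdj_gamma hC (iv i)).mul ((isAdj_sigmaM hC).sub (isAdj_sigmaP hC))
  have e : (sigmaP Γ - sigmaM Γ) * -Γ (iv i) = gam Γ i := by
    rw [gam, mul_neg, ← neg_mul, neg_sub, mul_sub, sub_mul, gammaV_mul_sigmaM hΓ,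
      gammaV_mul_sigmaP hΓ]
  rwa [e] at h

/-- The factors are self-adjoint; reversing the order of three anticommuting factors is an odd
permutation. -/
theorem isAdj_gam123 : IsAdj C (gam123 Γ) (-gam123 Γ) := by
  have h := ((isAdj_gam hC hΓ 0).mul (isAdj_gam hC hΓ 1)).mul (isAdj_gam hC hΓ 2)
  have e : gam Γ 2 * (gam Γ 1 * gam Γ 0) = -gam123 Γ := by
    have h12 := gam_mul_gam_of_ne hΓ (show (2 : Fin 9) ≠ 1 by decide)
    have h02 := gam_mul_gam_of_ne hΓ (show (2 : Fin 9) ≠ 0 by decide)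
    have h01 := gam_mul_gam_of_ne hΓ (show (1 : Fin 9) ≠ 0 by decide)
    rw [gam123, h01, mul_neg, ← mul_assoc, h02, neg_mul, neg_neg, mul_assoc, h12, mul_neg,
      ← mul_assoc]
  rwa [e] at h

end Adjoints

end Clifford

/-! ### The parameters -/

/-- The diagonal entries of `famB`. -/
def famDiag (α β : ℂ) (i : Fin 9) : ℝ :=
  -(if i.val < 3 then ((α - β) ^ 2).re else ((α + β) ^ 2).re)

theorem famB_eq (α β : ℂ) : famB α β = Matrix.diagonal (famDiag α β) := by
  rw [famB, Matrix.diagonal_neg]; rfl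

theorem famDiag_eq_lam_sq {α β : ℂ} (h : Admissible α β) (i : Fin 9) :
    (famDiag α β i : ℂ) = lam α β i ^ 2 := by
  have re_of : ∀ z : ℂ, z.im = 0 → (z.re : ℂ) = z := fun z hz => Complex.ext rfl (by simp [hz])
  unfold famDiag lam
  split_ifs
  · rw [Complex.ofReal_neg, re_of _ h.1, mul_pow, neg_sq, Complex.I_sq]; ring
  · rw [Complex.ofReal_neg, re_of _ h.2.1, mul_pow, neg_sq, Complex.I_sq]; ring

theorem lam_ne_zero {α β : ℂ} (h : Admissible α β) (i : Fin 9) : lam α β i ≠ 0 := by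
  unfold lam
  split_ifs
  · exact mul_ne_zero (neg_ne_zero.2 Complex.I_ne_zero) (sub_ne_zero.2 h.2.2.1)
  · exact mul_ne_zero (neg_ne_zero.2 Complex.I_ne_zero)
      (fun h0 => h.2.2.2 (eq_neg_of_add_eq_zero_left h0))

theorem famDiag_ne_zero {α β : ℂ} (h : Admissible α β) (i : Fin 9) : famDiag α β i ≠ 0 := by
  intro h0
  have := famDiag_eq_lam_sq h i
  rw [h0, Complex.ofReal_zero] at this
  exact lam_ne_zero h i (pow_eq_zero_iff two_ne_zero |>.1 this.symm)

theorem lam_congr (α β : ℂ) {i j : Fin 9} (h : i.val < 3 ↔ j.val < 3) :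
    lam α β i = lam α β j := by
  unfold lam; simp only [h]

theorem sgn_congr {i j : Fin 9} (h : i.val < 3 ↔ j.val < 3) : sgn i = sgn j := by
  unfold sgn; simp only [h]

/-- `α - ε_i β = i λ_i`. -/
theorem sub_sgn_mul (α β : ℂ) (i : Fin 9) : α - sgn i * β = Complex.I * lam α β i := by
  unfold sgn lam
  split_ifs
  · rw [← mul_assoc, mul_neg, Complex.I_mul_I]; ring
  · rw [← mul_assoc, mul_neg, Complex.I_mul_I]; ring

/-! ### The Killing equations for diagonal `B` -/

/-- The conditions are the equations with index pairs ++, +-, +i, --, -i, ij. The first one has been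
used to remove the quadratic term from the second, and the -- equation has been halved. -/
theorem isKilling_diagonal_iff (b : Fin 9 → ℝ) (X : VField) :
    IsKilling (Matrix.diagonal b) X ↔ ContDiff ℝ ∞ X ∧ ∀ x,
      pd ip (fun y => X y im) x = 0 ∧
      pd ip (fun y => X y ip) x + pd im (fun y => X y im) x = 0 ∧
      (∀ i, pd ip (fun y => X y (iv i)) x + pd (iv i) (fun y => X y im) x = 0) ∧
      pd im (fun y => X y ip) x - quad (Matrix.diagonal b) x * pd im (fun y => X y im) x
        = ∑ i, b i * x (iv i) * X x (iv i) ∧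
      (∀ i, pd (iv i) (fun y => X y ip) x
        - quad (Matrix.diagonal b) x * pd (iv i) (fun y => X y im) x
        + pd im (fun y => X y (iv i)) x = 0) ∧
      ∀ i j, pd (iv i) (fun y => X y (iv j)) x + pd (iv j) (fun y => X y (iv i)) x = 0 := by
  have hmat : ∀ (A C : Ix) (x : Pt), (metric (Matrix.diagonal b) x A C : ℂ) =
      match A, C with
      | Sum.inl 0, Sum.inl 1 => 1
      | Sum.inl 1, Sum.inl 0 => 1
      | Sum.inl 1, Sum.inl 1 => -(quad (Matrix.diagonal b) x : ℂ)
      | Sum.inr i, Sum.inr j => if i = j then 1 else 0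
      | _, _ => 0 := by
    intro A C x
    rcases A with k | i <;> rcases C with l | j
    all_goals try fin_cases k
    all_goals try fin_cases l
    all_goals simp [metric, Matrix.one_apply]
    split_ifs <;> simp
  unfold IsKilling
  refine and_congr_right fun _ => forall_congr' fun x => ?_
  simp only [sum_Ix, pd_metric, hmat]
  constructor
  · intro h
    have hpp := h ip ip
    have hpm := h ip im
    have hpi := fun i => h ip (iv i)
    have hmm := h im im
    have hmi := fun i => h im (iv i)
    have hij := fun i j => h (iv i) (iv j)
    simp [ip, im, iv, Finset.sum_add_distrib] at hpp hpm hpi hmm hmi hij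
    simp only [ip, im, iv]
    refine ⟨hpp, ?_, fun i => ?_, ?_, fun i => ?_, fun i j => ?_⟩
    · linear_combination hpm + (quad (Matrix.diagonal b) x : ℂ) * hpp
    · linear_combination hpi i
    · have e : ∑ i, X x (Sum.inr i) * (2 * (b i : ℂ) * (x (Sum.inr i) : ℂ))
          = 2 * ∑ i, b i * x (Sum.inr i) * X x (Sum.inr i) := by
        rw [Finset.mul_sum]; exact Finset.sum_congr rfl fun i _ => by ring
      rw [e] at hmm
      linear_combination (1 / 2 : ℂ) * hmm
    · linear_combination hmi i
    · linear_combination hij i j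
  · rintro ⟨h1, h2, h3, h4, h5, h6⟩ A C
    rcases A with k | i <;> rcases C with l | j
    all_goals try fin_cases k
    all_goals try fin_cases l
    all_goals simp [ip, im, iv, Finset.sum_add_distrib] at h1 h2 h3 h4 h5 h6 ⊢
    · exact h1
    · linear_combination h2 - (quad (Matrix.diagonal b) x : ℂ) * h1
    · linear_combination h2 - (quad (Matrix.diagonal b) x : ℂ) * h1
    · have e : ∑ i, X x (Sum.inr i) * (2 * (b i : ℂ) * (x (Sum.inr i) : ℂ))
          = 2 * ∑ i, b i * x (Sum.inr i) * X x (Sum.inr i) := by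
        rw [Finset.mul_sum]; exact Finset.sum_congr rfl fun i _ => by ring
      rw [e]
      linear_combination 2 * h4
    · linear_combination h3 j
    · linear_combination h5 j
    · linear_combination h3 i
    · linear_combination h5 i
    · linear_combination h6 i j

/-! ### The Killing fields in closed form -/

/-- The matrices `w` which enter the rotational part: skew-symmetric and block diagonal. -/
def IsRot (w : Fin 9 → Fin 9 → ℂ) : Prop :=
  (∀ i j, w i j = -w j i) ∧ ∀ i j, ¬(i.val < 3 ↔ j.val < 3) → w i j = 0

/-- A block diagonal matrix commutes with a diagonal matrix that is constant on the blocks. This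
lets λ_i, its functions and the signs `sgn i` pass through rotations. -/
theorem IsRot.mul_eq {w : Fin 9 → Fin 9 → ℂ} (hw : IsRot w) {f : Fin 9 → ℂ}
    (hf : ∀ {i j : Fin 9}, (i.val < 3 ↔ j.val < 3) → f i = f j) (i j : Fin 9) :
    f i * w i j = f j * w i j := by
  by_cases h : i.val < 3 ↔ j.val < 3
  · rw [hf h]
  · rw [hw.2 i j h]; simp

/-- The vector field
`a K₍₊₎ + b K₍₋₎ + ∑ p_i K₍ᵢ₎ + ∑ q_i K₍ᵢ*₎ + ½ ∑ w_{ij} K₍ᵢⱼ₎` in components. -/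
def killField (l : Fin 9 → ℂ) (a b : ℂ) (p q : Fin 9 → ℂ) (w : Fin 9 → Fin 9 → ℂ) : VField :=
  fun x => Sum.elim
    (fun k => if k = 0 then
      -a + ∑ i, (p i * l i * Complex.sin (l i * x im) + q i * l i ^ 2 * Complex.cos (l i * x im))
        * x (iv i) else -b)
    (fun i => p i * Complex.cos (l i * x im) - q i * l i * Complex.sin (l i * x im)
      + ∑ j, w i j * x (iv j))

section KillField

variable (l : Fin 9 → ℂ) (a b : ℂ) (p q : Fin 9 → ℂ) (w : Fin 9 → Fin 9 → ℂ) (x : Pt)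

theorem killField_ip : killField l a b p q w x ip = -a + ∑ i, (p i * l i * Complex.sin (l i * x im)
    + q i * l i ^ 2 * Complex.cos (l i * x im)) * x (iv i) := rfl

theorem killField_im : killField l a b p q w x im = -b := rfl

theorem killField_iv (i : Fin 9) : killField l a b p q w x (iv i) = p i * Complex.cos (l i * x im)
    - q i * l i * Complex.sin (l i * x im) + ∑ j, w i j * x (iv j) := rfl

theorem Ix_ext {V W : Ix → ℂ} (h1 : V ip = W ip) (h2 : V im = W im)
    (h3 : ∀ i, V (iv i) = W (iv i)) : V = W := by
  funext A
  rcases A with k | i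
  · fin_cases k
    exacts [h1, h2]
  · exact h3 i

/-- In the double sum each pair of indices occurs in both orders with equal contributions, since w
and K₍ᵢⱼ₎ are both skew; the factor ½ corrects for this. -/
theorem killField_eq (hw : ∀ i j, w i j = -w j i) : killField l a b p q w =
    a • Kp + b • Km + (∑ i, p i • Kv l i) + (∑ i, q i • Ks l i)
      + (1 / 2 : ℂ) • ∑ i, ∑ j, w i j • Kr i j := by
  funext x
  refine Ix_ext ?_ ?_ fun k => ?_
  · rw [killField_ip]
    simp [Kp, Km, Kv, Ks, Kr, Finset.sum_apply, Finset.sum_add_distrib, add_mul]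
    rw [add_assoc]
    congr 2 <;> exact Finset.sum_congr rfl fun i _ => by ring
  · rw [killField_im]
    simp [Kp, Km, Kv, Ks, Kr, Finset.sum_apply]
  · rw [killField_iv]
    have e : ∑ i, w i k * (x (iv i) : ℂ) = -∑ i, w k i * (x (iv i) : ℂ) := by
      rw [← Finset.sum_neg_distrib]
      exact Finset.sum_congr rfl fun i _ => by rw [hw i k]; ring
    simp [Kp, Km, Kv, Ks, Kr, Finset.sum_apply, Pi.single_apply, mul_sub,
      Finset.sum_sub_distrib]
    simp only [iv] at e ⊢
    rw [e]
    ring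

theorem killField_add (a' b' : ℂ) (p' q' : Fin 9 → ℂ) (w' : Fin 9 → Fin 9 → ℂ) :
    killField l a b p q w + killField l a' b' p' q' w'
      = killField l (a + a') (b + b') (p + p') (q + q') (w + w') := by
  funext x
  refine Ix_ext ?_ ?_ fun k => ?_
  · simp only [Pi.add_apply, killField_ip, add_mul, Finset.sum_add_distrib]; ring
  · simp only [Pi.add_apply, killField_im]; ring
  · simp only [Pi.add_apply, killField_iv, add_mul, Finset.sum_add_distrib]; ring

theorem killField_smul (z : ℂ) : z • killField l a b p q w
    = killField l (z * a) (z * b) (z • p) (z • q) (z • w) := by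
  funext x
  refine Ix_ext ?_ ?_ fun k => ?_
  · simp only [Pi.smul_apply, smul_eq_mul, killField_ip, mul_add, Finset.mul_sum]
    congr 1
    · ring
    · exact Finset.sum_congr rfl fun i _ => by ring
  · simp only [Pi.smul_apply, smul_eq_mul, killField_im]; ring
  · simp only [Pi.smul_apply, smul_eq_mul, killField_iv, mul_add, mul_sub, Finset.mul_sum]
    congr 1
    · ring
    · exact Finset.sum_congr rfl fun i _ => by ring

theorem contDiff_killField : ContDiff ℝ ∞ (killField l a b p q w) := by
  rw [contDiff_pi]
  rintro (k | i)
  · fin_cases k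
    · change ContDiff ℝ ∞ fun x : Pt => -a + ∑ i, (p i * l i * Complex.sin (l i * x im)
        + q i * l i ^ 2 * Complex.cos (l i * x im)) * x (iv i)
      fun_prop
    · exact contDiff_const
  · change ContDiff ℝ ∞ fun x : Pt => p i * Complex.cos (l i * x im)
      - q i * l i * Complex.sin (l i * x im) + ∑ j, w i j * (x (iv j) : ℂ)
    fun_prop

theorem pd_killField_im (A : Ix) : pd A (fun y => killField l a b p q w y im) x = 0 :=
  pd_const A (-b) x

theorem pd_killField_ip (A : Ix) : pd A (fun y => killField l a b p q w y ip) x =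
    Sum.elim (fun k => if k = 0 then 0 else
      ∑ i, (p i * l i ^ 2 * Complex.cos (l i * x im) - q i * l i ^ 3 * Complex.sin (l i * x im))
        * x (iv i))
      (fun i => p i * l i * Complex.sin (l i * x im) + q i * l i ^ 2 * Complex.cos (l i * x im))
      A := by
  have h1 : ∀ i, pd A (fun y : Pt => (p i * l i * Complex.sin (l i * y im)
      + q i * l i ^ 2 * Complex.cos (l i * y im)) * (y (iv i) : ℂ)) x
      = (p i * l i * Complex.sin (l i * x im) + q i * l i ^ 2 * Complex.cos (l i * x im))
        * (if A = iv i then 1 else 0)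
      + (if A = im then p i * l i ^ 2 * Complex.cos (l i * x im)
          - q i * l i ^ 3 * Complex.sin (l i * x im) else 0) * x (iv i) := by
    intro i
    rw [pd_mul A (by fun_prop) (by fun_prop), pd_add A (by fun_prop) (by fun_prop),
      pd_const_mul A _ (by fun_prop), pd_const_mul A _ (by fun_prop),
      pd_sin, pd_cos, pd_coord_complex]
    split_ifs <;> ring
  have h2 : pd A (fun y => killField l a b p q w y ip) x = ∑ i,
      pd A (fun y : Pt => (p i * l i * Complex.sin (l i * y im)
      + q i * l i ^ 2 * Complex.cos (l i * y im)) * (y (iv i) : ℂ)) x := by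
    simp only [killField_ip]
    rw [pd_add A (by fun_prop) (by fun_prop), pd_const, zero_add,
      pd_sum _ _ (by intros; fun_prop)]
  rw [h2]
  simp only [h1]
  rcases A with k | i
  · fin_cases k <;> simp [im, iv]
  · simp [im, iv]

theorem pd_killField_iv (A : Ix) (i : Fin 9) :
    pd A (fun y => killField l a b p q w y (iv i)) x =
    Sum.elim (fun k => if k = 0 then 0 else
      -(p i * l i * Complex.sin (l i * x im)) - q i * l i ^ 2 * Complex.cos (l i * x im))
      (fun j => w i j) A := by
  simp only [killField_iv]
  rw [pd_add A (by fun_prop) (by fun_prop), pd_sub A (by fun_prop) (by fun_prop),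
    pd_const_mul A _ (by fun_prop), pd_const_mul A _ (by fun_prop),
    pd_sin, pd_cos, pd_sum _ _ (by intros; fun_prop)]
  have h1 : ∀ j, pd A (fun y : Pt => w i j * (y (iv j) : ℂ)) x
      = if A = iv j then w i j else 0 := by
    intro j
    rw [pd_const_mul A _ (by fun_prop), pd_coord_complex]
    split_ifs <;> ring
  simp only [h1]
  rcases A with k | j
  · fin_cases k
    · simp [im, iv]
    · simp [im, iv]; ring
  · simp [im, iv]

variable {l w}

/-- Skewness of w makes it an infinitesimal rotation, and commuting with diag(l²) makes it preserve
the quadratic function in g₋₋. The second property is needed only in the -- equation. -/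
theorem isKilling_killField {B : Fin 9 → ℝ} (hB : ∀ i, (B i : ℂ) = l i ^ 2)
    (hw : ∀ i j, w i j = -w j i) (hlw : ∀ i j, l i ^ 2 * w i j = l j ^ 2 * w i j) :
    IsKilling (Matrix.diagonal B) (killField l a b p q w) := by
  rw [isKilling_diagonal_iff]
  refine ⟨contDiff_killField l a b p q w, fun x => ⟨?_, ?_, fun i => ?_, ?_, fun i => ?_,
    fun i j => ?_⟩⟩
  · rw [pd_killField_im]
  · rw [pd_killField_im, pd_killField_ip]; simp
  · rw [pd_killField_im, pd_killField_iv]; simp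
  · rw [pd_killField_im, pd_killField_ip]
    simp only [killField_iv, hB, mul_add, Finset.sum_add_distrib]
    have e : ∑ i, l i ^ 2 * (x (iv i) : ℂ) * ∑ j, w i j * (x (iv j) : ℂ) = 0 := by
      have e1 : ∑ i, l i ^ 2 * (x (iv i) : ℂ) * ∑ j, w i j * (x (iv j) : ℂ)
          = ∑ i, ∑ j, l i ^ 2 * w i j * x (iv i) * x (iv j) := by
        refine Finset.sum_congr rfl fun i _ => ?_
        rw [Finset.mul_sum]
        exact Finset.sum_congr rfl fun j _ => by ring
      -- After exchanging i and j, skewness gives a sign and the commutation hypothesis restores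
      -- l_i², so the sum is its own negative.
      have e2 : ∑ i, ∑ j, l i ^ 2 * w i j * x (iv i) * x (iv j)
          = -∑ i, ∑ j, l i ^ 2 * w i j * (x (iv i) : ℂ) * x (iv j) := by
        conv_lhs => rw [Finset.sum_comm]
        rw [← Finset.sum_neg_distrib]
        refine Finset.sum_congr rfl fun i _ => ?_
        rw [← Finset.sum_neg_distrib]
        refine Finset.sum_congr rfl fun j _ => ?_
        have h := hlw i j
        rw [hw j i]
        linear_combination (x (iv i) : ℂ) * x (iv j) * h
      rw [e1]
      exact self_eq_neg.1 e2
    rw [e]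
    simp [im]
    exact Finset.sum_congr rfl fun i _ => by ring
  · rw [pd_killField_im, pd_killField_ip, pd_killField_iv]; simp [im]
  · rw [pd_killField_iv, pd_killField_iv]; simp [hw i j]

theorem IsRot.sum_mul_eq (hw : IsRot w) (F : Fin 9 → ℂ) :
    ∑ k, (∑ j, w k j * (x (iv j) : ℂ)) * F k = ∑ i, (-∑ j, w i j * F j) * x (iv i) := by
  simp only [Finset.sum_mul]
  rw [Finset.sum_comm]
  refine Finset.sum_congr rfl fun i _ => ?_
  rw [← Finset.sum_neg_distrib, Finset.sum_mul]
  exact Finset.sum_congr rfl fun j _ => by rw [hw.1 j i]; ring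

/-- The bracket of two Killing fields in closed form. -/
theorem lieBr_killField (a' b' : ℂ) (p' q' : Fin 9 → ℂ) {w' : Fin 9 → Fin 9 → ℂ}
    (hl : ∀ {i j : Fin 9}, (i.val < 3 ↔ j.val < 3) → l i = l j) (hw : IsRot w) (hw' : IsRot w') :
    lieBr (killField l a b p q w) (killField l a' b' p' q' w') =
      killField l (-∑ i, l i ^ 2 * (p i * q' i - q i * p' i)) 0
        (fun i => b * l i ^ 2 * q' i - b' * l i ^ 2 * q i + ∑ j, (w' i j * p j - w i j * p' j))
        (fun i => -(b * p' i) + b' * p i + ∑ j, (w' i j * q j - w i j * q' j))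
        (fun i k => ∑ j, (w' i j * w j k - w i j * w' j k)) := by
  funext x
  -- `hc` and `hs` replace the frequency l_j by l_i next to w_ij, so that the rotated components are
  -- again combinations of cos(l_i x⁻) and sin(l_i x⁻).
  have hc : ∀ {w : Fin 9 → Fin 9 → ℂ}, IsRot w → ∀ (i j : Fin 9) (u v : ℂ),
      w i j * (u * Complex.cos (l j * x im) - v * l j * Complex.sin (l j * x im))
        = w i j * u * Complex.cos (l i * x im) - w i j * v * l i * Complex.sin (l i * x im) := by
    intro w hw i j u v
    have h1 := hw.mul_eq (f := fun i => Complex.cos (l i * x im)) (fun h => by rw [hl h]) i j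
    have h2 := hw.mul_eq (f := fun i => l i * Complex.sin (l i * x im))
      (fun h => by rw [hl h]) i j
    linear_combination -u * h1 + v * h2
  have hs : ∀ {w : Fin 9 → Fin 9 → ℂ}, IsRot w → ∀ (i j : Fin 9) (u v : ℂ),
      w i j * (u * l j * Complex.sin (l j * x im) + v * l j ^ 2 * Complex.cos (l j * x im))
        = w i j * u * l i * Complex.sin (l i * x im)
          + w i j * v * l i ^ 2 * Complex.cos (l i * x im) := by
    intro w hw i j u v
    have h1 := hw.mul_eq (f := fun i => l i ^ 2 * Complex.cos (l i * x im))
      (fun h => by rw [hl h]) i j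
    have h2 := hw.mul_eq (f := fun i => l i * Complex.sin (l i * x im))
      (fun h => by rw [hl h]) i j
    linear_combination -v * h1 - u * h2
  refine Ix_ext ?_ ?_ fun k => ?_
  · simp only [lieBr, sum_Ix, pd_killField_ip]
    simp only [killField_im, killField_iv, killField_ip,
      Sum.elim_inl, Sum.elim_inr, if_true, one_ne_zero, if_false, add_mul _ _ (_ + _),
      Finset.sum_sub_distrib, Finset.sum_add_distrib, hw.sum_mul_eq, hw'.sum_mul_eq, hs hw, hs hw']
    rw [Finset.mul_sum, Finset.mul_sum, neg_neg]
    simp only [← Finset.sum_sub_distrib, ← Finset.sum_add_distrib, mul_zero, sub_zero, zero_add]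
    refine Finset.sum_congr rfl fun i _ => ?_
    simp only [Finset.sum_sub_distrib, Finset.sum_add_distrib, ← Finset.sum_mul]
    -- The bracket of the transverse fields K₍ᵢ₎ and K₍ᵢ*₎ is a multiple of the central ∂₊; sin² +
    -- cos² = 1 makes the coefficient independent of x⁻.
    linear_combination l i ^ 2 * (p i * q' i - q i * p' i) * Complex.sin_sq_add_cos_sq (l i * x im)
  · simp only [lieBr, pd_killField_im]; simp [killField_im]
  · simp only [lieBr, sum_Ix, pd_killField_iv]
    simp only [killField_im, killField_iv,
      Sum.elim_inl, Sum.elim_inr, if_true, one_ne_zero, if_false]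
    have e : ∀ {w w' : Fin 9 → Fin 9 → ℂ} (p q : Fin 9 → ℂ), IsRot w' →
        ∑ j, (p j * Complex.cos (l j * x im) - q j * l j * Complex.sin (l j * x im)
          + ∑ m, w j m * (x (iv m) : ℂ)) * w' k j
        = (∑ j, w' k j * p j) * Complex.cos (l k * x im)
          - (∑ j, w' k j * q j) * l k * Complex.sin (l k * x im)
          + ∑ m, (∑ j, w' k j * w j m) * (x (iv m) : ℂ) := by
      intro w w' p q hw'
      simp only [mul_comm _ (w' k _), mul_add, hc hw', Finset.sum_add_distrib,
        Finset.sum_sub_distrib, Finset.sum_mul, Finset.mul_sum]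
      congr 1
      rw [Finset.sum_comm]
      exact Finset.sum_congr rfl fun m _ => Finset.sum_congr rfl fun j _ => by ring
    rw [Finset.sum_sub_distrib, e p q hw', e p' q' hw]
    simp only [Finset.sum_sub_distrib, sub_mul]
    ring

end KillField

theorem IsRot.zero : IsRot 0 := ⟨fun _ _ => by simp, fun _ _ _ => rfl⟩

theorem IsRot.add {w w' : Fin 9 → Fin 9 → ℂ} (hw : IsRot w) (hw' : IsRot w') :
    IsRot (w + w') :=
  ⟨fun i j => by simp [hw.1 i j, hw'.1 i j, add_comm],
    fun i j h => by simp [hw.2 i j h, hw'.2 i j h]⟩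

theorem IsRot.smul {w : Fin 9 → Fin 9 → ℂ} (hw : IsRot w) (z : ℂ) : IsRot (z • w) :=
  ⟨fun i j => by simp [hw.1 i j], fun i j h => by simp [hw.2 i j h]⟩

theorem IsRot.bracket {w w' : Fin 9 → Fin 9 → ℂ} (hw : IsRot w) (hw' : IsRot w') :
    IsRot (fun i k => ∑ j, (w' i j * w j k - w i j * w' j k)) := by
  refine ⟨fun i k => ?_, fun i k h => Finset.sum_eq_zero fun j _ => ?_⟩
  · rw [← Finset.sum_neg_distrib]
    refine Finset.sum_congr rfl fun j _ => ?_
    rw [hw.1 i j, hw'.1 i j, hw.1 j k, hw'.1 j k]; ring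
  · by_cases hij : i.val < 3 ↔ j.val < 3
    · have hjk : ¬(j.val < 3 ↔ k.val < 3) := fun h' => h (hij.trans h')
      rw [hw.2 j k hjk, hw'.2 j k hjk]; ring
    · rw [hw.2 i j hij, hw'.2 i j hij]; ring

/-- The Killing algebra consists of the fields `killField`. -/
theorem mem_killingAlg_iff {α β : ℂ} {X : VField} : X ∈ killingAlg α β ↔
    ∃ a b p q w, IsRot w ∧ X = killField (lam α β) a b p q w := by
  constructor
  · intro hX
    induction hX using Submodule.span_induction with
    | zero =>
      refine ⟨0, 0, 0, 0, 0, IsRot.zero, ?_⟩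
      rw [killField_eq _ _ _ _ _ _ IsRot.zero.1]; simp
    | add X Y _ _ hX hY =>
      obtain ⟨a, b, p, q, w, hw, rfl⟩ := hX
      obtain ⟨a', b', p', q', w', hw', rfl⟩ := hY
      exact ⟨_, _, _, _, _, hw.add hw', killField_add _ _ _ _ _ _ _ _ _ _ _⟩
    | smul z X _ hX =>
      obtain ⟨a, b, p, q, w, hw, rfl⟩ := hX
      exact ⟨_, _, _, _, _, hw.smul z, killField_smul _ _ _ _ _ _ _⟩
    | mem X hX =>
      rcases hX with (((rfl | rfl) | ⟨i, rfl⟩) | ⟨i, rfl⟩) | ⟨i, j, hij, rfl⟩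
      · refine ⟨1, 0, 0, 0, 0, IsRot.zero, ?_⟩
        rw [killField_eq _ _ _ _ _ _ IsRot.zero.1]; simp
      · refine ⟨0, 1, 0, 0, 0, IsRot.zero, ?_⟩
        rw [killField_eq _ _ _ _ _ _ IsRot.zero.1]; simp
      · refine ⟨0, 0, Pi.single i 1, 0, 0, IsRot.zero, ?_⟩
        rw [killField_eq _ _ _ _ _ _ IsRot.zero.1]; simp [Pi.single_apply]
      · refine ⟨0, 0, 0, Pi.single i 1, 0, IsRot.zero, ?_⟩
        rw [killField_eq _ _ _ _ _ _ IsRot.zero.1]; simp [Pi.single_apply]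
      · refine ⟨0, 0, 0, 0, fun k m => (if k = i then if m = j then 1 else 0 else 0)
          - (if k = j then if m = i then 1 else 0 else 0), ⟨fun k m => ?_, fun k m h => ?_⟩, ?_⟩
        · grind
        · grind
        · funext x
          refine Ix_ext ?_ ?_ fun k => ?_
          · rw [killField_ip]; simp [Kr]
          · rw [killField_im]; simp [Kr]
          · rw [killField_iv]
            simp [Kr, Pi.single_apply, sub_mul, Finset.sum_sub_distrib]
  · rintro ⟨a, b, p, q, w, hw, rfl⟩
    rw [killField_eq _ _ _ _ _ _ hw.1]
    have hs : ∀ {X}, X ∈ ({Kp, Km} ∪ Set.range (Kv (lam α β)) ∪ Set.range (Ks (lam α β))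
      ∪ {X | ∃ i j : Fin 9, (i.val < 3 ↔ j.val < 3) ∧ X = Kr i j}) → X ∈ killingAlg α β :=
      fun h => Submodule.subset_span h
    refine add_mem (add_mem (add_mem (add_mem ?_ ?_) ?_) ?_) ?_
    · exact Submodule.smul_mem _ _ (hs (by simp))
    · exact Submodule.smul_mem _ _ (hs (by simp))
    · exact sum_mem fun i _ => Submodule.smul_mem _ _ (hs (by simp))
    · exact sum_mem fun i _ => Submodule.smul_mem _ _ (hs (by simp))
    · refine Submodule.smul_mem _ _ (sum_mem fun i _ => sum_mem fun j _ => ?_)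
      by_cases h : i.val < 3 ↔ j.val < 3
      · exact Submodule.smul_mem _ _ (hs (Or.inr ⟨i, j, h, rfl⟩))
      · rw [hw.2 i j h, zero_smul]; exact zero_mem _

theorem isKilling_of_mem_killingAlg {α β : ℂ} (h : Admissible α β) {X : VField}
    (hX : X ∈ killingAlg α β) : IsKilling (famB α β) X := by
  obtain ⟨a, b, p, q, w, hw, rfl⟩ := mem_killingAlg_iff.1 hX
  rw [famB_eq]
  exact isKilling_killField a b p q (famDiag_eq_lam_sq h) hw.1
    (hw.mul_eq (f := fun i => lam α β i ^ 2) fun h => by rw [lam_congr α β h])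

theorem lieBr_mem_killingAlg {α β : ℂ} {X Y : VField} (hX : X ∈ killingAlg α β)
    (hY : Y ∈ killingAlg α β) : lieBr X Y ∈ killingAlg α β := by
  obtain ⟨a, b, p, q, w, hw, rfl⟩ := mem_killingAlg_iff.1 hX
  obtain ⟨a', b', p', q', w', hw', rfl⟩ := mem_killingAlg_iff.1 hY
  rw [lieBr_killField a b p q a' b' p' q' (lam_congr α β) hw hw']
  exact mem_killingAlg_iff.2 ⟨_, _, _, _, _, hw.bracket hw', rfl⟩

theorem contDiff_of_mem_killingAlg {α β : ℂ} {X : VField} (hX : X ∈ killingAlg α β) :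
    ContDiff ℝ ∞ X := by
  obtain ⟨a, b, p, q, w, hw, rfl⟩ := mem_killingAlg_iff.1 hX
  exact contDiff_killField _ _ _ _ _ _

/-! ### The operators in the connection form and in the action of the Killing algebra -/

section Operators

variable {S : Type*} [NormedAddCommGroup S] [NormedSpace ℂ S]

/-- The action of `K₍₋₎` on spinors at the origin. -/
def opN (Γ : Ix → S →L[ℂ] S) (α β : ℂ) : S →L[ℂ] S :=
  -((α • gam123 Γ) * sigmaM Γ + (β • gam123 Γ) * sigmaP Γ)

/-- The connection form of `D` in the direction `∂_i`. -/
def opP (Γ : Ix → S →L[ℂ] S) (α β : ℂ) (i : Fin 9) : S →L[ℂ] S :=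
  (-(Complex.I * lam α β i / 2)) • (Γ ip * gam123 Γ * gam Γ i)

/-- The operator `½ Γ₊ Γ_i`. -/
def opZ (Γ : Ix → S →L[ℂ] S) (i : Fin 9) : S →L[ℂ] S :=
  (-(1 / 2) : ℂ) • (Γ ip * gam Γ i)

/-- The action of a rotation on spinors. -/
def opR (Γ : Ix → S →L[ℂ] S) (w : Fin 9 → Fin 9 → ℂ) : S →L[ℂ] S :=
  (1 / 4 : ℂ) • ∑ k, ∑ i, w k i • (gam Γ k * gam Γ i)

variable {Γ : Ix → S →L[ℂ] S}

section Relations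

variable (hΓ : IsClifford Γ) (α β : ℂ)
include hΓ

theorem opN_mul_gammaP : opN Γ α β * Γ ip = -(α • (Γ ip * gam123 Γ)) := by
  rw [opN, neg_mul, add_mul, mul_assoc, mul_assoc, sigmaM_mul_gammaP hΓ, sigmaP_mul_gammaP hΓ,
    mul_zero, add_zero, smul_mul_assoc, (gam123_commute_gammaP hΓ).eq]

theorem gammaP_mul_opN : Γ ip * opN Γ α β = -(β • (Γ ip * gam123 Γ)) := by
  rw [opN, mul_neg, mul_add, smul_mul_assoc, smul_mul_assoc, (gam123_commute_sigmaM hΓ).eq,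
    (gam123_commute_sigmaP hΓ).eq, mul_smul_comm, mul_smul_comm, ← mul_assoc, ← mul_assoc,
    gammaP_mul_sigmaM hΓ, gammaP_mul_sigmaP hΓ, zero_mul, smul_zero, zero_add]

theorem gam_mul_opN (i : Fin 9) : gam Γ i * opN Γ α β = sgn i • (opN Γ α β * gam Γ i) := by
  rw [opN, mul_neg, neg_mul, mul_add, add_mul, smul_mul_assoc, smul_mul_assoc, smul_mul_assoc,
    smul_mul_assoc, mul_smul_comm, mul_smul_comm, ← mul_assoc, ← mul_assoc, gam_mul_gam123 hΓ,
    smul_mul_assoc, smul_mul_assoc, mul_assoc, mul_assoc, (gam_commute_sigmaM hΓ i).eq,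
    (gam_commute_sigmaP hΓ i).eq, mul_assoc, mul_assoc, smul_neg, smul_add]
  simp only [smul_comm (sgn i)]

theorem gam123_commute_opN : Commute (gam123 Γ) (opN Γ α β) := by
  unfold opN
  refine (Commute.add_right ?_ ?_).neg_right
  · exact ((Commute.refl _).smul_right α).mul_right (gam123_commute_sigmaM hΓ)
  · exact ((Commute.refl _).smul_right β).mul_right (gam123_commute_sigmaP hΓ)

/-- N acts by -α γ₁₂₃ to the left of Γ₊ and by -β γ₁₂₃ to its right. Moving it past γ_i multiplies β
by ε_i, so the commutator produces the factor α - ε_i β = i λ_i, which joins the i λ_i already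
contained in P_i. This is the identity that cancels the curvature. -/
theorem opN_mul_opP_sub (i : Fin 9) :
    opN Γ α β * opP Γ α β i - opP Γ α β i * opN Γ α β = lam α β i ^ 2 • opZ Γ i := by
  have h1 : opN Γ α β * (Γ ip * gam123 Γ * gam Γ i) = -(α • (Γ ip * gam Γ i)) := by
    rw [← mul_assoc, ← mul_assoc, opN_mul_gammaP hΓ, neg_mul, neg_mul, smul_mul_assoc,
      smul_mul_assoc, mul_assoc (Γ ip), gam123_sq hΓ, mul_one]
  have h2 : Γ ip * gam123 Γ * gam Γ i * opN Γ α β = -((sgn i * β) • (Γ ip * gam Γ i)) := by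
    rw [mul_assoc, gam_mul_opN hΓ, mul_smul_comm, ← mul_assoc, mul_assoc (Γ ip),
      (gam123_commute_opN hΓ α β).eq, ← mul_assoc, gammaP_mul_opN hΓ, neg_mul, neg_mul,
      smul_mul_assoc, smul_mul_assoc, mul_assoc (Γ ip), gam123_sq hΓ, mul_one, smul_neg, smul_smul]
  rw [opP, opZ, mul_smul_comm, smul_mul_assoc, ← smul_sub, h1, h2, neg_sub_neg, ← sub_smul,
    smul_smul, smul_smul]
  congr 1
  have := sub_sgn_mul α β i
  linear_combination Complex.I * lam α β i / 2 * this
    + lam α β i ^ 2 / 2 * Complex.I_mul_I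

theorem opN_mul_opZ_sub (i : Fin 9) :
    opN Γ α β * opZ Γ i - opZ Γ i * opN Γ α β = -opP Γ α β i := by
  have h1 : opN Γ α β * (Γ ip * gam Γ i) = -(α • (Γ ip * gam123 Γ * gam Γ i)) := by
    rw [← mul_assoc, opN_mul_gammaP hΓ, neg_mul, smul_mul_assoc]
  have h2 : Γ ip * gam Γ i * opN Γ α β = -((sgn i * β) • (Γ ip * gam123 Γ * gam Γ i)) := by
    rw [mul_assoc, gam_mul_opN hΓ, mul_smul_comm, ← mul_assoc, gammaP_mul_opN hΓ, neg_mul,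
      smul_mul_assoc, smul_neg, smul_smul]
  rw [opP, opZ, mul_smul_comm, smul_mul_assoc, ← smul_sub, h1, h2, neg_sub_neg, ← sub_smul,
    smul_smul, ← neg_smul]
  congr 1
  have := sub_sgn_mul α β i
  linear_combination 1 / 2 * this

variable {α β}

theorem gammaP_mul_opP (i : Fin 9) : Γ ip * opP Γ α β i = 0 := by
  rw [opP, mul_smul_comm, ← mul_assoc, ← mul_assoc, gammaP_sq hΓ]; simp

theorem gammaP_mul_opZ (i : Fin 9) : Γ ip * opZ Γ i = 0 := by
  rw [opZ, mul_smul_comm, ← mul_assoc, gammaP_sq hΓ]; simp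

theorem opP_eq_mul_gammaP (i : Fin 9) :
    opP Γ α β i = (-(Complex.I * lam α β i / 2)) • (gam123 Γ * gam Γ i * Γ ip) := by
  rw [opP, mul_assoc, ((gam123_commute_gammaP hΓ).mul_left (gam_commute_gammaP hΓ i)).eq]

theorem opZ_eq_mul_gammaP (i : Fin 9) : opZ Γ i = (-(1 / 2) : ℂ) • (gam Γ i * Γ ip) := by
  rw [opZ, (gam_commute_gammaP hΓ i).eq]

/-- Both factors contain Γ₊, which can be moved to the inner ends, and Γ₊² = 0. The three mixed
products below vanish for the same reason. -/
theorem opP_mul_opP (i j : Fin 9) : opP Γ α β i * opP Γ α β j = 0 := by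
  rw [opP_eq_mul_gammaP hΓ, smul_mul_assoc, mul_assoc, gammaP_mul_opP hΓ]; simp

theorem opP_mul_opZ (i j : Fin 9) : opP Γ α β i * opZ Γ j = 0 := by
  rw [opP_eq_mul_gammaP hΓ, smul_mul_assoc, mul_assoc, gammaP_mul_opZ hΓ]; simp

theorem opZ_mul_opP (i j : Fin 9) : opZ Γ i * opP Γ α β j = 0 := by
  rw [opZ_eq_mul_gammaP hΓ, smul_mul_assoc, mul_assoc, gammaP_mul_opP hΓ]; simp

theorem opZ_mul_opZ (i j : Fin 9) : opZ Γ i * opZ Γ j = 0 := by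
  rw [opZ_eq_mul_gammaP hΓ, smul_mul_assoc, mul_assoc, gammaP_mul_opZ hΓ]; simp

variable {w w' : Fin 9 → Fin 9 → ℂ}

omit hΓ in
theorem opR_commute_of_gam {T : S →L[ℂ] S} (hT : ∀ i, Commute (gam Γ i) T) :
    Commute (opR Γ w) T :=
  (Commute.sum_left _ _ _ fun k _ => Commute.sum_left _ _ _ fun i _ =>
    ((hT k).mul_left (hT i)).smul_left _).smul_left _

theorem opR_commute_gammaP : Commute (opR Γ w) (Γ ip) :=
  opR_commute_of_gam (gam_commute_gammaP hΓ)

theorem opR_commute_gammaM : Commute (opR Γ w) (Γ im) :=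
  opR_commute_of_gam (gam_commute_gammaM hΓ)

theorem opR_commute_sigmaM : Commute (opR Γ w) (sigmaM Γ) :=
  opR_commute_of_gam (gam_commute_sigmaM hΓ)

theorem opR_commute_sigmaP : Commute (opR Γ w) (sigmaP Γ) :=
  opR_commute_of_gam (gam_commute_sigmaP hΓ)

/-- Passing γ_k γ_i costs ε_k ε_i, which is 1 wherever w_ki is non-zero. This is why only rotations
within the blocks act on parallel spinors. -/
theorem opR_commute_gam123 (hw : IsRot w) : Commute (opR Γ w) (gam123 Γ) := by
  refine (Commute.sum_left _ _ _ fun k _ => Commute.sum_left _ _ _ fun i _ => ?_).smul_left _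
  unfold Commute SemiconjBy
  rw [smul_mul_assoc, mul_smul_comm, mul_assoc, gam_mul_gam123 hΓ, mul_smul_comm, ← mul_assoc,
    gam_mul_gam123 hΓ, smul_mul_assoc, smul_smul, smul_smul, mul_assoc]
  have h := hw.mul_eq (f := sgn) (fun h => sgn_congr h) k i
  congr 1
  linear_combination sgn i * h + w k i * sgn_mul_self i

theorem opR_commute_opN (hw : IsRot w) : Commute (opR Γ w) (opN Γ α β) := by
  unfold opN
  refine (Commute.add_right ?_ ?_).neg_right
  · exact ((opR_commute_gam123 hΓ hw).smul_right α).mul_right (opR_commute_sigmaM hΓ)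
  · exact ((opR_commute_gam123 hΓ hw).smul_right β).mul_right (opR_commute_sigmaP hΓ)

/-- The defining property of the spin representation; the commutators of rotations with Z, with P
and with each other follow from it by the Leibniz rule. -/
theorem opR_mul_gam_sub (hw : ∀ i j, w i j = -w j i) (j : Fin 9) :
    opR Γ w * gam Γ j - gam Γ j * opR Γ w = -∑ k, w k j • gam Γ k := by
  have h : ∀ k i, gam Γ k * gam Γ i * gam Γ j - gam Γ j * (gam Γ k * gam Γ i)
      = (if i = j then -(2 : ℂ) else 0) • gam Γ k + (if k = j then (2 : ℂ) else 0) • gam Γ i := by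
    intro k i
    rw [mul_assoc, gam_mul_gam hΓ i j, mul_sub, mul_smul_comm, mul_one, ← mul_assoc,
      gam_mul_gam hΓ k j, sub_mul, smul_mul_assoc, one_mul, mul_assoc]
    split_ifs <;> simp
    abel
  rw [opR, smul_mul_assoc, mul_smul_comm, ← smul_sub, Finset.sum_mul, Finset.mul_sum,
    ← Finset.sum_sub_distrib]
  simp only [Finset.sum_mul, Finset.mul_sum, ← Finset.sum_sub_distrib, smul_mul_assoc,
    mul_smul_comm, ← smul_sub, h, smul_add, Finset.sum_add_distrib, smul_smul, smul_ite, smul_zero,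
    ite_smul, zero_smul]
  have e1 : ∑ k, ∑ i, (if k = j then (w k i * 2) • gam Γ i else 0)
      = ∑ i, (w j i * 2) • gam Γ i := by
    rw [Finset.sum_comm]; simp
  rw [e1]
  simp only [Finset.sum_ite_eq', Finset.mem_univ, if_true]
  rw [← Finset.sum_neg_distrib, Finset.smul_sum, Finset.smul_sum, ← Finset.sum_add_distrib]
  refine Finset.sum_congr rfl fun k _ => ?_
  rw [hw j k, smul_smul, smul_smul, ← add_smul, ← neg_smul]
  congr 1
  ring

theorem opR_mul_opZ_sub (hw : ∀ i j, w i j = -w j i) (j : Fin 9) :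
    opR Γ w * opZ Γ j - opZ Γ j * opR Γ w = -∑ k, w k j • opZ Γ k := by
  have h : opR Γ w * (Γ ip * gam Γ j) - Γ ip * gam Γ j * opR Γ w
      = Γ ip * (opR Γ w * gam Γ j - gam Γ j * opR Γ w) := by
    rw [mul_sub, ← mul_assoc, (opR_commute_gammaP hΓ).eq, mul_assoc, mul_assoc]
  rw [opZ, mul_smul_comm, smul_mul_assoc, ← smul_sub, h, opR_mul_gam_sub hΓ hw, mul_neg, smul_neg,
    Finset.mul_sum, Finset.smul_sum]
  congr 1
  refine Finset.sum_congr rfl fun k _ => ?_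
  rw [opZ, mul_smul_comm, smul_comm]

theorem opR_mul_opP_sub (hw : IsRot w) (j : Fin 9) :
    opR Γ w * opP Γ α β j - opP Γ α β j * opR Γ w = -∑ k, w k j • opP Γ α β k := by
  have h : opR Γ w * (Γ ip * gam123 Γ * gam Γ j) - Γ ip * gam123 Γ * gam Γ j * opR Γ w
      = Γ ip * gam123 Γ * (opR Γ w * gam Γ j - gam Γ j * opR Γ w) := by
    rw [mul_sub, ← mul_assoc,
      ((opR_commute_gammaP hΓ).mul_right (opR_commute_gam123 hΓ hw)).eq]
    simp only [mul_assoc]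
  rw [opP, mul_smul_comm, smul_mul_assoc, ← smul_sub, h, opR_mul_gam_sub hΓ hw.1, mul_neg,
    smul_neg, Finset.mul_sum, Finset.smul_sum]
  congr 1
  refine Finset.sum_congr rfl fun k _ => ?_
  rw [opP, mul_smul_comm, smul_smul, smul_smul]
  congr 1
  have h := hw.mul_eq (f := lam α β) (lam_congr α β) k j
  linear_combination Complex.I / 2 * h

theorem opR_mul_opR_sub (hw : ∀ i j, w i j = -w j i) :
    opR Γ w * opR Γ w' - opR Γ w' * opR Γ w
      = opR Γ (fun i k => ∑ j, (w' i j * w j k - w i j * w' j k)) := by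
  have h : ∀ k i, opR Γ w * (gam Γ k * gam Γ i) - gam Γ k * gam Γ i * opR Γ w
      = -(∑ m, w m k • (gam Γ m * gam Γ i)) - ∑ m, w m i • (gam Γ k * gam Γ m) := by
    intro k i
    have hk := opR_mul_gam_sub hΓ hw k
    have hi := opR_mul_gam_sub hΓ hw i
    calc _ = (opR Γ w * gam Γ k - gam Γ k * opR Γ w) * gam Γ i
          + gam Γ k * (opR Γ w * gam Γ i - gam Γ i * opR Γ w) := by
          rw [sub_mul, mul_sub]; simp only [mul_assoc]; abel
      _ = _ := by
          rw [hk, hi, neg_mul, mul_neg, Finset.sum_mul, Finset.mul_sum, ← sub_eq_add_neg]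
          simp only [smul_mul_assoc, mul_smul_comm]
  have h2 : opR Γ w * opR Γ w' - opR Γ w' * opR Γ w = (1 / 4 : ℂ) • ∑ k, ∑ i, w' k i •
      (opR Γ w * (gam Γ k * gam Γ i) - gam Γ k * gam Γ i * opR Γ w) := by
    conv_lhs => rw [opR.eq_1 Γ w']
    simp only [mul_smul_comm, smul_mul_assoc, ← smul_sub, Finset.mul_sum, Finset.sum_mul,
      ← Finset.sum_sub_distrib]
  rw [h2]
  conv_rhs => rw [opR]
  congr 1
  simp only [h, smul_sub, smul_neg, Finset.smul_sum, smul_smul, Finset.sum_sub_distrib,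
    Finset.sum_neg_distrib, sub_smul, Finset.sum_smul]
  have e1 : ∑ k, ∑ i, ∑ m, (w' k i * w m k) • (gam Γ m * gam Γ i)
      = ∑ k, ∑ i, ∑ m, (w k m * w' m i) • (gam Γ k * gam Γ i) := by
    rw [Finset.sum_congr rfl fun k _ => Finset.sum_comm, Finset.sum_comm]
    refine Finset.sum_congr rfl fun m _ => ?_
    rw [Finset.sum_comm]
    simp only [mul_comm]
  have e2 : ∑ k, ∑ i, ∑ m, (w' k i * w m i) • (gam Γ k * gam Γ m)
      = -∑ k, ∑ i, ∑ m, (w' k m * w m i) • (gam Γ k * gam Γ i) := by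
    rw [← Finset.sum_neg_distrib]
    refine Finset.sum_congr rfl fun k _ => ?_
    rw [Finset.sum_comm, ← Finset.sum_neg_distrib]
    refine Finset.sum_congr rfl fun i _ => ?_
    rw [← Finset.sum_neg_distrib]
    refine Finset.sum_congr rfl fun m _ => ?_
    rw [hw i m, ← neg_smul]
    congr 1; ring
  rw [e1, e2]
  abel

end Relations

/-- The general combination of the operators above. The Killing field with parameters
`a, b, p, q, w` acts on spinors at the origin through `opGen Γ α β b p (λ² q) w`. -/
def opGen (Γ : Ix → S →L[ℂ] S) (α β b : ℂ) (f g : Fin 9 → ℂ) (w : Fin 9 → Fin 9 → ℂ) :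
    S →L[ℂ] S :=
  b • opN Γ α β - ∑ i, f i • opP Γ α β i + ∑ i, g i • opZ Γ i + opR Γ w

/-- The commutator of two general combinations, from the commutators of the generators. -/
theorem commutator_combination {A ι : Type*} [Ring A] [Algebra ℂ A] [Fintype ι]
    {N R R' R'' : A} {P Z : ι → A} {w w' : ι → ι → ℂ} {l : ι → ℂ}
    (hNP : ∀ i, N * P i - P i * N = l i • Z i) (hNZ : ∀ i, N * Z i - Z i * N = -P i)
    (hPP : ∀ i j, P i * P j = 0) (hPZ : ∀ i j, P i * Z j = 0) (hZP : ∀ i j, Z i * P j = 0)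
    (hZZ : ∀ i j, Z i * Z j = 0) (hRN : R * N - N * R = 0) (hRN' : R' * N - N * R' = 0)
    (hRP : ∀ j, R * P j - P j * R = -∑ k, w k j • P k)
    (hRP' : ∀ j, R' * P j - P j * R' = -∑ k, w' k j • P k)
    (hRZ : ∀ j, R * Z j - Z j * R = -∑ k, w k j • Z k)
    (hRZ' : ∀ j, R' * Z j - Z j * R' = -∑ k, w' k j • Z k)
    (hRR : R * R' - R' * R = R'') (b b' : ℂ) (f g f' g' : ι → ℂ) :
    (b • N - ∑ i, f i • P i + ∑ i, g i • Z i + R)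
        * (b' • N - ∑ i, f' i • P i + ∑ i, g' i • Z i + R')
      - (b' • N - ∑ i, f' i • P i + ∑ i, g' i • Z i + R')
        * (b • N - ∑ i, f i • P i + ∑ i, g i • Z i + R) =
    -∑ i, (b * g' i - b' * g i + ∑ j, (w' i j * f j - w i j * f' j)) • P i
      + ∑ i, (l i * (-(b * f' i) + b' * f i) + ∑ j, (w' i j * g j - w i j * g' j)) • Z i
      + R'' := by
  -- With the commutator as Lie bracket, the expansion is a matter of bilinearity; otherwise each
  -- product would have to be expanded separately.
  let _ : LieRing A := LieRing.ofAssociativeRing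
  rw [← Ring.lie_def]
  have hPN : ∀ i, ⁅P i, N⁆ = -(l i • Z i) := fun i => by
    rw [← lie_skew, Ring.lie_def, hNP]
  have hZN : ∀ i, ⁅Z i, N⁆ = P i := fun i => by
    rw [← lie_skew, Ring.lie_def, hNZ, neg_neg]
  have hPP : ∀ i j, ⁅P i, P j⁆ = 0 := fun i j => by rw [Ring.lie_def, hPP, hPP, sub_zero]
  have hPZ' : ∀ i j, ⁅P i, Z j⁆ = 0 := fun i j => by rw [Ring.lie_def, hPZ, hZP, sub_zero]
  have hZP' : ∀ i j, ⁅Z i, P j⁆ = 0 := fun i j => by rw [Ring.lie_def, hPZ, hZP, sub_zero]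
  have hZZ : ∀ i j, ⁅Z i, Z j⁆ = 0 := fun i j => by rw [Ring.lie_def, hZZ, hZZ, sub_zero]
  have hNR' : ⁅N, R'⁆ = 0 := by rw [← lie_skew, Ring.lie_def, hRN', neg_zero]
  have hPR' : ∀ j, ⁅P j, R'⁆ = ∑ k, w' k j • P k :=
    fun j => by rw [← lie_skew, Ring.lie_def, hRP', neg_neg]
  have hZR' : ∀ j, ⁅Z j, R'⁆ = ∑ k, w' k j • Z k :=
    fun j => by rw [← lie_skew, Ring.lie_def, hRZ', neg_neg]
  simp only [← Ring.lie_def] at hNP hNZ hRN hRP hRZ hRR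
  have swap : ∀ (w : ι → ι → ℂ) (f : ι → ℂ) (T : ι → A),
      ∑ i, f i • ∑ k, w k i • T k = ∑ i, (∑ j, w i j * f j) • T i := by
    intro w f T
    simp only [Finset.smul_sum, Finset.sum_smul, smul_smul]
    rw [Finset.sum_comm]
    simp only [mul_comm]
  simp only [add_lie, sub_lie, lie_add, lie_sub, sum_lie, lie_sum, smul_lie, lie_smul,
    hNP, hPN, hNZ, hZN, hPP, hPZ', hZP', hZZ, hRN, hNR', hRP, hPR', hRZ, hZR', hRR, lie_self,
    smul_zero, Finset.sum_const_zero, add_zero, sub_zero, zero_sub]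
  simp only [smul_neg, Finset.sum_neg_distrib, smul_add, Finset.sum_add_distrib,
    Finset.sum_sub_distrib, swap, add_smul, sub_smul, neg_smul, mul_add, mul_neg]
  simp only [Finset.smul_sum, smul_smul, mul_left_comm (l _), mul_comm (l _),
    mul_comm (g' _) b, mul_left_comm (f' _) b]
  abel

/-- With g = λ² q these are the structure constants of `lieBr_killField`; the central parameter a is
absent because K₍₊₎ acts by zero. -/
theorem opGen_commutator (hΓ : IsClifford Γ) {w w' : Fin 9 → Fin 9 → ℂ} (hw : IsRot w)
    (hw' : IsRot w') (α β b b' : ℂ) (f g f' g' : Fin 9 → ℂ) :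
    opGen Γ α β b f g w * opGen Γ α β b' f' g' w' - opGen Γ α β b' f' g' w' * opGen Γ α β b f g w
      = opGen Γ α β 0
      (fun i => b * g' i - b' * g i + ∑ j, (w' i j * f j - w i j * f' j))
      (fun i => lam α β i ^ 2 * (-(b * f' i) + b' * f i) + ∑ j, (w' i j * g j - w i j * g' j))
      (fun i k => ∑ j, (w' i j * w j k - w i j * w' j k)) := by
  have hRN : opR Γ w * opN Γ α β - opN Γ α β * opR Γ w = 0 :=
    sub_eq_zero.2 (opR_commute_opN hΓ hw).eq
  have hRN' : opR Γ w' * opN Γ α β - opN Γ α β * opR Γ w' = 0 :=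
    sub_eq_zero.2 (opR_commute_opN hΓ hw').eq
  have hRR := opR_mul_opR_sub hΓ (w' := w') hw.1
  have h := commutator_combination (A := S →L[ℂ] S) (N := opN Γ α β)
    (P := opP Γ α β) (Z := opZ Γ) (R := opR Γ w) (R' := opR Γ w') (l := fun i => lam α β i ^ 2)
    (R'' := opR Γ (fun i k => ∑ j, (w' i j * w j k - w i j * w' j k)))
    (w := w) (w' := w') ?_ ?_ ?_ ?_ ?_ ?_ ?_ ?_ ?_ ?_ ?_ ?_ ?_ b b' f g f' g'
  rotate_left
  · exact (opN_mul_opP_sub hΓ α β)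
  · exact (opN_mul_opZ_sub hΓ α β)
  · exact (opP_mul_opP hΓ)
  · exact (opP_mul_opZ hΓ)
  · exact (opZ_mul_opP hΓ)
  · exact (opZ_mul_opZ hΓ)
  · exact hRN
  · exact hRN'
  · exact (opR_mul_opP_sub hΓ hw)
  · exact (opR_mul_opP_sub hΓ hw')
  · exact (opR_mul_opZ_sub hΓ hw.1)
  · exact (opR_mul_opZ_sub hΓ hw'.1)
  · exact hRR
  rw [opGen, opGen, opGen, zero_smul, zero_sub]
  rw [h]

end Operators

/-! ### The connection -/

section Connection

variable {S : Type*} [NormedAddCommGroup S] [NormedSpace ℂ S] {Γ : Ix → S →L[ℂ] S}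

/-- The hypotheses describe a skew endomorphism annihilating e₊: a null rotation with parameter y
together with a transverse rotation w. The null part contributes equally through e₋ and through the
e_i, which turns the prefactor -¼ into the -½ of `opZ`. -/
theorem spinLift_of (hΓ : IsClifford Γ) (B : Matrix (Fin 9) (Fin 9) ℝ) (x : Pt)
    {v : Ix → Ix → ℂ} (y : Fin 9 → ℂ) (w : Fin 9 → Fin 9 → ℂ)
    (hp : v ip = 0) (hmm : v im im = 0) (hmv : ∀ k, v im (iv k) = y k)
    (hvp : ∀ i, v (iv i) ip = -y i) (hvm : ∀ i, v (iv i) im = 0)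
    (hvv : ∀ i k, v (iv i) (iv k) = w k i) :
    spinLift B Γ x v = ∑ i, y i • opZ Γ i - opR Γ w := by
  have hcl : ∀ u : Ix → ℂ, u im = 0 →
      cliff B Γ x u = u ip • Γ ip + ∑ k, u (iv k) • Γ (iv k) := by
    intro u hu
    have : coframe B x u = u := by simp [coframe, hu]
    rw [cliff, this, sum_Ix, hu, zero_smul, add_zero]
  have h0 : cliff B Γ x (v ip) = 0 := by rw [hp, hcl 0 rfl]; simp
  have d1 : dualIx im = ip := rfl
  have d2 : ∀ i, dualIx (iv i) = iv i := fun _ => rfl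
  have hpg : ∀ i, Γ (iv i) * Γ ip = Γ ip * gam Γ i := fun i => by
    rw [gammaV_mul_gammaP hΓ, gammaP_mul_gam hΓ]
  have hpg' : ∀ i, Γ ip * Γ (iv i) = -(Γ ip * gam Γ i) := fun i => by
    rw [gammaP_mul_gam hΓ, neg_neg]
  rw [spinLift, sum_Ix, h0, zero_mul, zero_add, d1, hcl _ hmm, add_mul, smul_mul_assoc,
    gammaP_sq hΓ, smul_zero, zero_add, Finset.sum_mul]
  have e : ∀ i, cliff B Γ x (v (iv i)) * Γ (dualIx (iv i))
      = y i • (Γ ip * gam Γ i) + ∑ k, w k i • (gam Γ k * gam Γ i) := by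
    intro i
    rw [hcl _ (hvm i), d2, add_mul, smul_mul_assoc, hpg', hvp, smul_neg, neg_smul, neg_neg,
      Finset.sum_mul]
    simp only [hvv, smul_mul_assoc, gammaV_mul_gammaV_eq_gam hΓ]
  simp only [e, smul_mul_assoc, hpg, hmv, Finset.sum_add_distrib]
  rw [Finset.sum_comm (f := fun i k => w k i • (gam Γ k * gam Γ i)), opR, ← add_assoc, smul_add,
    neg_smul (1 / 4 : ℂ) (∑ k, ∑ i, w k i • (gam Γ k * gam Γ i)), ← sub_eq_add_neg,
    ← Finset.sum_add_distrib, Finset.smul_sum]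
  congr 1
  refine Finset.sum_congr rfl fun i _ => ?_
  rw [← add_smul, opZ, smul_smul, smul_smul]
  congr 1
  ring

theorem pd_ofReal {f : Pt → ℝ} {x : Pt} (hf : DifferentiableAt ℝ f x) (A : Ix) :
    pd A (fun y => (f y : ℂ)) x = ((pd A f x : ℝ) : ℂ) := by
  have h := (Complex.ofRealCLM.hasFDerivAt (x := f x)).comp x hf.hasFDerivAt
  have h2 : fderiv ℝ (fun y => (f y : ℂ)) x = _ := h.fderiv
  simp only [pd, h2]
  simp

theorem frame_ip (B : Matrix (Fin 9) (Fin 9) ℝ) (x : Pt) : frame B ip x = Pi.single ip 1 := rfl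

theorem frame_im (B : Matrix (Fin 9) (Fin 9) ℝ) (x : Pt) :
    frame B im x = Pi.single im 1 + ((quad B x : ℂ) / 2) • Pi.single ip 1 := rfl

theorem frame_iv (B : Matrix (Fin 9) (Fin 9) ℝ) (i : Fin 9) (x : Pt) :
    frame B (iv i) x = Pi.single (iv i) 1 := rfl

theorem nablaVec_frame_ip (b : Fin 9 → ℝ) (A : Ix) (x : Pt) :
    nablaVec (Matrix.diagonal b) A (frame (Matrix.diagonal b) ip) x = 0 := by
  funext C
  rw [nablaVec_diagonal]
  simp only [frame_ip, pd_const]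
  rcases C with k | i <;> rcases A with l | j
  all_goals try fin_cases k
  all_goals try fin_cases l
  all_goals simp

theorem nablaVec_frame_iv (b : Fin 9 → ℝ) (A : Ix) (i : Fin 9) (x : Pt) :
    nablaVec (Matrix.diagonal b) A (frame (Matrix.diagonal b) (iv i)) x
      = if A = im then Pi.single ip (-(b i * x (iv i) : ℂ)) else 0 := by
  funext C
  rw [nablaVec_diagonal]
  simp only [frame_iv, pd_const]
  rcases C with k | i <;> rcases A with l | j
  all_goals try fin_cases k
  all_goals try fin_cases l
  all_goals simp [im, ip, iv, Pi.single_apply]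

theorem nablaVec_frame_im (b : Fin 9 → ℝ) (A : Ix) (x : Pt) :
    nablaVec (Matrix.diagonal b) A (frame (Matrix.diagonal b) im) x
      = if A = im then fun C => Sum.elim (fun _ => 0) (fun k => (b k * x (iv k) : ℂ)) C else 0 := by
  have hq : ∀ C, pd A (fun y => frame (Matrix.diagonal b) im y C) x
      = if C = ip then ((pd A (quad (Matrix.diagonal b)) x : ℝ) : ℂ) / 2 else 0 := by
    intro C
    by_cases hC : C = ip
    · subst hC
      have : (fun y => frame (Matrix.diagonal b) im y ip)
          = fun y => (1 / 2 : ℂ) * (quad (Matrix.diagonal b) y : ℂ) := by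
        funext y; simp [frame_im]; ring
      have hd := differentiable_of_smooth (contDiff_quad b) x
      rw [this, pd_const_mul, pd_ofReal hd, if_pos rfl]
      · ring
      · exact Complex.ofRealCLM.differentiableAt.comp x hd
    · have : (fun y => frame (Matrix.diagonal b) im y C) = fun _ => (Pi.single im 1 : Ix → ℂ) C := by
        funext y; simp [frame_im, Pi.single_apply, hC]
      rw [this, pd_const, if_neg hC]
  funext C
  rw [nablaVec_diagonal]
  simp only [hq]
  simp only [pd_quad, frame_im]
  rcases C with k | i <;> rcases A with l | j
  all_goals try fin_cases k
  all_goals try fin_cases l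
  all_goals simp [im, ip, iv]
  all_goals try ring

/-- The spinorial Levi-Civita connection in the trivialisation. -/
theorem leviCivita_diagonal (hΓ : IsClifford Γ) (b : Fin 9 → ℝ) (A : Ix) (x : Pt) :
    leviCivita (Matrix.diagonal b) Γ A x
      = if A = im then ∑ i, (b i * x (iv i) : ℂ) • opZ Γ i else 0 := by
  rw [leviCivita]
  by_cases hA : A = im
  · subst hA
    rw [if_pos rfl, spinLift_of hΓ _ x (fun k => (b k * x (iv k) : ℂ)) 0]
    · simp [opR]
    · exact nablaVec_frame_ip b im x
    · simp [nablaVec_frame_im]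
    · intro k; simp [nablaVec_frame_im]
    · intro k; simp [nablaVec_frame_iv]
    · intro k; simp [nablaVec_frame_iv]
    · intro i k; simp [nablaVec_frame_iv]
  · rw [if_neg hA, spinLift_of hΓ _ x 0 0]
    · simp [opR]
    · exact nablaVec_frame_ip b A x
    · simp [nablaVec_frame_im, hA]
    · intro k; simp [nablaVec_frame_im, hA]
    · intro k; simp [nablaVec_frame_iv, hA]
    · intro k; simp [nablaVec_frame_iv, hA]
    · intro i k; simp [nablaVec_frame_iv, hA]

theorem pairForm_ip (c d : S →L[ℂ] S) (x : Pt) : pairForm Γ c d ip x = 0 := rfl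

theorem pairForm_im (α β : ℂ) (x : Pt) :
    pairForm Γ (α • gam123 Γ) (β • gam123 Γ) im x = opN Γ α β := rfl

/-- Here c γ_i - γ_i d = (α - ε_i β) γ₁₂₃ γ_i, and σ₊ is absorbed by Γ₊. -/
theorem pairForm_iv (hΓ : IsClifford Γ) (α β : ℂ) (i : Fin 9) (x : Pt) :
    pairForm Γ (α • gam123 Γ) (β • gam123 Γ) (iv i) x = opP Γ α β i := by
  have h : pairForm Γ (α • gam123 Γ) (β • gam123 Γ) (iv i) x = (-(1 / 2) : ℂ) •
    (Γ ip * ((α • gam123 Γ) * gam Γ i - gam Γ i * (β • gam123 Γ)) * sigmaP Γ) := rfl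
  rw [h, smul_mul_assoc, mul_smul_comm, gam_mul_gam123 hΓ, smul_smul, ← sub_smul, mul_smul_comm,
    smul_mul_assoc, mul_assoc, mul_assoc, (gam_commute_sigmaP hΓ i).eq, ← mul_assoc (gam123 Γ),
    (gam123_commute_sigmaP hΓ).eq, mul_assoc, ← mul_assoc, gammaP_mul_sigmaP hΓ, opP, smul_smul,
    mul_assoc]
  congr 1
  linear_combination -(1 / 2) * sub_sgn_mul α β i

variable {α β : ℂ}

theorem famD_ip (hΓ : IsClifford Γ) (x : Pt) : famD Γ α β ip x = 0 := by
  simp only [famD, connD, Pi.add_apply]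
  rw [famB_eq, leviCivita_diagonal hΓ, pairForm_ip]
  simp [ip, im]

theorem famD_im (hΓ : IsClifford Γ) (x : Pt) :
    famD Γ α β im x = opN Γ α β + ∑ i, (famDiag α β i * x (iv i) : ℂ) • opZ Γ i := by
  simp only [famD, connD, Pi.add_apply]
  rw [famB_eq, leviCivita_diagonal hΓ, pairForm_im, if_pos rfl, add_comm]

theorem famD_iv (hΓ : IsClifford Γ) (i : Fin 9) (x : Pt) :
    famD Γ α β (iv i) x = opP Γ α β i := by
  simp only [famD, connD, Pi.add_apply]
  rw [famB_eq, leviCivita_diagonal hΓ, pairForm_iv hΓ, if_neg (by simp [im]), zero_add]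

theorem contDiff_famD (hΓ : IsClifford Γ) (A : Ix) : ContDiff ℝ ∞ (famD Γ α β A) := by
  rcases A with k | i
  · fin_cases k
    · change ContDiff ℝ ∞ (famD Γ α β ip)
      rw [show famD Γ α β ip = fun _ => 0 from funext fun x => famD_ip hΓ x]
      exact contDiff_const
    · change ContDiff ℝ ∞ (famD Γ α β im)
      rw [show famD Γ α β im = _ from funext fun x => famD_im hΓ x]
      fun_prop
  · rw [show famD Γ α β (Sum.inr i) = _ from funext fun x => famD_iv hΓ i x]
    exact contDiff_const

/-- The operators are complex-linear but the base is real, so evaluation has to be regarded as a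
real bilinear map before differentiating. -/
theorem isBoundedBilinearMap_clm_apply :
    IsBoundedBilinearMap ℝ fun z : (S →L[ℂ] S) × S => z.1 z.2 :=
  (ContinuousLinearMap.id ℂ (S →L[ℂ] S)).bilinearRestrictScalars ℝ |>.isBoundedBilinearMap

theorem differentiableAt_clm_apply {F : Pt → S →L[ℂ] S} {ξ : Field S} {x : Pt}
    (hF : DifferentiableAt ℝ F x) (hξ : DifferentiableAt ℝ ξ x) :
    DifferentiableAt ℝ (fun y => F y (ξ y)) x := by
  have h := (isBoundedBilinearMap_clm_apply.hasFDerivAt (F x, ξ x)).comp x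
    (hF.hasFDerivAt.prodMk hξ.hasFDerivAt)
  exact h.differentiableAt

theorem contDiff_clm_apply' {F : Pt → S →L[ℂ] S} {ξ : Field S}
    (hF : ContDiff ℝ ∞ F) (hξ : ContDiff ℝ ∞ ξ) : ContDiff ℝ ∞ fun y => F y (ξ y) := by
  have h := isBoundedBilinearMap_clm_apply.contDiff.comp (hF.prodMk hξ)
  exact h

theorem pd_clm_apply {F : Pt → S →L[ℂ] S} {ξ : Field S} {x : Pt} (hF : DifferentiableAt ℝ F x)
    (hξ : DifferentiableAt ℝ ξ x) (A : Ix) :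
    pd A (fun y => F y (ξ y)) x = pd A F x (ξ x) + F x (pd A ξ x) := by
  have h := (isBoundedBilinearMap_clm_apply.hasFDerivAt (F x, ξ x)).comp x
    (hF.hasFDerivAt.prodMk hξ.hasFDerivAt)
  have h2 : fderiv ℝ (fun y => F y (ξ y)) x = _ := h.fderiv
  simp only [pd, h2]
  simp [add_comm]

end Connection

/-! ### Flatness and parallel spinors -/

section Parallel

variable {S : Type*} [NormedAddCommGroup S] [NormedSpace ℂ S] {Γ : Ix → S →L[ℂ] S}

/-- In the commutator of covariant derivatives the second derivatives cancel by symmetry and the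
first derivatives of ξ cancel in pairs, leaving the curvature applied to ξ. -/
theorem isFlat_of_curvature {ϖ : Conn S} (hϖ : ∀ A, ContDiff ℝ ∞ (ϖ A))
    (h : ∀ A C x, pd A (ϖ C) x - pd C (ϖ A) x + (ϖ A x * ϖ C x - ϖ C x * ϖ A x) = 0) :
    IsFlat ϖ := by
  intro ξ hξ A C x
  have hd := differentiable_of_smooth hξ
  have hϖd := fun A => differentiable_of_smooth (hϖ A)
  have key : ∀ A C, covD ϖ A (covD ϖ C ξ) x = pd A (pd C ξ) x + (pd A (ϖ C) x) (ξ x)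
      + ϖ C x (pd A ξ x) + ϖ A x (pd C ξ x) + (ϖ A x * ϖ C x) (ξ x) := by
    intro A C
    have hs := differentiableAt_clm_apply (hϖd C x) (hd x)
    have e : pd A (covD ϖ C ξ) x = pd A (fun y => pd C ξ y + ϖ C y (ξ y)) x := rfl
    rw [covD, e, pd_add A (differentiable_of_smooth (contDiff_pd hξ C) x) hs,
      pd_clm_apply (hϖd C x) (hd x)]
    simp only [covD, map_add, mul_apply_eq_comp]
    abel
  have h' := congrArg (fun T : S →L[ℂ] S => T (ξ x)) (h A C x)
  simp only [add_apply, sub_apply,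
    zero_apply] at h'
  rw [key, key, pd_comm hξ A C, ← sub_eq_zero, ← h']
  abel

variable {α β : ℂ}

theorem pd_famD (hΓ : IsClifford Γ) (A C : Ix) (x : Pt) : pd A (famD Γ α β C) x =
    if C = im then Sum.elim (fun _ => 0) (fun i => (famDiag α β i : ℂ) • opZ Γ i) A else 0 := by
  by_cases hC : C = im
  · subst hC
    rw [if_pos rfl, show famD Γ α β im = _ from funext fun x => famD_im hΓ x,
      pd_add A (by fun_prop) (by fun_prop), pd_const, zero_add, pd_sum _ _ (by intros; fun_prop)]
    have h : ∀ i, pd A (fun y : Pt => (famDiag α β i * y (iv i) : ℂ) • opZ Γ i) x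
        = if A = iv i then (famDiag α β i : ℂ) • opZ Γ i else 0 := by
      intro i
      rw [pd_smul A (by fun_prop) (by fun_prop), pd_const, smul_zero, zero_add,
        pd_const_mul A _ (by fun_prop), pd_coord_complex]
      split_ifs <;> simp
    simp only [h]
    rcases A with k | i <;> simp [iv]
  · rw [if_neg hC]
    rcases C with k | i
    · have : k = 0 := by
        fin_cases k
        · rfl
        · exact absurd rfl hC
      subst this
      rw [show famD Γ α β (Sum.inl 0) = fun _ => 0 from funext fun x => famD_ip hΓ x, pd_const]
    · rw [show famD Γ α β (Sum.inr i) = fun _ => opP Γ α β i from funext fun x => famD_iv hΓ i x,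
        pd_const]

/-- This cancels the derivative of the ∂₋ part of the connection form in the direction ∂_i, leaving
no curvature. -/
theorem opP_mul_famD_im_sub (hΓ : IsClifford Γ) (h : Admissible α β) (i : Fin 9) (x : Pt) :
    opP Γ α β i * famD Γ α β im x - famD Γ α β im x * opP Γ α β i
      = -((famDiag α β i : ℂ) • opZ Γ i) := by
  rw [famD_im hΓ, mul_add, add_mul, Finset.mul_sum, Finset.sum_mul]
  simp only [mul_smul_comm, smul_mul_assoc, opP_mul_opZ hΓ, opZ_mul_opP hΓ, smul_zero,
    Finset.sum_const_zero, add_zero]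
  rw [← neg_sub, opN_mul_opP_sub hΓ, famDiag_eq_lam_sq h]

theorem isFlat_famD (hΓ : IsClifford Γ) (h : Admissible α β) : IsFlat (famD Γ α β) := by
  refine isFlat_of_curvature (contDiff_famD hΓ) fun A C x => ?_
  rw [pd_famD hΓ, pd_famD hΓ]
  have h0 : ∀ x, famD Γ α β (Sum.inl 0) x = 0 := famD_ip hΓ
  have hP : ∀ i x, famD Γ α β (Sum.inr i) x = opP Γ α β i := famD_iv hΓ
  have hN := fun i => opP_mul_famD_im_sub hΓ h i x
  have hN' := fun i => neg_eq_iff_eq_neg.2 (hN i)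
  simp only [neg_sub, im] at hN'
  simp only [im] at hN
  rcases A with k | i <;> rcases C with l | j
  · fin_cases k <;> fin_cases l <;> simp [h0, im]
  · fin_cases k
    · simp [h0, im]
    · simp only [hP, im, Sum.elim_inr, Fin.mk_one, if_true, reduceCtorEq, if_false, hN']
      simp
  · fin_cases l
    · simp [h0, im]
    · simp only [hP, im, Sum.elim_inr, Fin.mk_one, if_true, reduceCtorEq, if_false, hN]
      simp
  · simp [hP, opP_mul_opP hΓ, im]

theorem pd_sum_coord_smul (A : Ix) (T : Fin 9 → S →L[ℂ] S) (x : Pt) :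
    pd A (fun x : Pt => ∑ i, (x (iv i) : ℂ) • T i) x = Sum.elim (fun _ => 0) T A := by
  rw [pd_sum _ _ (by intros; fun_prop)]
  have h : ∀ i, pd A (fun y : Pt => (y (iv i) : ℂ) • T i) x = if A = iv i then T i else 0 := by
    intro i
    rw [pd_smul A (by fun_prop) (by fun_prop), pd_const, smul_zero, zero_add, pd_coord_complex]
    split_ifs <;> simp
  simp only [h]
  rcases A with k | i <;> simp [iv]

theorem sum_opP_mul_opN_add (hΓ : IsClifford Γ) (h : Admissible α β) (x : Pt) :
    opN Γ α β * (∑ i, (x (iv i) : ℂ) • opP Γ α β i) = (∑ i, (x (iv i) : ℂ) • opP Γ α β i) * opN Γ α β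
      + ∑ i, (famDiag α β i * x (iv i) : ℂ) • opZ Γ i := by
  rw [← sub_eq_iff_eq_add', Finset.mul_sum, Finset.sum_mul, ← Finset.sum_sub_distrib]
  refine Finset.sum_congr rfl fun i _ => ?_
  rw [mul_smul_comm, smul_mul_assoc, ← smul_sub, opN_mul_opP_sub hΓ, smul_smul,
    famDiag_eq_lam_sq h, mul_comm]

theorem sum_opP_mul_sum_opZ (hΓ : IsClifford Γ) (f g : Fin 9 → ℂ) :
    (∑ i, f i • opP Γ α β i) * ∑ i, g i • opZ Γ i = 0 := by
  simp [Finset.sum_mul, Finset.mul_sum, opP_mul_opZ hΓ]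

theorem sum_opZ_mul_sum_opP (hΓ : IsClifford Γ) (f g : Fin 9 → ℂ) :
    (∑ i, g i • opZ Γ i) * (∑ i, f i • opP Γ α β i) = 0 := by
  simp [Finset.sum_mul, Finset.mul_sum, opZ_mul_opP hΓ]

variable [FiniteDimensional ℂ S]

/-- The gauge transformation that trivialises `D`. -/
def gauge (Γ : Ix → S →L[ℂ] S) (α β : ℂ) (x : Pt) : S →L[ℂ] S :=
  NormedSpace.exp (x im • opN Γ α β) * (1 + ∑ i, (x (iv i) : ℂ) • opP Γ α β i)

/-- The inverse of `gauge`. -/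
def gaugeInv (Γ : Ix → S →L[ℂ] S) (α β : ℂ) (x : Pt) : S →L[ℂ] S :=
  (1 - ∑ i, (x (iv i) : ℂ) • opP Γ α β i) * NormedSpace.exp (x im • -opN Γ α β)

/-- Products of P's vanish, so 1 - ∑ x^i P_i inverts 1 + ∑ x^i P_i, and the two exponentials are
inverse to each other. -/
theorem gaugeInv_mul_gauge (hΓ : IsClifford Γ) (x : Pt) :
    gaugeInv Γ α β x * gauge Γ α β x = 1 := by
  have : CompleteSpace S := FiniteDimensional.complete ℂ S
  have h : NormedSpace.exp (x im • -opN Γ α β) * NormedSpace.exp (x im • opN Γ α β) = 1 := by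
    let _ : NormedAlgebra ℚ (S →L[ℂ] S) := NormedAlgebra.restrictScalars ℚ ℝ _
    rw [← NormedSpace.exp_add_of_commute]
    · simp
    · rw [smul_neg]
      exact (Commute.refl _).neg_left
  have h2 : (∑ i, (x (iv i) : ℂ) • opP Γ α β i) * ∑ i, (x (iv i) : ℂ) • opP Γ α β i = 0 := by
    simp [Finset.sum_mul, Finset.mul_sum, opP_mul_opP hΓ]
  rw [gaugeInv, gauge, mul_assoc, ← mul_assoc (NormedSpace.exp _), h, one_mul, sub_mul,
    mul_add (∑ i, (x (iv i) : ℂ) • opP Γ α β i), h2, mul_one]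
  simp

theorem contDiff_exp_smul (T : S →L[ℂ] S) :
    ContDiff ℝ ∞ fun x : Pt => NormedSpace.exp (x im • T) := by
  have : CompleteSpace S := FiniteDimensional.complete ℂ S
  have h : ContDiff ℝ ∞ (NormedSpace.exp : (S →L[ℂ] S) → _) :=
    contDiff_iff_contDiffAt.2 fun y => (NormedSpace.exp_analytic (𝕂 := ℝ) y).contDiffAt
  exact h.comp (by fun_prop)

theorem pd_exp_smul (T : S →L[ℂ] S) (A : Ix) (x : Pt) :
    pd A (fun x : Pt => NormedSpace.exp (x im • T)) x
      = if A = im then NormedSpace.exp (x im • T) * T else 0 := by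
  have : CompleteSpace S := FiniteDimensional.complete ℂ S
  exact pd_comp_coord A im (h := fun t : ℝ => NormedSpace.exp (t • T))
    (hasDerivAt_exp_smul_const T (x im))

theorem contDiff_gauge : ContDiff ℝ ∞ (gauge Γ α β) :=
  (contDiff_exp_smul _).mul (by fun_prop)

theorem contDiff_gaugeInv : ContDiff ℝ ∞ (gaugeInv Γ α β) :=
  ContDiff.mul (by fun_prop) (contDiff_exp_smul _)

/-- In the direction ∂₋ the factor N appears to the left of 1 + ∑ x^i P_i. Moving it to the right
produces exactly the Levi-Civita term, by `sum_opP_mul_opN_add`, and this term is unchanged by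
multiplication with 1 + ∑ x^i P_i because P Z = 0. -/
theorem pd_gauge (hΓ : IsClifford Γ) (h : Admissible α β) (A : Ix) (x : Pt) :
    pd A (gauge Γ α β) x = gauge Γ α β x * famD Γ α β A x := by
  have e := pd_mul A (x := x) (differentiable_of_smooth (contDiff_exp_smul (opN Γ α β)) x)
    (g := fun x => 1 + ∑ i, (x (iv i) : ℂ) • opP Γ α β i) (by fun_prop)
  have e1 : pd A (gauge Γ α β) x = _ := e
  rw [e1, pd_exp_smul, pd_add A (by fun_prop) (by fun_prop), pd_const, zero_add, pd_sum_coord_smul]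
  rcases A with k | i
  · fin_cases k
    · have h0 : famD Γ α β (Sum.inl 0) x = 0 := famD_ip hΓ x
      simp [h0, im]
    · change _ = _ * famD Γ α β im x
      rw [famD_im hΓ, gauge]
      simp only [Fin.mk_one, im, if_true, Sum.elim_inl, mul_zero, zero_add]
      rw [mul_assoc, mul_assoc]
      congr 1
      rw [mul_add, add_mul, mul_add (∑ i, (x (iv i) : ℂ) • opP Γ α β i), sum_opP_mul_opN_add hΓ h,
        sum_opP_mul_sum_opZ hΓ]
      simp only [mul_one, one_mul]
      abel
  · have hP : famD Γ α β (Sum.inr i) x = opP Γ α β i := famD_iv hΓ i x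
    rw [hP, gauge, mul_assoc, add_mul, Finset.sum_mul]
    simp [im, opP_mul_opP hΓ]

theorem pd_gaugeInv (hΓ : IsClifford Γ) (h : Admissible α β) (A : Ix) (x : Pt) :
    pd A (gaugeInv Γ α β) x = -(famD Γ α β A x * gaugeInv Γ α β x) := by
  have e := pd_mul A (x := x) (f := fun x => 1 - ∑ i, (x (iv i) : ℂ) • opP Γ α β i) (by fun_prop)
    (differentiable_of_smooth (contDiff_exp_smul (-opN Γ α β)) x)
  have e1 : pd A (gaugeInv Γ α β) x = _ := e
  rw [e1, pd_exp_smul, pd_sub A (by fun_prop) (by fun_prop), pd_const, zero_sub, pd_sum_coord_smul]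
  rcases A with k | i
  · fin_cases k
    · have h0 : famD Γ α β (Sum.inl 0) x = 0 := famD_ip hΓ x
      simp [h0, im]
    · change _ = -(famD Γ α β im x * _)
      rw [famD_im hΓ, gaugeInv]
      simp only [Fin.mk_one, im, if_true, Sum.elim_inl, neg_zero, zero_mul, add_zero]
      have hc : Commute (NormedSpace.exp (x (Sum.inl 1) • -opN Γ α β)) (-opN Γ α β) :=
        ((Commute.refl (-opN Γ α β)).smul_left _).exp_left
      rw [hc.eq, ← mul_assoc, ← mul_assoc, ← neg_mul]
      congr 1
      rw [sub_mul, mul_sub, add_mul, add_mul, sum_opZ_mul_sum_opP hΓ, sum_opP_mul_opN_add hΓ h]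
      simp only [mul_one, one_mul, mul_neg]
      abel
  · have hP : famD Γ α β (Sum.inr i) x = opP Γ α β i := famD_iv hΓ i x
    rw [hP, gaugeInv, ← mul_assoc, mul_sub, Finset.mul_sum]
    simp [im, opP_mul_opP hΓ]

theorem gauge_apply_eq (hΓ : IsClifford Γ) (h : Admissible α β) {ξ : Field S}
    (hξ : ξ ∈ parallel (famD Γ α β)) (x : Pt) : gauge Γ α β x (ξ x) = ξ 0 := by
  have hg := differentiable_of_smooth (contDiff_gauge (Γ := Γ) (α := α) (β := β))
  have hd := differentiable_of_smooth hξ.1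
  have hsm : Differentiable ℝ fun y => gauge Γ α β y (ξ y) := fun y =>
    differentiableAt_clm_apply (hg y) (hd y)
  have e := eq_of_pd_eq_zero hsm (fun A y => ?_) x 0
  · rw [e]
    simp [gauge]
  · have hp := hξ.2 A y
    rw [covD] at hp
    rw [pd_clm_apply (hg y) (hd y), pd_gauge hΓ h, eq_neg_of_add_eq_zero_left hp]
    simp

theorem parallel_apply_eq (hΓ : IsClifford Γ) (h : Admissible α β) {ξ : Field S}
    (hξ : ξ ∈ parallel (famD Γ α β)) (x : Pt) : ξ x = gaugeInv Γ α β x (ξ 0) := by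
  rw [← gauge_apply_eq hΓ h hξ x, ← mul_apply_eq_comp, gaugeInv_mul_gauge hΓ]
  simp

theorem gaugeInv_mem_parallel (hΓ : IsClifford Γ) (h : Admissible α β) (s : S) :
    (fun x => gaugeInv Γ α β x s) ∈ parallel (famD Γ α β) := by
  have hg := contDiff_gaugeInv (Γ := Γ) (α := α) (β := β)
  refine ⟨contDiff_clm_apply' hg contDiff_const, fun A x => ?_⟩
  rw [covD, pd_clm_apply (differentiable_of_smooth hg x) (differentiableAt_const s), pd_const,
    pd_gaugeInv hΓ h]
  simp

/-- Parallel spinors correspond to their values at the origin. -/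
def evalEquiv (hΓ : IsClifford Γ) (h : Admissible α β) : parallel (famD Γ α β) ≃ₗ[ℂ] S where
  toFun ξ := (ξ : Field S) 0
  map_add' _ _ := rfl
  map_smul' _ _ := rfl
  invFun s := ⟨fun x => gaugeInv Γ α β x s, gaugeInv_mem_parallel hΓ h s⟩
  left_inv ξ := Subtype.ext (funext fun x => (parallel_apply_eq hΓ h ξ.2 x).symm)
  right_inv s := by simp [gaugeInv]

theorem evalEquiv_apply (hΓ : IsClifford Γ) (h : Admissible α β) (ξ : parallel (famD Γ α β)) :
    evalEquiv hΓ h ξ = (ξ : Field S) 0 := rfl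

end Parallel

/-! ### The spinorial Lie derivative -/

section SpinorLie

variable {S : Type*} [NormedAddCommGroup S] [NormedSpace ℂ S] {Γ : Ix → S →L[ℂ] S} {α β : ℂ}

/-- The components `-∇₋X^k` of a Killing field `X`. -/
def killBoost (l : Fin 9 → ℂ) (b : ℂ) (p q : Fin 9 → ℂ) (x : Pt) (k : Fin 9) : ℂ :=
  p k * l k * Complex.sin (l k * x im) + q k * l k ^ 2 * Complex.cos (l k * x im)
    + b * l k ^ 2 * x (iv k)

/-- The operator through which a Killing field acts on parallel spinors. -/
def opLie (Γ : Ix → S →L[ℂ] S) (α β a b : ℂ) (p q : Fin 9 → ℂ) (w : Fin 9 → Fin 9 → ℂ) (x : Pt) :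
    S →L[ℂ] S :=
  opGen Γ α β b (fun k => killField (lam α β) a b p q w x (iv k))
    (killBoost (lam α β) b p q x) w

/-- For a D-parallel spinor the Levi-Civita derivative is minus the (c, d) part of the connection
form. The first-order term of the Lie derivative thereby becomes algebraic and supplies N and the
P_i, while Γ(∇X) supplies the Z_i and the rotation. -/
theorem spinorLie_killField (hΓ : IsClifford Γ) (h : Admissible α β) (a b : ℂ) (p q : Fin 9 → ℂ)
    (w : Fin 9 → Fin 9 → ℂ) {ξ : Field S} (hξ : ξ ∈ parallel (famD Γ α β))
    (x : Pt) : spinorLie (famB α β) Γ (killField (lam α β) a b p q w) ξ x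
      = opLie Γ α β a b p q w x (ξ x) := by
  have hcov : ∀ A, covD (leviCivita (famB α β) Γ) A ξ x
      = -(pairForm Γ (α • gam123 Γ) (β • gam123 Γ) A x (ξ x)) := by
    intro A
    have h1 := hξ.2 A x
    simp only [covD, famD, connD, Pi.add_apply, add_apply] at h1
    rw [covD, eq_neg_iff_add_eq_zero, add_assoc, h1]
  have hlift : spinLift (famB α β) Γ x (fun A => ∑ E, frame (famB α β) A x E •
      nablaVec (famB α β) E (killField (lam α β) a b p q w) x)
      = ∑ i, (-killBoost (lam α β) b p q x i) • opZ Γ i - opR Γ w := by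
    rw [famB_eq]
    have hv0 : nablaVec (Matrix.diagonal (famDiag α β)) ip (killField (lam α β) a b p q w) x
        = 0 := by
      refine Ix_ext ?_ ?_ fun k => ?_
      · rw [nablaVec_diagonal, pd_killField_ip]; simp
      · rw [nablaVec_diagonal, pd_killField_im]; simp
      · rw [nablaVec_diagonal, pd_killField_iv]; simp
    -- The frame differs from the coordinate basis only by multiples of ∂₊, and ∇₊X = 0, so the
    -- change of basis has no effect.
    have hv : ∀ A, ∑ E, frame (Matrix.diagonal (famDiag α β)) A x E •
        nablaVec (Matrix.diagonal (famDiag α β)) E (killField (lam α β) a b p q w) x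
        = nablaVec (Matrix.diagonal (famDiag α β)) A (killField (lam α β) a b p q w) x := by
      intro A
      rw [sum_Ix, hv0, smul_zero, zero_add]
      rcases A with k | i
      · fin_cases k
        · change frame (Matrix.diagonal (famDiag α β)) ip x im • _
            + ∑ i, frame (Matrix.diagonal (famDiag α β)) ip x (iv i) • _ = _
          simp only [frame_ip]
          simp [hv0]
        · change frame (Matrix.diagonal (famDiag α β)) im x im • _
            + ∑ i, frame (Matrix.diagonal (famDiag α β)) im x (iv i) • _ = _
          simp only [frame_im]
          simp
      · change frame (Matrix.diagonal (famDiag α β)) (iv i) x im • _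
          + ∑ j, frame (Matrix.diagonal (famDiag α β)) (iv i) x (iv j) • _ = _
        simp only [frame_iv]
        simp [Pi.single_apply]
    simp only [hv]
    refine spinLift_of hΓ _ x _ w hv0 ?_ (fun k => ?_) (fun i => ?_) (fun i => ?_) fun i k => ?_
    · rw [nablaVec_diagonal, pd_killField_im]; simp
    · rw [nablaVec_diagonal, pd_killField_iv]
      simp [killField_im, killBoost, famDiag_eq_lam_sq h, im, iv]; ring
    · rw [nablaVec_diagonal, pd_killField_ip]
      simp [killField_im, killBoost, famDiag_eq_lam_sq h, ip, iv]; ring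
    · rw [nablaVec_diagonal, pd_killField_im]; simp
    · rw [nablaVec_diagonal, pd_killField_iv]; simp [iv]
  simp only [spinorLie, hlift, hcov]
  rw [sum_Ix, pairForm_ip, pairForm_im, killField_im]
  simp only [pairForm_iv hΓ, opLie, opGen]
  simp [sum_apply]
  abel

theorem contDiff_opLie (a b : ℂ) (p q : Fin 9 → ℂ) (w : Fin 9 → Fin 9 → ℂ) :
    ContDiff ℝ ∞ (opLie Γ α β a b p q w) := by
  unfold opLie opGen
  simp only [killField_iv, killBoost]
  fun_prop

theorem pd_opLie (a b : ℂ) (p q : Fin 9 → ℂ) (w : Fin 9 → Fin 9 → ℂ) (A : Ix) (x : Pt) :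
    pd A (opLie Γ α β a b p q w) x
      = opGen Γ α β 0 (fun k => pd A (fun y => killField (lam α β) a b p q w y (iv k)) x)
        (fun k => pd A (fun y => killBoost (lam α β) b p q y k) x) 0 := by
  have hX : ∀ k, Differentiable ℝ fun y => killField (lam α β) a b p q w y (iv k) := by
    intro k; simp only [killField_iv]; fun_prop
  have hY : ∀ k, Differentiable ℝ fun y => killBoost (lam α β) b p q y k := by
    intro k; simp only [killBoost]; fun_prop
  have e : ∀ (f : Fin 9 → Pt → ℂ) (T : Fin 9 → S →L[ℂ] S), (∀ k, Differentiable ℝ (f k)) →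
      pd A (fun y => ∑ k, f k y • T k) x = ∑ k, pd A (f k) x • T k := by
    intro f T hf
    rw [pd_sum _ _ fun k _ => ((hf k) x).smul_const (T k)]
    refine Finset.sum_congr rfl fun k _ => ?_
    rw [pd_smul A (hf k x) (differentiableAt_const _), pd_const, smul_zero, zero_add]
  have h1 : pd A (opLie Γ α β a b p q w) x = pd A (fun y => b • opN Γ α β
      - ∑ k, killField (lam α β) a b p q w y (iv k) • opP Γ α β k
      + ∑ k, killBoost (lam α β) b p q y k • opZ Γ k + opR Γ w) x := rfl
  rw [h1, pd_add A (by fun_prop) (by fun_prop), pd_add A (by fun_prop) (by fun_prop),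
    pd_sub A (by fun_prop) (by fun_prop), pd_const, pd_const, e _ _ hX, e _ _ hY]
  simp [opGen, opR]

theorem pd_killBoost (l : Fin 9 → ℂ) (b : ℂ) (p q : Fin 9 → ℂ) (A : Ix) (x : Pt) (k : Fin 9) :
    pd A (fun y => killBoost l b p q y k) x = Sum.elim (fun m => if m = 0 then 0 else
      p k * l k ^ 2 * Complex.cos (l k * x im) - q k * l k ^ 3 * Complex.sin (l k * x im))
      (fun i => if i = k then b * l k ^ 2 else 0) A := by
  simp only [killBoost]
  rw [pd_add A (by fun_prop) (by fun_prop), pd_add A (by fun_prop) (by fun_prop),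
    pd_const_mul A _ (by fun_prop), pd_const_mul A _ (by fun_prop),
    pd_const_mul A _ (by fun_prop), pd_sin, pd_cos, pd_coord_complex]
  rcases A with m | i
  · fin_cases m
    · simp [im, iv]
    · simp [im, iv]; ring
  · simp [im, iv]

/-- The connection form lies pointwise in the span of the operators that represent the Killing
algebra, so `opGen_commutator` also computes its commutators with `opLie`. -/
theorem famD_im_eq_opGen (hΓ : IsClifford Γ) (x : Pt) :
    famD Γ α β im x = opGen Γ α β 1 0 (fun i => famDiag α β i * x (iv i)) 0 := by
  rw [famD_im hΓ]; simp [opGen, opR]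

theorem famD_iv_eq_opGen (hΓ : IsClifford Γ) (i : Fin 9) (x : Pt) :
    famD Γ α β (iv i) x = opGen Γ α β 0 (-Pi.single i 1) 0 0 := by
  rw [famD_iv hΓ]; simp [opGen, opR, Pi.single_apply]

theorem opGen_add (b b' : ℂ) (f f' g g' : Fin 9 → ℂ) (w w' : Fin 9 → Fin 9 → ℂ) :
    opGen Γ α β b f g w + opGen Γ α β b' f' g' w'
      = opGen Γ α β (b + b') (f + f') (g + g') (w + w') := by
  simp only [opGen, opR, Pi.add_apply, add_smul, Finset.sum_add_distrib, smul_add]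
  abel

theorem opGen_eq_zero {b : ℂ} {f g : Fin 9 → ℂ} {w : Fin 9 → Fin 9 → ℂ} (hb : b = 0) (hf : f = 0)
    (hg : g = 0) (hw : w = 0) : opGen Γ α β b f g w = 0 := by
  subst hb hf hg hw
  simp [opGen, opR]

/-- The operator field is parallel for the connection that D induces on endomorphisms, and hence
maps parallel spinors to parallel spinors. -/
theorem pd_opLie_add_commutator (hΓ : IsClifford Γ) (h : Admissible α β) (a b : ℂ)
    (p q : Fin 9 → ℂ) {w : Fin 9 → Fin 9 → ℂ} (hw : IsRot w) (A : Ix) (x : Pt) :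
    pd A (opLie Γ α β a b p q w) x
      + (famD Γ α β A x * opLie Γ α β a b p q w x - opLie Γ α β a b p q w x * famD Γ α β A x)
      = 0 := by
  rw [pd_opLie]
  simp only [pd_killField_iv, pd_killBoost]
  rcases A with m | i
  · obtain rfl | rfl : m = 0 ∨ m = 1 := by omega
    · have h0 : famD Γ α β (Sum.inl 0) x = 0 := famD_ip hΓ x
      simp [h0, opGen, opR]
    · have h1 : famD Γ α β (Sum.inl 1) x = _ := famD_im_eq_opGen hΓ x
      rw [h1, opLie, opGen_commutator hΓ IsRot.zero hw, opGen_add]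
      refine opGen_eq_zero ?_ ?_ ?_ ?_
      · simp
      · funext k
        simp [killBoost, famDiag_eq_lam_sq h, im, iv]; ring
      · funext k
        have e : ∑ j, w k j * (lam α β j ^ 2 * (x (iv j) : ℂ))
            = lam α β k ^ 2 * ∑ j, w k j * (x (iv j) : ℂ) := by
          rw [Finset.mul_sum]
          refine Finset.sum_congr rfl fun j _ => ?_
          have := hw.mul_eq (f := fun i => lam α β i ^ 2) (fun h => by rw [lam_congr α β h]) k j
          linear_combination -(x (iv j) : ℂ) * this
        simp only [iv] at e
        simp [killField_iv, famDiag_eq_lam_sq h, im, iv, e]; ring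
      · funext i j; simp
  · have h1 : famD Γ α β (Sum.inr i) x = _ := famD_iv_eq_opGen hΓ i x
    rw [h1, opLie, opGen_commutator hΓ IsRot.zero hw, opGen_add]
    refine opGen_eq_zero ?_ ?_ ?_ ?_
    · simp
    · funext k
      simp [Pi.single_apply]
    · funext k
      simp [Pi.single_apply]
      split_ifs with h1 h2 h2
      · subst h1; ring
      · exact absurd h1.symm h2
      · exact absurd h2.symm h1
      · simp
    · funext i j; simp

theorem spinorLie_mem_parallel (hΓ : IsClifford Γ) (h : Admissible α β) {X : VField}
    (hX : X ∈ killingAlg α β) {ξ : Field S} (hξ : ξ ∈ parallel (famD Γ α β)) :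
    spinorLie (famB α β) Γ X ξ ∈ parallel (famD Γ α β) := by
  obtain ⟨a, b, p, q, w, hw, rfl⟩ := mem_killingAlg_iff.1 hX
  rw [show spinorLie (famB α β) Γ _ ξ = _ from
    funext fun x => spinorLie_killField hΓ h a b p q w hξ x]
  have hM := contDiff_opLie (Γ := Γ) (α := α) (β := β) a b p q w
  refine ⟨contDiff_clm_apply' hM hξ.1, fun A x => ?_⟩
  have h1 := hξ.2 A x
  rw [covD] at h1
  rw [covD, pd_clm_apply (differentiable_of_smooth hM x) (differentiable_of_smooth hξ.1 x),
    eq_neg_of_add_eq_zero_left h1]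
  have h2 := congrArg (fun T : S →L[ℂ] S => T (ξ x))
    (pd_opLie_add_commutator hΓ h a b p q hw A x)
  simp only [add_apply, sub_apply, mul_apply_eq_comp, zero_apply] at h2
  rw [← h2, map_neg]
  abel

/-- Parallel spinors are determined by their value at the origin, so this formula describes the
whole action. -/
theorem spinorLie_killField_zero (hΓ : IsClifford Γ) (h : Admissible α β) (a b : ℂ)
    (p q : Fin 9 → ℂ) (w : Fin 9 → Fin 9 → ℂ) {ξ : Field S}
    (hξ : ξ ∈ parallel (famD Γ α β)) :
    spinorLie (famB α β) Γ (killField (lam α β) a b p q w) ξ 0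
      = opGen Γ α β b p (fun i => lam α β i ^ 2 * q i) w (ξ 0) := by
  rw [spinorLie_killField hΓ h a b p q w hξ, opLie]
  congr 2
  · funext k; simp [killField_iv]
  · funext k; simp [killBoost]; ring

theorem nablaVec_add (B : Matrix (Fin 9) (Fin 9) ℝ) (A : Ix) {X Y : VField}
    (hX : ContDiff ℝ ∞ X) (hY : ContDiff ℝ ∞ Y) (x : Pt) :
    nablaVec B A (X + Y) x = nablaVec B A X x + nablaVec B A Y x := by
  funext C
  have h1 := differentiable_of_smooth (contDiff_pi.1 hX C)
  have h2 := differentiable_of_smooth (contDiff_pi.1 hY C)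
  simp only [nablaVec, Pi.add_apply]
  rw [pd_add A (h1 x) (h2 x)]
  simp only [mul_add, Finset.sum_add_distrib]
  ring

theorem nablaVec_smul (B : Matrix (Fin 9) (Fin 9) ℝ) (A : Ix) (z : ℂ) {X : VField}
    (hX : ContDiff ℝ ∞ X) (x : Pt) :
    nablaVec B A (z • X) x = z • nablaVec B A X x := by
  funext C
  have h1 := differentiable_of_smooth (contDiff_pi.1 hX C)
  simp only [nablaVec, Pi.smul_apply, smul_eq_mul]
  rw [pd_const_mul A z (h1 x), mul_add, Finset.mul_sum]
  congr 1
  exact Finset.sum_congr rfl fun E _ => by ring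

theorem cliff_add (B : Matrix (Fin 9) (Fin 9) ℝ) (x : Pt) (v v' : Ix → ℂ) :
    cliff B Γ x (v + v') = cliff B Γ x v + cliff B Γ x v' := by
  simp only [cliff, ← Finset.sum_add_distrib, ← add_smul]
  refine Finset.sum_congr rfl fun A _ => ?_
  congr 1
  simp [coframe]; ring

theorem cliff_smul (B : Matrix (Fin 9) (Fin 9) ℝ) (x : Pt) (z : ℂ) (v : Ix → ℂ) :
    cliff B Γ x (z • v) = z • cliff B Γ x v := by
  simp only [cliff, Finset.smul_sum, smul_smul]
  refine Finset.sum_congr rfl fun A _ => ?_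
  congr 1
  simp [coframe]; ring

theorem spinorLie_add (B : Matrix (Fin 9) (Fin 9) ℝ) {X Y : VField}
    (hX : ContDiff ℝ ∞ X) (hY : ContDiff ℝ ∞ Y) (ξ : Field S) :
    spinorLie B Γ (X + Y) ξ = spinorLie B Γ X ξ + spinorLie B Γ Y ξ := by
  funext x
  have e : spinLift B Γ x (fun A => ∑ E, frame B A x E • nablaVec B E (X + Y) x)
      = spinLift B Γ x (fun A => ∑ E, frame B A x E • nablaVec B E X x)
        + spinLift B Γ x (fun A => ∑ E, frame B A x E • nablaVec B E Y x) := by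
    simp only [nablaVec_add B _ hX hY, smul_add, Finset.sum_add_distrib, spinLift, cliff_add,
      add_mul]
  simp only [spinorLie, e, Pi.add_apply, add_smul, Finset.sum_add_distrib, add_apply]
  abel

theorem spinorLie_smul (B : Matrix (Fin 9) (Fin 9) ℝ) (z : ℂ) {X : VField}
    (hX : ContDiff ℝ ∞ X) (ξ : Field S) :
    spinorLie B Γ (z • X) ξ = z • spinorLie B Γ X ξ := by
  funext x
  have e : spinLift B Γ x (fun A => ∑ E, frame B A x E • nablaVec B E (z • X) x)
      = z • spinLift B Γ x (fun A => ∑ E, frame B A x E • nablaVec B E X x) := by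
    simp only [nablaVec_smul B _ z hX, smul_comm _ z, ← Finset.smul_sum, spinLift, cliff_smul,
      smul_mul_assoc]
  simp only [spinorLie, e, Pi.smul_apply, smul_apply, smul_sub, Finset.smul_sum, smul_smul,
    smul_eq_mul]

end SpinorLie

/-! ### The bracket of spinors: operators -/

section BracketOperators

variable {S : Type*} [NormedAddCommGroup S] [NormedSpace ℂ S]

/-- The operator of the component `{ξ,ξ}^i`. -/
def brP (Γ : Ix → S →L[ℂ] S) (i : Fin 9) : S →L[ℂ] S :=
  gam Γ i * (sigmaP Γ - sigmaM Γ)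

/-- The operator of the component `{ξ,ξ}^{i*}`. -/
def brQ (Γ : Ix → S →L[ℂ] S) (α β : ℂ) (i : Fin 9) : S →L[ℂ] S :=
  (Complex.I / lam α β i) • (gam123 Γ * gam Γ i * (sigmaP Γ + sgn i • sigmaM Γ))

/-- The operator of the component `{ξ,ξ}^{ik}`. -/
def brW (Γ : Ix → S →L[ℂ] S) (α β : ℂ) (i k : Fin 9) : S →L[ℂ] S :=
  (Complex.I * lam α β k / 2) • (gam123 Γ * (sgn k • (gam Γ k * gam Γ i)
    - sgn i • (gam Γ i * gam Γ k)) * Γ ip)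

/-- The adjoint of `opN`. -/
def opNAdj (Γ : Ix → S →L[ℂ] S) (α β : ℂ) : S →L[ℂ] S :=
  gam123 Γ * (α • sigmaP Γ + β • sigmaM Γ)

/-- The adjoint of `opGen`. -/
def opGenAdj (Γ : Ix → S →L[ℂ] S) (α β b : ℂ) (f g : Fin 9 → ℂ) (w : Fin 9 → Fin 9 → ℂ) :
    S →L[ℂ] S :=
  b • opNAdj Γ α β - ∑ i, f i • (sgn i • opP Γ α β i) - ∑ i, g i • opZ Γ i - opR Γ w

variable {Γ : Ix → S →L[ℂ] S} {C : S →ₗ[ℂ] S →ₗ[ℂ] ℂ} (α β : ℂ)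

theorem IsAdj.congr_right {T T' U' : S →L[ℂ] S} (hT : IsAdj C T T') (h : U' = T') :
    IsAdj C T U' := h ▸ hT

section Adjoints

variable (hC : IsChargeConj Γ C) (hΓ : IsClifford Γ)
include hC hΓ

theorem isAdj_opN : IsAdj C (opN Γ α β) (opNAdj Γ α β) := by
  have h := ((((isAdj_gam123 hC hΓ).smul α).mul (isAdj_sigmaM hC)).add
    (((isAdj_gam123 hC hΓ).smul β).mul (isAdj_sigmaP hC))).smul (-1)
  convert h using 1
  · simp [opN, add_comm]
  · rw [opNAdj, (((gam123_commute_sigmaP hΓ).smul_right α).add_right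
      ((gam123_commute_sigmaM hΓ).smul_right β)).eq]
    simp [add_mul]

theorem isAdj_opP (i : Fin 9) : IsAdj C (opP Γ α β i) (sgn i • opP Γ α β i) := by
  have h := (((isAdj_gamma hC ip).mul (isAdj_gam123 hC hΓ)).mul (isAdj_gam hC hΓ i)).smul
    (-(Complex.I * lam α β i / 2))
  refine h.congr_right ?_
  rw [neg_mul_neg, ← mul_assoc, gam_mul_gam123 hΓ, opP_eq_mul_gammaP hΓ, smul_mul_assoc, smul_comm]

theorem isAdj_opZ (i : Fin 9) : IsAdj C (opZ Γ i) (-opZ Γ i) := by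
  have h := ((isAdj_gamma hC ip).mul (isAdj_gam hC hΓ i)).smul (-(1 / 2))
  refine h.congr_right ?_
  rw [mul_neg, smul_neg, opZ_eq_mul_gammaP hΓ]

theorem isAdj_opR {w : Fin 9 → Fin 9 → ℂ} (hw : ∀ i j, w i j = -w j i) :
    IsAdj C (opR Γ w) (-opR Γ w) := by
  have h := (IsAdj.sum Finset.univ fun k _ => IsAdj.sum Finset.univ fun i _ =>
    ((isAdj_gam hC hΓ k).mul (isAdj_gam hC hΓ i)).smul (w k i)).smul (1 / 4)
  refine h.congr_right ?_
  rw [opR, Finset.sum_comm, ← smul_neg, ← Finset.sum_neg_distrib]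
  congr 1
  refine Finset.sum_congr rfl fun k _ => ?_
  rw [← Finset.sum_neg_distrib]
  refine Finset.sum_congr rfl fun i _ => ?_
  rw [hw i k, neg_smul, neg_neg]

/-- With the adjoint at hand, the action on a form C(s, T t) becomes the operator expression A* T +
T A. -/
theorem isAdj_opGen {w : Fin 9 → Fin 9 → ℂ} (hw : ∀ i j, w i j = -w j i) (b : ℂ)
    (f g : Fin 9 → ℂ) : IsAdj C (opGen Γ α β b f g w) (opGenAdj Γ α β b f g w) := by
  have h := ((((isAdj_opN α β hC hΓ).smul b).sub (IsAdj.sum Finset.univ fun i _ =>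
    (isAdj_opP α β hC hΓ i).smul (f i))).add (IsAdj.sum Finset.univ fun i _ =>
    (isAdj_opZ hC hΓ i).smul (g i))).add (isAdj_opR hC hΓ hw)
  refine h.congr_right ?_
  rw [opGenAdj]
  simp only [smul_neg, Finset.sum_neg_distrib]
  abel

theorem isAdj_brP (i : Fin 9) : IsAdj C (brP Γ i) (-brP Γ i) := by
  have h := (isAdj_gam hC hΓ i).mul ((isAdj_sigmaP hC).sub (isAdj_sigmaM hC))
  refine h.congr_right ?_
  rw [brP, ← mul_neg, neg_sub, ((gam_commute_sigmaM hΓ i).sub_right (gam_commute_sigmaP hΓ i)).eq]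

theorem isAdj_brQ (i : Fin 9) : IsAdj C (brQ Γ α β i) (-brQ Γ α β i) := by
  have h := (((isAdj_gam123 hC hΓ).mul (isAdj_gam hC hΓ i)).mul
    ((isAdj_sigmaP hC).add ((isAdj_sigmaM hC).smul (sgn i)))).smul (Complex.I / lam α β i)
  refine h.congr_right ?_
  have e : gam Γ i * -gam123 Γ = -(sgn i • (gam123 Γ * gam Γ i)) := by
    rw [mul_neg, gam_mul_gam123 hΓ]
  have e2 : (sigmaM Γ + sgn i • sigmaP Γ) * (gam123 Γ * gam Γ i)
      = gam123 Γ * gam Γ i * (sigmaM Γ + sgn i • sigmaP Γ) :=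
    ((((gam123_commute_sigmaM hΓ).mul_left (gam_commute_sigmaM hΓ i)).add_right
      (((gam123_commute_sigmaP hΓ).mul_left (gam_commute_sigmaP hΓ i)).smul_right (sgn i))).eq).symm
  rw [brQ, e, mul_neg, smul_neg, mul_smul_comm, e2, ← mul_smul_comm (sgn i), smul_add, smul_smul,
    sgn_mul_self, one_smul, add_comm]

theorem isAdj_brW (i k : Fin 9) : IsAdj C (brW Γ α β i k) (-brW Γ α β i k) := by
  have h := (((isAdj_gam123 hC hΓ).mul ((((isAdj_gam hC hΓ k).mul (isAdj_gam hC hΓ i)).smul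
    (sgn k)).sub (((isAdj_gam hC hΓ i).mul (isAdj_gam hC hΓ k)).smul (sgn i)))).mul
    (isAdj_gamma hC ip)).smul (Complex.I * lam α β k / 2)
  refine h.congr_right ?_
  have e : ∀ a b : Fin 9, gam Γ a * gam Γ b * gam123 Γ
      = (sgn a * sgn b) • (gam123 Γ * (gam Γ a * gam Γ b)) := by
    intro a b
    rw [mul_assoc, gam_mul_gam123 hΓ, mul_smul_comm, ← mul_assoc, gam_mul_gam123 hΓ,
      smul_mul_assoc, smul_smul, mul_comm (sgn a), mul_assoc]
  have e2 : (sgn k • (gam Γ i * gam Γ k) - sgn i • (gam Γ k * gam Γ i)) * -gam123 Γ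
      = gam123 Γ * (sgn k • (gam Γ k * gam Γ i) - sgn i • (gam Γ i * gam Γ k)) := by
    rw [mul_neg, sub_mul, smul_mul_assoc, smul_mul_assoc, e, e, mul_sub, mul_smul_comm,
      mul_smul_comm, smul_smul, smul_smul]
    have h1 := sgn_mul_self i
    have h2 := sgn_mul_self k
    rw [show sgn k * (sgn i * sgn k) = sgn i by linear_combination sgn i * h2,
      show sgn i * (sgn k * sgn i) = sgn k by linear_combination sgn k * h1]
    abel
  have e3 : Commute (Γ ip) (gam123 Γ * (sgn k • (gam Γ k * gam Γ i)
      - sgn i • (gam Γ i * gam Γ k))) := by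
    refine (gam123_commute_gammaP hΓ).symm.mul_right (Commute.sub_right ?_ ?_)
    · exact ((gam_commute_gammaP hΓ k).mul_left (gam_commute_gammaP hΓ i)).symm.smul_right _
    · exact ((gam_commute_gammaP hΓ i).mul_left (gam_commute_gammaP hΓ k)).symm.smul_right _
  rw [brW, e2, neg_mul, e3.eq, smul_neg]

end Adjoints

/-! ### Action of the generators on the forms that define the bracket of spinors. -/

section Action

set_option linter.unusedSimpArgs false

variable (hΓ : IsClifford Γ)
include hΓ

/-- Rules that sort products into the order `γ₁₂₃, γ_i`, the rest. -/
theorem clifford_sort :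
    (∀ i, sigmaM Γ * gam Γ i = gam Γ i * sigmaM Γ) ∧ (∀ i, sigmaP Γ * gam Γ i = gam Γ i * sigmaP Γ)
    ∧ (∀ i, Γ ip * gam Γ i = gam Γ i * Γ ip) ∧ (∀ i, Γ im * gam Γ i = gam Γ i * Γ im)
    ∧ sigmaM Γ * gam123 Γ = gam123 Γ * sigmaM Γ ∧ sigmaP Γ * gam123 Γ = gam123 Γ * sigmaP Γ
    ∧ Γ ip * gam123 Γ = gam123 Γ * Γ ip ∧ Γ im * gam123 Γ = gam123 Γ * Γ im
    ∧ (∀ i, gam Γ i * gam123 Γ = sgn i • (gam123 Γ * gam Γ i)) ∧ gam123 Γ * gam123 Γ = 1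
    ∧ sigmaM Γ * sigmaM Γ = sigmaM Γ ∧ sigmaP Γ * sigmaP Γ = sigmaP Γ
    ∧ sigmaM Γ * sigmaP Γ = 0 ∧ sigmaP Γ * sigmaM Γ = 0
    ∧ Γ ip * sigmaM Γ = 0 ∧ Γ ip * sigmaP Γ = Γ ip ∧ Γ im * sigmaM Γ = Γ im ∧ Γ im * sigmaP Γ = 0
    ∧ sigmaM Γ * Γ ip = Γ ip ∧ sigmaP Γ * Γ ip = 0 ∧ sigmaM Γ * Γ im = 0 ∧ sigmaP Γ * Γ im = Γ im
    ∧ Γ ip * Γ ip = 0 ∧ Γ im * Γ im = 0 ∧ Γ ip * Γ im = -(2 : ℂ) • sigmaM Γ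
    ∧ Γ im * Γ ip = -(2 : ℂ) • sigmaP Γ :=
  ⟨fun i => (gam_commute_sigmaM hΓ i).eq.symm, fun i => (gam_commute_sigmaP hΓ i).eq.symm,
    fun i => (gam_commute_gammaP hΓ i).eq.symm, fun i => (gam_commute_gammaM hΓ i).eq.symm,
    (gam123_commute_sigmaM hΓ).eq.symm, (gam123_commute_sigmaP hΓ).eq.symm,
    (gam123_commute_gammaP hΓ).eq.symm, (gam123_commute_gammaM hΓ).eq.symm,
    gam_mul_gam123 hΓ, gam123_sq hΓ, sigmaM_mul_sigmaM hΓ, sigmaP_mul_sigmaP hΓ,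
    sigmaM_mul_sigmaP hΓ, sigmaP_mul_sigmaM hΓ, gammaP_mul_sigmaM hΓ, gammaP_mul_sigmaP hΓ,
    gammaM_mul_sigmaM hΓ, gammaM_mul_sigmaP hΓ, sigmaM_mul_gammaP hΓ, sigmaP_mul_gammaP hΓ,
    sigmaM_mul_gammaM hΓ, sigmaP_mul_gammaM hΓ, gammaP_sq hΓ, gammaM_sq hΓ, gammaP_mul_gammaM,
    gammaM_mul_gammaP⟩

/-- The rules of `clifford_sort` for the first factors of a product. -/
theorem clifford_sort_assoc (T : S →L[ℂ] S) :
    (∀ i, sigmaM Γ * (gam Γ i * T) = gam Γ i * (sigmaM Γ * T))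
    ∧ (∀ i, sigmaP Γ * (gam Γ i * T) = gam Γ i * (sigmaP Γ * T))
    ∧ (∀ i, Γ ip * (gam Γ i * T) = gam Γ i * (Γ ip * T))
    ∧ (∀ i, Γ im * (gam Γ i * T) = gam Γ i * (Γ im * T))
    ∧ sigmaM Γ * (gam123 Γ * T) = gam123 Γ * (sigmaM Γ * T)
    ∧ sigmaP Γ * (gam123 Γ * T) = gam123 Γ * (sigmaP Γ * T)
    ∧ Γ ip * (gam123 Γ * T) = gam123 Γ * (Γ ip * T) ∧ Γ im * (gam123 Γ * T) = gam123 Γ * (Γ im * T)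
    ∧ (∀ i, gam Γ i * (gam123 Γ * T) = sgn i • (gam123 Γ * (gam Γ i * T)))
    ∧ gam123 Γ * (gam123 Γ * T) = T := by
  have h := clifford_sort hΓ
  refine ⟨fun i => ?_, fun i => ?_, fun i => ?_, fun i => ?_, ?_, ?_, ?_, ?_, fun i => ?_, ?_⟩ <;>
    rw [← mul_assoc] <;> simp only [h, ← mul_assoc, smul_mul_assoc, one_mul]

/-- First entry of the table of expressions A* T + T A, with A among N, P, Z, R and T among Γ₋, Γ₊,
`brP`, `brQ`, `brW`. Each entry has to reproduce a bracket of Killing fields, where these T carry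
the components +, -, i, i* and ij respectively. -/
theorem opN_act_gammaP : opNAdj Γ α β * Γ ip + Γ ip * opN Γ α β = 0 := by
  simp only [opNAdj, opN, mul_add, add_mul, mul_neg, smul_mul_assoc, mul_smul_comm, mul_assoc,
    clifford_sort hΓ, clifford_sort_assoc hΓ]
  module

theorem opN_act_gammaM : opNAdj Γ α β * Γ im + Γ im * opN Γ α β = 0 := by
  simp only [opNAdj, opN, mul_add, add_mul, mul_neg, smul_mul_assoc, mul_smul_comm, mul_assoc,
    clifford_sort hΓ, clifford_sort_assoc hΓ]
  module

theorem opP_act_gammaM (hl : ∀ i, lam α β i ≠ 0) (k : Fin 9) :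
    sgn k • (opP Γ α β k * Γ im) + Γ im * opP Γ α β k = lam α β k ^ 2 • brQ Γ α β k := by
  simp only [opP, brQ, mul_add, mul_neg, smul_mul_assoc, mul_smul_comm, mul_assoc,
    clifford_sort hΓ, clifford_sort_assoc hΓ, smul_smul, smul_add]
  have := hl k
  match_scalars <;> field_simp

theorem opZ_act_gammaM (k : Fin 9) : Γ im * opZ Γ k - opZ Γ k * Γ im = brP Γ k := by
  simp only [opZ, brP, mul_sub, mul_neg, smul_mul_assoc, mul_smul_comm, mul_assoc,
    clifford_sort hΓ, clifford_sort_assoc hΓ, smul_smul, smul_add]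
  module

/-- Together with `opN_act_brQ` this is the harmonic oscillator of frequency λ_i by which K₍₋₎ acts
on the pair K₍ᵢ₎, K₍ᵢ*₎. The factor i/λ_i in `brQ` is what α - ε_i β = i λ_i requires. -/
theorem opN_act_brP (hl : ∀ i, lam α β i ≠ 0) (i : Fin 9) :
    opNAdj Γ α β * brP Γ i + brP Γ i * opN Γ α β = lam α β i ^ 2 • brQ Γ α β i := by
  simp only [opNAdj, opN, brP, brQ, mul_add, add_mul, mul_sub, mul_neg, smul_mul_assoc,
    mul_smul_comm, mul_assoc, sub_mul, mul_zero,
    clifford_sort hΓ, clifford_sort_assoc hΓ, smul_smul, smul_add]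
  have h := hl i
  have h1 := sub_sgn_mul α β i
  have h2 := sgn_mul_self i
  match_scalars <;> field_simp
  · linear_combination h1
  · linear_combination sgn i * h1 + β * h2

theorem opN_act_brQ (hl : ∀ i, lam α β i ≠ 0) (i : Fin 9) :
    opNAdj Γ α β * brQ Γ α β i + brQ Γ α β i * opN Γ α β = -brP Γ i := by
  simp only [opNAdj, opN, brP, brQ, mul_add, add_mul, mul_sub, mul_neg, smul_mul_assoc,
    mul_smul_comm, mul_assoc, mul_zero,
    clifford_sort hΓ, clifford_sort_assoc hΓ, smul_smul, smul_add]
  have h := hl i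
  have h1 := sub_sgn_mul α β i
  have h2 := sgn_mul_self i
  have h3 := Complex.I_mul_I
  match_scalars <;> field_simp
  · linear_combination Complex.I * h1 + lam α β i * h3
  · linear_combination -Complex.I * h1 - lam α β i * h3 - Complex.I * α * h2

/-- The rotational components of the bracket are forced here: transverse translations carry `brP` to
`brW`. -/
theorem opP_act_brP (i k : Fin 9) :
    sgn k • (opP Γ α β k * brP Γ i) + brP Γ i * opP Γ α β k = -brW Γ α β i k := by
  simp only [opP, brP, brW, mul_add, mul_sub, sub_mul, mul_neg, smul_mul_assoc, mul_smul_comm,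
    mul_assoc, mul_zero, zero_sub,
    clifford_sort hΓ, clifford_sort_assoc hΓ, smul_smul, smul_add]
  have h2 := sgn_mul_self i
  module

theorem gam_mul_gam_add (i k : Fin 9) : gam Γ i * gam Γ k + gam Γ k * gam Γ i
    = (if i = k then -(2 : ℂ) else 0) • 1 := by
  rw [gam_mul_gam hΓ i k]; abel

theorem opZ_act_brP (i k : Fin 9) :
    brP Γ i * opZ Γ k - opZ Γ k * brP Γ i = if i = k then -Γ ip else 0 := by
  have h : brP Γ i * opZ Γ k - opZ Γ k * brP Γ i
      = (1 / 2 : ℂ) • ((gam Γ i * gam Γ k + gam Γ k * gam Γ i) * Γ ip) := by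
    simp only [opZ, brP, add_mul, mul_sub, sub_mul, mul_neg, smul_mul_assoc, mul_smul_comm,
      mul_assoc, mul_zero, zero_sub,
      clifford_sort hΓ, clifford_sort_assoc hΓ, smul_smul, smul_add]
    module
  rw [h, gam_mul_gam_add hΓ]
  split_ifs <;> simp [smul_smul]

/-- The products combine into the anticommutator of γ_i and γ_k, so only i = k survives, and there
the quotient of λ_k by λ_i is 1. -/
theorem opP_act_brQ (hl : ∀ i, lam α β i ≠ 0) (i k : Fin 9) :
    sgn k • (opP Γ α β k * brQ Γ α β i) + brQ Γ α β i * opP Γ α β k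
      = if i = k then -Γ ip else 0 := by
  have h : sgn k • (opP Γ α β k * brQ Γ α β i) + brQ Γ α β i * opP Γ α β k
      = (lam α β k / (2 * lam α β i)) • ((gam Γ i * gam Γ k + gam Γ k * gam Γ i) * Γ ip) := by
    simp only [opP, brQ, mul_add, add_mul, mul_sub, mul_neg, smul_mul_assoc, mul_smul_comm,
      mul_assoc, mul_zero,
      clifford_sort hΓ, clifford_sort_assoc hΓ, smul_smul, smul_add]
    have h1 := hl i
    have h2 := sgn_mul_self i
    have h4 := sgn_mul_self k
    have h3 := Complex.I_mul_I
    match_scalars <;> field_simp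
    · linear_combination lam α β k * (-sgn k ^ 2 * h3 + h4)
    · linear_combination lam α β k * (-sgn i ^ 2 * h3 + h2)
  rw [h, gam_mul_gam_add hΓ]
  have h1 := hl k
  split_ifs with hik
  · subst hik
    rw [smul_mul_assoc, one_mul, smul_smul, ← neg_one_smul ℂ (Γ ip)]
    congr 1
    field_simp
  · simp

/-- Across the blocks ε_k = -ε_i, and the two terms combine into the anticommutator of distinct γ's.
Hence the bracket of spinors contains no rotations mixing the blocks. -/
theorem brW_eq_zero {i k : Fin 9} (h : ¬(i.val < 3 ↔ k.val < 3)) : brW Γ α β i k = 0 := by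
  have hs : sgn k = -sgn i := by
    unfold sgn
    grind
  have hik : i ≠ k := fun e => h (e ▸ Iff.rfl)
  have h2 := gam_mul_gam_of_ne hΓ hik
  rw [brW, h2, hs, neg_smul, smul_neg]
  simp

theorem lam_smul_brW (i k : Fin 9) :
    lam α β i • brW Γ α β i k = lam α β k • brW Γ α β i k := by
  by_cases h : i.val < 3 ↔ k.val < 3
  · rw [lam_congr α β h]
  · rw [brW_eq_zero α β hΓ h, smul_zero, smul_zero]

theorem brW_skew (i k : Fin 9) : brW Γ α β i k = -brW Γ α β k i := by
  by_cases h : i.val < 3 ↔ k.val < 3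
  · rw [brW, brW, lam_congr α β h, ← smul_neg, ← neg_mul, ← mul_neg, neg_sub]
  · rw [brW_eq_zero α β hΓ h, brW_eq_zero α β hΓ fun h' => h h'.symm, neg_zero]

/-- The computation yields λ_k/λ_i times `brW`; since `brW` vanishes across the blocks, the quotient
may be replaced by 1. -/
theorem opZ_act_brQ (hl : ∀ i, lam α β i ≠ 0) (i k : Fin 9) :
    lam α β k ^ 2 • (brQ Γ α β i * opZ Γ k - opZ Γ k * brQ Γ α β i) = brW Γ α β i k := by
  have h : brQ Γ α β i * opZ Γ k - opZ Γ k * brQ Γ α β i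
      = (1 / (lam α β i * lam α β k)) • brW Γ α β i k := by
    simp only [opZ, brQ, brW, mul_add, add_mul, mul_sub, sub_mul, mul_neg, smul_mul_assoc,
      mul_smul_comm, mul_assoc, mul_zero, smul_sub,
      clifford_sort hΓ, clifford_sort_assoc hΓ, smul_smul, smul_add]
    have h1 := hl i
    have h2 := hl k
    match_scalars <;> field_simp
  have h1 := hl i
  have h2 := hl k
  have h3 := congrArg (fun T => (lam α β i)⁻¹ • T) (lam_smul_brW α β hΓ i k)
  simp only [smul_smul, inv_mul_cancel₀ h1, one_smul] at h3
  rw [h, smul_smul]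
  conv_rhs => rw [h3]
  congr 1
  field_simp

theorem opN_act_brW (i k : Fin 9) :
    opNAdj Γ α β * brW Γ α β i k + brW Γ α β i k * opN Γ α β = 0 := by
  by_cases h : i.val < 3 ↔ k.val < 3
  · have h1 := sgn_mul_self k
    simp only [opNAdj, opN, brW, mul_add, add_mul, mul_sub, sub_mul, mul_neg, smul_mul_assoc,
      mul_smul_comm, mul_assoc, mul_zero, smul_sub, sgn_congr h,
      clifford_sort hΓ, clifford_sort_assoc hΓ, smul_smul, smul_add, h1]
    match_scalars <;> ring
  · rw [brW_eq_zero α β hΓ h, mul_zero, zero_mul, add_zero]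

theorem opP_act_brW (i j k : Fin 9) :
    sgn j • (opP Γ α β j * brW Γ α β i k) + brW Γ α β i k * opP Γ α β j = 0 := by
  simp only [opP, brW, mul_add, add_mul, mul_sub, sub_mul, smul_mul_assoc,
    mul_smul_comm, mul_assoc, mul_zero, clifford_sort hΓ, clifford_sort_assoc hΓ, smul_zero]
  simp

theorem opZ_act_brW (i j k : Fin 9) :
    brW Γ α β i k * opZ Γ j - opZ Γ j * brW Γ α β i k = 0 := by
  simp only [opZ, brW, mul_add, add_mul, mul_sub, sub_mul, smul_mul_assoc,
    mul_smul_comm, mul_assoc, mul_zero, clifford_sort hΓ, clifford_sort_assoc hΓ, smul_zero]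
  simp

variable {w : Fin 9 → Fin 9 → ℂ}

theorem gam_mul_opR_sub (hw : ∀ i j, w i j = -w j i) (i : Fin 9) :
    gam Γ i * opR Γ w - opR Γ w * gam Γ i = -∑ k, w i k • gam Γ k := by
  rw [← neg_sub, opR_mul_gam_sub hΓ hw, neg_neg, ← Finset.sum_neg_distrib]
  exact Finset.sum_congr rfl fun k _ => by rw [hw k i, neg_smul]

theorem brP_mul_opR_sub (hw : ∀ i j, w i j = -w j i) (i : Fin 9) :
    brP Γ i * opR Γ w - opR Γ w * brP Γ i = -∑ k, w i k • brP Γ k := by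
  have h1 := ((opR_commute_sigmaP hΓ (w := w)).sub_right (opR_commute_sigmaM hΓ)).eq
  have h : brP Γ i * opR Γ w - opR Γ w * brP Γ i
      = (gam Γ i * opR Γ w - opR Γ w * gam Γ i) * (sigmaP Γ - sigmaM Γ) := by
    rw [brP, mul_assoc, ← h1, ← mul_assoc, ← mul_assoc, ← sub_mul]
  rw [h, gam_mul_opR_sub hΓ hw, neg_mul, Finset.sum_mul]
  simp only [smul_mul_assoc, brP]

theorem brQ_mul_opR_sub (hw : IsRot w) (i : Fin 9) :
    brQ Γ α β i * opR Γ w - opR Γ w * brQ Γ α β i = -∑ k, w i k • brQ Γ α β k := by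
  have h1 := ((opR_commute_sigmaP hΓ (w := w)).add_right
    ((opR_commute_sigmaM hΓ).smul_right (sgn i))).eq
  have h2 := (opR_commute_gam123 hΓ hw).eq
  have h : brQ Γ α β i * opR Γ w - opR Γ w * brQ Γ α β i = (Complex.I / lam α β i) •
      (gam123 Γ * (gam Γ i * opR Γ w - opR Γ w * gam Γ i) * (sigmaP Γ + sgn i • sigmaM Γ)) := by
    rw [brQ, smul_mul_assoc, mul_smul_comm, ← smul_sub, mul_assoc, ← h1, ← mul_assoc, ← mul_assoc,
      ← mul_assoc, h2, ← sub_mul, mul_sub, mul_assoc, mul_assoc (gam123 Γ)]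
  rw [h, gam_mul_opR_sub hΓ hw.1, mul_neg, neg_mul, smul_neg, Finset.mul_sum, Finset.sum_mul,
    Finset.smul_sum]
  congr 1
  refine Finset.sum_congr rfl fun k _ => ?_
  by_cases hik : i.val < 3 ↔ k.val < 3
  · rw [brQ, lam_congr α β hik, sgn_congr hik, mul_smul_comm, smul_mul_assoc, smul_comm]
  · simp [hw.2 i k hik]

theorem brW_mul_opR_sub (hw : IsRot w) (i k : Fin 9) :
    brW Γ α β i k * opR Γ w - opR Γ w * brW Γ α β i k
      = ∑ j, (w j k • brW Γ α β i j - w i j • brW Γ α β j k) := by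
  have hp := (opR_commute_gammaP hΓ (w := w)).eq
  have hg := (opR_commute_gam123 hΓ hw).eq
  have hgg : ∀ a b, gam Γ a * gam Γ b * opR Γ w - opR Γ w * (gam Γ a * gam Γ b)
      = -∑ j, (w b j • (gam Γ a * gam Γ j) + w a j • (gam Γ j * gam Γ b)) := by
    intro a b
    have ha := gam_mul_opR_sub hΓ hw.1 a
    have hb := gam_mul_opR_sub hΓ hw.1 b
    calc _ = gam Γ a * (gam Γ b * opR Γ w - opR Γ w * gam Γ b)
          + (gam Γ a * opR Γ w - opR Γ w * gam Γ a) * gam Γ b := by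
          rw [sub_mul, mul_sub]; simp only [mul_assoc]; abel
      _ = _ := by
          rw [ha, hb, mul_neg, neg_mul, ← neg_add, Finset.mul_sum, Finset.sum_mul,
            ← Finset.sum_add_distrib]
          simp only [mul_smul_comm, smul_mul_assoc]
  have h : brW Γ α β i k * opR Γ w - opR Γ w * brW Γ α β i k = (Complex.I * lam α β k / 2) •
      (gam123 Γ * (sgn k • (gam Γ k * gam Γ i * opR Γ w - opR Γ w * (gam Γ k * gam Γ i))
        - sgn i • (gam Γ i * gam Γ k * opR Γ w - opR Γ w * (gam Γ i * gam Γ k))) * Γ ip) := by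
    rw [brW, smul_mul_assoc, mul_smul_comm, ← smul_sub, mul_assoc _ (Γ ip), ← hp, ← mul_assoc,
      ← mul_assoc, ← mul_assoc, hg, ← sub_mul, mul_assoc, mul_assoc (gam123 Γ) (opR Γ w), ← mul_sub]
    simp only [sub_mul, mul_sub, smul_sub, smul_mul_assoc, mul_smul_comm]
    abel_nf
  rw [h, hgg, hgg]
  simp only [smul_neg, Finset.smul_sum, ← Finset.sum_neg_distrib, ← Finset.sum_sub_distrib,
    Finset.mul_sum, Finset.sum_mul]
  refine Finset.sum_congr rfl fun j _ => ?_
  -- The signs and λ in the definition of `brW` refer to its own indices, so after a rotation has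
  -- changed an index they must be transferred along w.
  have hij : sgn i * w i j = sgn j * w i j := hw.mul_eq (fun h => sgn_congr h) i j
  have hjk : sgn j * w j k = sgn k * w j k := hw.mul_eq (fun h => sgn_congr h) j k
  have ljk : lam α β j * w j k = lam α β k * w j k := hw.mul_eq (lam_congr α β) j k
  rw [hw.1 k j]
  simp only [brW, mul_add, mul_sub, mul_neg, mul_smul_comm, sub_mul, add_mul, neg_mul,
    smul_mul_assoc]
  match_scalars
  · ring
  · linear_combination -(Complex.I / 2) * (lam α β j * hjk + sgn k * ljk)
  · linear_combination Complex.I / 2 * sgn i * ljk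
  · linear_combination Complex.I / 2 * lam α β k * hij

end Action

end BracketOperators

/-! ### The bracket of spinors as a Killing field -/

section Bracket

variable {S : Type*} [NormedAddCommGroup S] [NormedSpace ℂ S]
  {Γ : Ix → S →L[ℂ] S} {C : S →ₗ[ℂ] S →ₗ[ℂ] ℂ} {α β : ℂ}

/-- Linearity reduces the action of a general Killing field to the table for the generators. -/
theorem opGen_act (b : ℂ) (f g : Fin 9 → ℂ) (w : Fin 9 → Fin 9 → ℂ) (T : S →L[ℂ] S) :
    opGenAdj Γ α β b f g w * T + T * opGen Γ α β b f g w
      = b • (opNAdj Γ α β * T + T * opN Γ α β)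
        - ∑ k, f k • (sgn k • (opP Γ α β k * T) + T * opP Γ α β k)
        + ∑ k, g k • (T * opZ Γ k - opZ Γ k * T) + (T * opR Γ w - opR Γ w * T) := by
  simp only [opGenAdj, opGen, mul_add, mul_sub, sub_mul, Finset.sum_mul, Finset.mul_sum,
    smul_mul_assoc, mul_smul_comm, smul_add, smul_sub, Finset.sum_add_distrib,
    Finset.sum_sub_distrib]
  abel

section Act

variable (hΓ : IsClifford Γ) (b : ℂ) (f g q : Fin 9 → ℂ) {w : Fin 9 → Fin 9 → ℂ}
include hΓ

theorem opGen_act_gammaP :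
    opGenAdj Γ α β b f g w * Γ ip + Γ ip * opGen Γ α β b f g w = 0 := by
  have hP : ∀ k, opP Γ α β k * Γ ip = 0 := fun k => by
    rw [opP_eq_mul_gammaP hΓ, smul_mul_assoc, mul_assoc, gammaP_sq hΓ]; simp
  have hZ : ∀ k, opZ Γ k * Γ ip = 0 := fun k => by
    rw [opZ_eq_mul_gammaP hΓ, smul_mul_assoc, mul_assoc, gammaP_sq hΓ]; simp
  rw [opGen_act, opN_act_gammaP α β hΓ, (opR_commute_gammaP hΓ).eq]
  simp [hP, hZ, gammaP_mul_opP hΓ, gammaP_mul_opZ hΓ]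

theorem opGen_act_gammaM (hl : ∀ i, lam α β i ≠ 0) :
    opGenAdj Γ α β b f g w * Γ im + Γ im * opGen Γ α β b f g w
      = ∑ k, g k • brP Γ k - ∑ k, (f k * lam α β k ^ 2) • brQ Γ α β k := by
  rw [opGen_act, opN_act_gammaM α β hΓ, (opR_commute_gammaM hΓ).eq]
  simp only [opP_act_gammaM α β hΓ hl, opZ_act_gammaM hΓ, smul_zero, sub_self, add_zero, zero_sub,
    smul_smul]
  abel

theorem opGen_act_brP (hl : ∀ i, lam α β i ≠ 0) (hw : IsRot w) (i : Fin 9) :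
    opGenAdj Γ α β b f g w * brP Γ i + brP Γ i * opGen Γ α β b f g w
      = (b * lam α β i ^ 2) • brQ Γ α β i + ∑ k, f k • brW Γ α β i k - g i • Γ ip
        - ∑ k, w i k • brP Γ k := by
  rw [opGen_act, opN_act_brP α β hΓ hl, brP_mul_opR_sub hΓ hw.1]
  simp only [opP_act_brP α β hΓ, opZ_act_brP hΓ, smul_neg, smul_ite, smul_zero,
    Finset.sum_ite_eq, Finset.mem_univ, if_true, smul_smul, Finset.sum_neg_distrib]
  abel

theorem opGen_act_brQ (hl : ∀ i, lam α β i ≠ 0) (hw : IsRot w) (i : Fin 9) :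
    opGenAdj Γ α β b f (fun k => lam α β k ^ 2 * q k) w * brQ Γ α β i
        + brQ Γ α β i * opGen Γ α β b f (fun k => lam α β k ^ 2 * q k) w
      = -(b • brP Γ i) + f i • Γ ip + ∑ k, q k • brW Γ α β i k
        - ∑ k, w i k • brQ Γ α β k := by
  rw [opGen_act, opN_act_brQ α β hΓ hl, brQ_mul_opR_sub α β hΓ hw]
  simp only [opP_act_brQ α β hΓ hl, mul_comm (lam α β _ ^ 2), mul_smul, opZ_act_brQ α β hΓ hl,
    smul_neg, smul_ite, smul_zero, Finset.sum_ite_eq, Finset.mem_univ, if_true]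
  abel

theorem opGen_act_brW (hw : IsRot w) (i k : Fin 9) :
    opGenAdj Γ α β b f g w * brW Γ α β i k + brW Γ α β i k * opGen Γ α β b f g w
      = ∑ j, (w j k • brW Γ α β i j - w i j • brW Γ α β j k) := by
  rw [opGen_act, opN_act_brW α β hΓ, brW_mul_opR_sub α β hΓ hw]
  simp only [opP_act_brW α β hΓ, opZ_act_brW α β hΓ, smul_zero, Finset.sum_const_zero]
  abel

end Act

/-- The Killing field `{ξ,η}` for the spinors `ξ, η` with values `s, t` at the origin. -/
def brKill (Γ : Ix → S →L[ℂ] S) (C : S →ₗ[ℂ] S →ₗ[ℂ] ℂ) (α β : ℂ) (s t : S) : VField :=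
  killField (lam α β) (C s (Γ im t)) (C s (Γ ip t)) (fun i => C s (brP Γ i t))
    (fun i => C s (brQ Γ α β i t)) (fun i k => C s (brW Γ α β i k t))

theorem isRot_brW (hΓ : IsClifford Γ) (s t : S) : IsRot fun i k => C s (brW Γ α β i k t) := by
  refine ⟨fun i k => ?_, fun i k h => ?_⟩
  · simp only [brW_skew α β hΓ i k, neg_apply, map_neg]
  · simp only [brW_eq_zero α β hΓ h, zero_apply, map_zero]

theorem brKill_mem (hΓ : IsClifford Γ) (s t : S) : brKill Γ C α β s t ∈ killingAlg α β :=
  mem_killingAlg_iff.2 ⟨_, _, _, _, _, isRot_brW hΓ s t, rfl⟩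

/-- A skew form composed with a skew-adjoint operator is symmetric. -/
theorem brKill_symm (hC : IsChargeConj Γ C) (hΓ : IsClifford Γ) (s t : S) :
    brKill Γ C α β s t = brKill Γ C α β t s := by
  have h := hC.2.1
  unfold brKill
  congr 1
  · exact (isAdj_gamma hC im).symm_of_neg h s t
  · exact (isAdj_gamma hC ip).symm_of_neg h s t
  · exact funext fun i => (isAdj_brP hC hΓ i).symm_of_neg h s t
  · exact funext fun i => (isAdj_brQ α β hC hΓ i).symm_of_neg h s t
  · exact funext fun i => funext fun k => (isAdj_brW α β hC hΓ i k).symm_of_neg h s t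

theorem brKill_add (s t t' : S) :
    brKill Γ C α β s (t + t') = brKill Γ C α β s t + brKill Γ C α β s t' := by
  rw [brKill, brKill, brKill, killField_add]
  simp only [map_add]
  rfl

theorem brKill_smul (z : ℂ) (s t : S) : brKill Γ C α β s (z • t) = z • brKill Γ C α β s t := by
  rw [brKill, brKill, killField_smul]
  simp only [map_smul]
  rfl

theorem IsAdj.apply_self_eq {T T' : S →L[ℂ] S} (hT : IsAdj C T T') (hC : ∀ s t, C s t = -C t s)
    (s : S) : C s (T s) = -C s (T' s) := by
  rw [hC, hT]

/-- The operators `brP`, `brQ`, `brW` are symmetrised versions of the asymmetric expressions in ξ₁⁰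
and ξ₂⁰. On the diagonal, skewness of C makes the two halves equal, which produces the factors 2 of
the formula. -/
theorem brKill_self (hC : IsChargeConj Γ C) (hΓ : IsClifford Γ) (s : S) :
    brKill Γ C α β s s = brField Γ C α β (sigmaM Γ s) (sigmaP Γ s) := by
  have hM : ∀ t, C (sigmaM Γ s) t = C s (sigmaP Γ t) := fun t => isAdj_sigmaM hC s t
  have hP : ∀ t, C (sigmaP Γ s) t = C s (sigmaM Γ t) := fun t => isAdj_sigmaP hC s t
  have ap : ∀ {T T' : S →L[ℂ] S}, T = T' → ∀ s, T s = T' s := fun h s => by rw [h]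
  rw [brKill, killField_eq _ _ _ _ _ _ (isRot_brW hΓ s s).1, brField]
  congr 1
  · congr 1
    · congr 1
      · congr 1
        · rw [hM]
          have e := ap (show sigmaP Γ * (Γ im * sigmaM Γ) = Γ im by
            rw [gammaM_mul_sigmaM hΓ, sigmaP_mul_gammaM hΓ]) s
          rw [← e]; rfl
        · rw [hP]
          have e := ap (show sigmaM Γ * (Γ ip * sigmaP Γ) = Γ ip by
            rw [gammaP_mul_sigmaP hΓ, sigmaM_mul_gammaP hΓ]) s
          rw [← e]; rfl
      · refine Finset.sum_congr rfl fun i _ => ?_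
        congr 1
        -- This turns the half of `brP` that contains σ₋ into the half that contains σ₊.
        have h1 := ((isAdj_gam hC hΓ i).mul (isAdj_sigmaM hC)).apply_self_eq hC.2.1 s
        have e := ap (show sigmaP Γ * (gam Γ i * sigmaP Γ) = sigmaP Γ * gam Γ i by
          rw [(gam_commute_sigmaP hΓ i).eq, ← mul_assoc, sigmaP_mul_sigmaP hΓ]) s
        have e2 := ap (gam_commute_sigmaP hΓ i).eq s
        rw [hM]
        simp only [brP, mul_sub, sub_apply, map_sub, mul_apply_eq_comp] at h1 e e2 ⊢
        rw [h1, e, e2]; ring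
    · refine Finset.sum_congr rfl fun i _ => ?_
      congr 1
      have h1 := (((isAdj_gam123 hC hΓ).mul (isAdj_gam hC hΓ i)).mul
        (isAdj_sigmaM hC)).apply_self_eq hC.2.1 s
      have e1 : sigmaP Γ * (gam Γ i * -gam123 Γ) = -(sgn i • (gam123 Γ * (gam Γ i * sigmaP Γ))) := by
        simp only [mul_neg, clifford_sort hΓ, clifford_sort_assoc hΓ, mul_smul_comm]
      have e := ap (show sigmaP Γ * (gam123 Γ * (gam Γ i * sigmaP Γ))
        = gam123 Γ * (gam Γ i * sigmaP Γ) by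
          simp only [clifford_sort hΓ, clifford_sort_assoc hΓ]) s
      rw [e1] at h1
      rw [hM]
      simp only [brQ, mul_add, add_apply, neg_apply, smul_apply, map_add, map_neg, map_smul,
        smul_eq_mul, mul_apply_eq_comp, mul_smul_comm, neg_neg] at h1 e ⊢
      rw [e]
      linear_combination Complex.I / lam α β i * (sgn i * h1
        + C s (gam123 Γ (gam Γ i (sigmaP Γ s))) * sgn_mul_self i)
  · congr 1
    refine Finset.sum_congr rfl fun i _ => Finset.sum_congr rfl fun k _ => ?_
    congr 1
    by_cases h : i.val < 3 ↔ k.val < 3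
    · have h1 := ((isAdj_gam123 hC hΓ).mul (((isAdj_gam hC hΓ k).mul (isAdj_gam hC hΓ i)).mul
        (isAdj_gamma hC ip))).apply_self_eq hC.2.1 s
      have e1 : -Γ ip * (gam Γ i * gam Γ k) * -gam123 Γ
          = gam123 Γ * (gam Γ i * (gam Γ k * Γ ip)) := by
        simp only [neg_mul, mul_neg, neg_neg, mul_assoc, clifford_sort hΓ, clifford_sort_assoc hΓ,
          mul_smul_comm, sgn_congr h, smul_smul, sgn_mul_self, one_smul]
      have e2 := ap (show sigmaM Γ * (Γ ip * (gam123 Γ * (gam Γ i * (gam Γ k * sigmaP Γ))))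
          = gam123 Γ * (gam Γ i * (gam Γ k * Γ ip)) by
        simp only [clifford_sort hΓ, clifford_sort_assoc hΓ]) s
      rw [e1] at h1
      have e3 : C s (brW Γ α β i k s) = -(Complex.I * lam α β i * sgn i)
          * C s (gam123 Γ (gam Γ i (gam Γ k (Γ ip s)))) := by
        rw [lam_congr α β h, sgn_congr h]
        simp only [brW, sgn_congr h, mul_sub, sub_mul, mul_assoc, mul_smul_comm, smul_mul_assoc,
          smul_apply, sub_apply, mul_apply_eq_comp, map_smul, map_sub, smul_eq_mul] at h1 ⊢
        rw [h1]; ring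
      simp only [mul_apply_eq_comp] at e2
      rw [e3, ← e2, ← hP, brRot]
      unfold sgn
      by_cases hi : i.val < 3
      · rw [if_pos hi, if_pos ⟨hi, h.1 hi⟩]; ring
      · have hk : ¬k.val < 3 := fun hk => hi (h.2 hk)
        rw [if_neg hi, if_neg fun h => hi h.1, if_pos ⟨not_lt.1 hi, not_lt.1 hk⟩]; ring
    · rw [brW_eq_zero α β hΓ h, brRot, if_neg, if_neg]
      · simp
      · rintro ⟨h1, h2⟩; omega
      · rintro ⟨h1, h2⟩; omega

/-- Symmetry of the forms turns 2 C(A s, T s) into C(s, (A* T + T A) s). The table of actions then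
matches the parameters given by `lieBr_killField` one by one. -/
theorem two_smul_brKill (hC : IsChargeConj Γ C) (hΓ : IsClifford Γ) (h : Admissible α β)
    (a b : ℂ) (p q : Fin 9 → ℂ) {w : Fin 9 → Fin 9 → ℂ} (hw : IsRot w) (s : S) :
    2 • brKill Γ C α β (opGen Γ α β b p (fun i => lam α β i ^ 2 * q i) w s) s
      = lieBr (killField (lam α β) a b p q w) (brKill Γ C α β s s) := by
  have hl := lam_ne_zero h
  have key : ∀ {T : S →L[ℂ] S}, IsAdj C T (-T) →
      2 * C (opGen Γ α β b p (fun i => lam α β i ^ 2 * q i) w s) (T s)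
      = C s ((opGenAdj Γ α β b p (fun i => lam α β i ^ 2 * q i) w * T
        + T * opGen Γ α β b p (fun i => lam α β i ^ 2 * q i) w) s) := by
    intro T hT
    rw [two_mul, add_apply, map_add, mul_apply_eq_comp, mul_apply_eq_comp,
      ← isAdj_opGen α β hC hΓ hw.1, hT.symm_of_neg hC.2.1 s]
  rw [two_smul ℕ, ← two_smul ℂ, brKill, brKill, killField_smul,
    lieBr_killField _ _ _ _ _ _ _ _ (lam_congr α β) hw (isRot_brW hΓ s s)]
  congr 1
  · rw [key (isAdj_gamma hC im), opGen_act_gammaM hΓ _ _ _ hl]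
    simp only [sub_apply, sum_apply, smul_apply, map_sub, map_sum, map_smul, smul_eq_mul]
    rw [← Finset.sum_sub_distrib, ← Finset.sum_neg_distrib]
    exact Finset.sum_congr rfl fun i _ => by ring
  · rw [key (isAdj_gamma hC ip), opGen_act_gammaP hΓ]; simp
  · funext i
    rw [Pi.smul_apply, smul_eq_mul, key (isAdj_brP hC hΓ i), opGen_act_brP hΓ _ _ _ hl hw]
    simp only [sub_apply, add_apply, sum_apply, smul_apply, map_sub, map_add, map_sum, map_smul,
      smul_eq_mul, Finset.sum_sub_distrib]
    rw [Finset.sum_congr rfl fun k _ => mul_comm (p k) _]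
    ring
  · funext i
    rw [Pi.smul_apply, smul_eq_mul, key (isAdj_brQ α β hC hΓ i), opGen_act_brQ hΓ _ _ _ hl hw]
    simp only [sub_apply, add_apply, neg_apply, sum_apply, smul_apply, map_sub, map_add, map_neg,
      map_sum, map_smul, smul_eq_mul, Finset.sum_sub_distrib]
    rw [Finset.sum_congr rfl fun k _ => mul_comm (q k) _]
    ring
  · funext i k
    rw [Pi.smul_apply, Pi.smul_apply, smul_eq_mul, key (isAdj_brW α β hC hΓ i k),
      opGen_act_brW hΓ _ _ _ hw]
    simp only [sub_apply, sum_apply, smul_apply, map_sub, map_sum, map_smul,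
      smul_eq_mul]
    exact Finset.sum_congr rfl fun j _ => by ring

end Bracket

/-! ### The superalgebra -/

section Superalgebra

variable {S : Type*} [NormedAddCommGroup S] [NormedSpace ℂ S] [FiniteDimensional ℂ S]
  {Γ : Ix → S →L[ℂ] S} {C : S →ₗ[ℂ] S →ₗ[ℂ] ℂ} {α β : ℂ}

theorem parallel_ext (hΓ : IsClifford Γ) (h : Admissible α β) {ξ η : parallel (famD Γ α β)}
    (h0 : (ξ : Field S) 0 = (η : Field S) 0) : ξ = η :=
  (evalEquiv hΓ h).injective h0

/-- The action of the Killing algebra on parallel spinors by the spinorial Lie derivative. -/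
def lieAction (hΓ : IsClifford Γ) (h : Admissible α β) :
    killingAlg α β →ₗ[ℂ] Module.End ℂ (parallel (famD Γ α β)) where
  toFun X :=
    { toFun := fun ξ => ⟨spinorLie (famB α β) Γ X ξ, spinorLie_mem_parallel hΓ h X.2 ξ.2⟩
      map_add' := fun ξ η => by
        obtain ⟨a, b, p, q, w, hw, e⟩ := mem_killingAlg_iff.1 X.2
        refine parallel_ext hΓ h ?_
        change spinorLie (famB α β) Γ X (ξ + η : parallel (famD Γ α β)) 0
          = spinorLie (famB α β) Γ X ξ 0 + spinorLie (famB α β) Γ X η 0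
        rw [e, spinorLie_killField_zero hΓ h _ _ _ _ _ ξ.2,
          spinorLie_killField_zero hΓ h _ _ _ _ _ η.2,
          spinorLie_killField_zero hΓ h _ _ _ _ _ (ξ + η).2, ← map_add]
        rfl
      map_smul' := fun z ξ => by
        obtain ⟨a, b, p, q, w, hw, e⟩ := mem_killingAlg_iff.1 X.2
        refine parallel_ext hΓ h ?_
        change spinorLie (famB α β) Γ X (z • ξ : parallel (famD Γ α β)) 0
          = z • spinorLie (famB α β) Γ X ξ 0
        rw [e, spinorLie_killField_zero hΓ h _ _ _ _ _ ξ.2,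
          spinorLie_killField_zero hΓ h _ _ _ _ _ (z • ξ).2, ← map_smul]
        rfl }
  map_add' X Y := LinearMap.ext fun ξ => Subtype.ext
    (spinorLie_add _ (contDiff_of_mem_killingAlg X.2) (contDiff_of_mem_killingAlg Y.2) _)
  map_smul' z X := LinearMap.ext fun ξ => Subtype.ext
    (spinorLie_smul _ z (contDiff_of_mem_killingAlg X.2) _)

theorem lieAction_apply (hΓ : IsClifford Γ) (h : Admissible α β) (X : killingAlg α β)
    (ξ : parallel (famD Γ α β)) :
    (lieAction hΓ h X ξ : Field S) = spinorLie (famB α β) Γ X ξ := rfl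

theorem lieAction_apply_zero (hΓ : IsClifford Γ) (h : Admissible α β) {X : killingAlg α β}
    {a b : ℂ} {p q : Fin 9 → ℂ} {w : Fin 9 → Fin 9 → ℂ}
    (hX : (X : VField) = killField (lam α β) a b p q w) (ξ : parallel (famD Γ α β)) :
    (lieAction hΓ h X ξ : Field S) 0
      = opGen Γ α β b p (fun i => lam α β i ^ 2 * q i) w ((ξ : Field S) 0) := by
  rw [lieAction_apply, hX, spinorLie_killField_zero hΓ h _ _ _ _ _ ξ.2]

/-- Both sides are parallel spinors, so it suffices to compare values at the origin, where the claim
is the agreement of the structure constants of operators and Killing fields. -/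
theorem lieAction_bracket (hΓ : IsClifford Γ) (h : Admissible α β) (X Y : killingAlg α β) :
    lieAction hΓ h X * lieAction hΓ h Y - lieAction hΓ h Y * lieAction hΓ h X
      = lieAction hΓ h ⟨lieBr X Y, lieBr_mem_killingAlg X.2 Y.2⟩ := by
  obtain ⟨a, b, p, q, w, hw, e⟩ := mem_killingAlg_iff.1 X.2
  obtain ⟨a', b', p', q', w', hw', e'⟩ := mem_killingAlg_iff.1 Y.2
  refine LinearMap.ext fun ξ => parallel_ext hΓ h ?_
  have h1 := lieAction_apply_zero hΓ h (X := ⟨lieBr X Y, lieBr_mem_killingAlg X.2 Y.2⟩) (by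
    change lieBr X Y = _
    rw [e, e', lieBr_killField a b p q a' b' p' q' (lam_congr α β) hw hw']) ξ
  rw [h1]
  change (lieAction hΓ h X (lieAction hΓ h Y ξ) : Field S) 0
    - (lieAction hΓ h Y (lieAction hΓ h X ξ) : Field S) 0 = _
  rw [lieAction_apply_zero hΓ h e (lieAction hΓ h Y ξ),
    lieAction_apply_zero hΓ h e' (lieAction hΓ h X ξ), lieAction_apply_zero hΓ h e ξ,
    lieAction_apply_zero hΓ h e' ξ]
  have h2 := congrArg (fun T : S →L[ℂ] S => T ((ξ : Field S) 0)) (opGen_commutator hΓ hw hw' α β b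
    b' p (fun i => lam α β i ^ 2 * q i) p' (fun i => lam α β i ^ 2 * q' i))
  simp only [sub_apply, mul_apply_eq_comp] at h2
  rw [h2]
  have e1 : (fun i => b * (lam α β i ^ 2 * q' i) - b' * (lam α β i ^ 2 * q i)
      + ∑ j, (w' i j * p j - w i j * p' j)) = fun i => b * lam α β i ^ 2 * q' i
        - b' * lam α β i ^ 2 * q i + ∑ j, (w' i j * p j - w i j * p' j) := by
    funext i; ring
  have e2 : (fun i => lam α β i ^ 2 * (-(b * p' i) + b' * p i)
      + ∑ j, (w' i j * (lam α β j ^ 2 * q j) - w i j * (lam α β j ^ 2 * q' j)))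
      = fun i => lam α β i ^ 2 * (-(b * p' i) + b' * p i
        + ∑ j, (w' i j * q j - w i j * q' j)) := by
    funext i
    rw [mul_add (lam α β i ^ 2) (_ + _), Finset.mul_sum]
    congr 1
    refine Finset.sum_congr rfl fun j _ => ?_
    have h3 := hw.mul_eq (f := fun i => lam α β i ^ 2) (fun h => by rw [lam_congr α β h]) i j
    have h4 := hw'.mul_eq (f := fun i => lam α β i ^ 2) (fun h => by rw [lam_congr α β h]) i j
    linear_combination q' j * h3 - q j * h4
  rw [e1, e2]

/-- The bracket of parallel spinors. -/
def oddBracket (hC : IsChargeConj Γ C) (hΓ : IsClifford Γ) (α β : ℂ) :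
    parallel (famD Γ α β) →ₗ[ℂ] parallel (famD Γ α β) →ₗ[ℂ] killingAlg α β :=
  LinearMap.mk₂ ℂ (fun ξ η => ⟨brKill Γ C α β ((ξ : Field S) 0) ((η : Field S) 0),
      brKill_mem hΓ _ _⟩)
    (fun ξ ξ' η => Subtype.ext (by
      change brKill Γ C α β ((ξ : Field S) 0 + (ξ' : Field S) 0) ((η : Field S) 0)
        = brKill Γ C α β ((ξ : Field S) 0) ((η : Field S) 0)
          + brKill Γ C α β ((ξ' : Field S) 0) ((η : Field S) 0)
      rw [brKill_symm hC hΓ, brKill_add, brKill_symm hC hΓ ((η : Field S) 0),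
        brKill_symm hC hΓ ((η : Field S) 0)]))
    (fun z ξ η => Subtype.ext (by
      change brKill Γ C α β (z • (ξ : Field S) 0) ((η : Field S) 0)
        = z • brKill Γ C α β ((ξ : Field S) 0) ((η : Field S) 0)
      rw [brKill_symm hC hΓ, brKill_smul, brKill_symm hC hΓ ((η : Field S) 0)]))
    (fun ξ η η' => Subtype.ext (brKill_add _ _ _))
    (fun z ξ η => Subtype.ext (brKill_smul _ _ _))

/-- The geometric superalgebra of the family. -/
def superalgebra (hC : IsChargeConj Γ C) (hΓ : IsClifford Γ) (h : Admissible α β) :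
    GeomSuperalgebra (famB α β) (famD Γ α β) where
  even := killingAlg α β
  even_killing _ hX := isKilling_of_mem_killingAlg h hX
  even_lie _ hX _ hY := lieBr_mem_killingAlg hX hY
  odd := parallel (famD Γ α β)
  odd_parallel := le_rfl
  L := lieAction hΓ h
  L_lie := lieAction_bracket hΓ h
  br := oddBracket hC hΓ α β
  br_symm ξ η := Subtype.ext (brKill_symm hC hΓ _ _)
  compat X ξ := by
    obtain ⟨a, b, p, q, w, hw, e⟩ := mem_killingAlg_iff.1 X.2
    refine Subtype.ext ?_
    change 2 • brKill Γ C α β ((lieAction hΓ h X ξ : Field S) 0) ((ξ : Field S) 0)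
      = lieBr X (brKill Γ C α β ((ξ : Field S) 0) ((ξ : Field S) 0))
    rw [lieAction_apply_zero hΓ h e, e]
    exact two_smul_brKill hC hΓ h a b p q hw _

theorem superalgebra_nu [Nontrivial S] (hC : IsChargeConj Γ C) (hΓ : IsClifford Γ)
    (h : Admissible α β) : (superalgebra hC hΓ h).nu = 1 := by
  have e : Module.finrank ℂ (parallel (famD Γ α β)) = Module.finrank ℂ S :=
    (evalEquiv hΓ h).finrank_eq
  have e0 : (Module.finrank ℂ S : ℚ) ≠ 0 := by exact_mod_cast Module.finrank_pos.ne'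
  change (Module.finrank ℂ (parallel (famD Γ α β)) : ℚ) / _ = 1
  rw [e, div_self e0]

end Superalgebra

/-! ### Rescaling of the parameters -/

section Rescale

/-- Transport of vector fields along `(x⁺, x⁻, x^i) ↦ (t x⁺, t⁻¹ x⁻, x^i)`. -/
def rescale (t : ℝ) : VField →ₗ[ℂ] VField where
  toFun X x := Sum.elim (fun k => if k = 0 then t * X (Sum.elim ![t⁻¹ * x ip, t * x im]
      fun i => x (iv i)) ip else (t : ℂ)⁻¹ * X (Sum.elim ![t⁻¹ * x ip, t * x im]
      fun i => x (iv i)) im)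
    fun i => X (Sum.elim ![t⁻¹ * x ip, t * x im] fun i => x (iv i)) (iv i)
  map_add' X Y := by
    funext x
    refine Ix_ext ?_ ?_ fun k => ?_ <;> simp [mul_add]
  map_smul' z X := by
    funext x
    refine Ix_ext ?_ ?_ fun k => ?_ <;> simp [mul_left_comm]

theorem lam_mul (t α β : ℂ) (i : Fin 9) : lam (t * α) (t * β) i = t * lam α β i := by
  unfold lam
  split_ifs <;> ring

theorem rescale_killField {t : ℝ} (ht : t ≠ 0) (α β a b : ℂ) (p q : Fin 9 → ℂ)
    (w : Fin 9 → Fin 9 → ℂ) : rescale t (killField (lam α β) a b p q w)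
      = killField (lam (t * α) (t * β)) (t * a) ((t : ℂ)⁻¹ * b) p (fun i => (t : ℂ)⁻¹ * q i) w := by
  have ht' : (t : ℂ) ≠ 0 := by exact_mod_cast ht
  have e : ∀ i (y : ℝ), lam α β i * ((t * y : ℝ) : ℂ) = t * lam α β i * (y : ℂ) := by
    intro i y; push_cast; ring
  funext x
  refine Ix_ext ?_ ?_ fun k => ?_
  · change (t : ℂ) * killField (lam α β) a b p q w _ ip = _
    rw [killField_ip, killField_ip]
    simp only [lam_mul, im, iv, Sum.elim_inl, Sum.elim_inr, Matrix.cons_val_one,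
      Matrix.cons_val_fin_one, e]
    rw [mul_add, Finset.mul_sum, mul_neg]
    congr 1
    refine Finset.sum_congr rfl fun i _ => ?_
    field_simp
  · change (t : ℂ)⁻¹ * killField (lam α β) a b p q w _ im = _
    rw [killField_im, killField_im, mul_neg]
  · change killField (lam α β) a b p q w _ (iv k) = _
    rw [killField_iv, killField_iv]
    simp only [lam_mul, im, iv, Sum.elim_inl, Sum.elim_inr, Matrix.cons_val_one,
      Matrix.cons_val_fin_one, e]
    congr 2
    field_simp

theorem rescale_mem {t : ℝ} (ht : t ≠ 0) {α β : ℂ} {X : VField} (hX : X ∈ killingAlg α β) :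
    rescale t X ∈ killingAlg (t * α) (t * β) := by
  obtain ⟨a, b, p, q, w, hw, rfl⟩ := mem_killingAlg_iff.1 hX
  rw [rescale_killField ht]
  exact mem_killingAlg_iff.2 ⟨_, _, _, _, _, hw, rfl⟩

theorem rescale_rescale {s t : ℝ} (h : s * t = 1) (X : VField) : rescale s (rescale t X) = X := by
  have ht : t = s⁻¹ := eq_inv_of_mul_eq_one_right h
  have hs : s ≠ 0 := left_ne_zero_of_mul_eq_one h
  subst ht
  have hs' : (s : ℂ) ≠ 0 := by exact_mod_cast hs
  funext x
  have e : (Sum.elim ![s⁻¹⁻¹ * (s⁻¹ * x ip), s⁻¹ * (s * x im)] fun i => x (iv i) : Pt) = x := by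
    funext A
    rcases A with k | i
    · fin_cases k
      · simp [hs]
      · simp [hs]
    · rfl
  have e' : (Sum.elim ![s⁻¹⁻¹ * (Sum.elim ![s⁻¹ * x ip, s * x im] fun i => x (iv i) : Pt) ip,
      s⁻¹ * (Sum.elim ![s⁻¹ * x ip, s * x im] fun i => x (iv i) : Pt) im]
      fun i => (Sum.elim ![s⁻¹ * x ip, s * x im] fun i => x (iv i) : Pt) (iv i) : Pt) = x := e
  refine Ix_ext ?_ ?_ fun k => ?_
  · change (s : ℂ) * (((s⁻¹ : ℝ) : ℂ) * X _ ip) = _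
    rw [e']; push_cast; field_simp
  · change (s : ℂ)⁻¹ * (((s⁻¹ : ℝ) : ℂ)⁻¹ * X _ im) = _
    rw [e']; push_cast; field_simp
  · change X _ (iv k) = _
    rw [e']

/-- The even part of the isomorphism between the superalgebras of `(α, β)` and `t(α, β)`. -/
def rescaleEquiv {t : ℝ} (ht : t ≠ 0) (α β : ℂ) :
    killingAlg α β ≃ₗ[ℂ] killingAlg (t * α) (t * β) where
  toFun X := ⟨rescale t X, rescale_mem ht X.2⟩
  map_add' X Y := Subtype.ext (map_add (rescale t) (X : VField) Y)
  map_smul' z X := Subtype.ext (map_smul (rescale t) z (X : VField))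
  invFun X := ⟨rescale t⁻¹ X, by
    have h := rescale_mem (inv_ne_zero ht) X.2
    have ht' : (t : ℂ) ≠ 0 := by exact_mod_cast ht
    rw [Complex.ofReal_inv, inv_mul_cancel_left₀ ht', inv_mul_cancel_left₀ ht'] at h
    exact h⟩
  left_inv X := Subtype.ext (rescale_rescale (inv_mul_cancel₀ ht) _)
  right_inv X := Subtype.ext (rescale_rescale (mul_inv_cancel₀ ht) _)

/-- Comparing parameters of closed forms avoids the naturality of the Lie bracket under
diffeomorphisms. -/
theorem rescale_lieBr {t : ℝ} (ht : t ≠ 0) {α β : ℂ} {X Y : VField} (hX : X ∈ killingAlg α β)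
    (hY : Y ∈ killingAlg α β) : rescale t (lieBr X Y) = lieBr (rescale t X) (rescale t Y) := by
  have ht' : (t : ℂ) ≠ 0 := by exact_mod_cast ht
  obtain ⟨a, b, p, q, w, hw, rfl⟩ := mem_killingAlg_iff.1 hX
  obtain ⟨a', b', p', q', w', hw', rfl⟩ := mem_killingAlg_iff.1 hY
  rw [lieBr_killField a b p q a' b' p' q' (lam_congr α β) hw hw', rescale_killField ht,
    rescale_killField ht, rescale_killField ht,
    lieBr_killField _ _ _ _ _ _ _ _ (lam_congr _ _) hw hw']
  congr 1
  · simp only [lam_mul]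
    rw [mul_neg, Finset.mul_sum]
    congr 1
    refine Finset.sum_congr rfl fun i _ => ?_
    field_simp
  · simp
  · funext i
    simp only [lam_mul]
    congr 1
    field_simp
  · funext i
    rw [mul_add, Finset.mul_sum]
    congr 1
    · ring
    · exact Finset.sum_congr rfl fun j _ => by ring

variable {S : Type*} [NormedAddCommGroup S] [NormedSpace ℂ S] {Γ : Ix → S →L[ℂ] S}
  {C : S →ₗ[ℂ] S →ₗ[ℂ] ℂ} {α β : ℂ}

/-- The isomorphism between the superalgebras of `(α, β)` and `a²(α, β)` on spinors at the
origin. -/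
def opT (Γ : Ix → S →L[ℂ] S) (a : ℂ) : S →L[ℂ] S := a • sigmaM Γ + a⁻¹ • sigmaP Γ

theorem opT_mul_inv (hΓ : IsClifford Γ) {a : ℂ} (ha : a ≠ 0) : opT Γ a * opT Γ a⁻¹ = 1 := by
  rw [← sigmaM_add_sigmaP hΓ]
  simp only [opT, mul_add, add_mul, smul_mul_assoc, mul_smul_comm, clifford_sort hΓ, smul_zero,
    smul_smul, inv_inv, add_zero, zero_add, inv_mul_cancel₀ ha, mul_inv_cancel₀ ha, one_smul]

/-- The map weights S₋ by a and S₊ by a⁻¹. N preserves both summands, and its coefficients scale by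
t. P and Z map S₊ to S₋ and pick up a² = t; for P this is absorbed by λ, and for Z it matches λ² q ↦
t λ² q. -/
theorem opT_mul_opGen (hΓ : IsClifford Γ) {a t : ℂ} (ht : t ≠ 0) (hat : a ^ 2 = t) (b : ℂ)
    (p q : Fin 9 → ℂ) (w : Fin 9 → Fin 9 → ℂ) :
    opT Γ a * opGen Γ α β b p (fun i => lam α β i ^ 2 * q i) w
      = opGen Γ (t * α) (t * β) (t⁻¹ * b) p
        (fun i => lam (t * α) (t * β) i ^ 2 * (t⁻¹ * q i)) w * opT Γ a := by
  have ha : a ≠ 0 := by rintro rfl; exact ht (by simpa using hat.symm)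
  have hN : opT Γ a * opN Γ α β = t⁻¹ • (opN Γ (t * α) (t * β) * opT Γ a) := by
    simp only [opT, opN, mul_add, add_mul, mul_neg, neg_mul, smul_mul_assoc, mul_smul_comm,
      mul_assoc, clifford_sort hΓ, clifford_sort_assoc hΓ]
    match_scalars <;> field_simp
    rw [hat]; ring
  have hP : ∀ i, opT Γ a * opP Γ α β i = opP Γ (t * α) (t * β) i * opT Γ a := by
    intro i
    simp only [opT, opP, lam_mul, mul_add, add_mul, smul_mul_assoc, mul_smul_comm,
      mul_assoc, clifford_sort hΓ, clifford_sort_assoc hΓ, mul_zero, smul_zero, add_zero, zero_add]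
    match_scalars
    field_simp
    linear_combination -lam α β i * hat
  have hZ : ∀ i, opT Γ a * opZ Γ i = t • (opZ Γ i * opT Γ a) := by
    intro i
    simp only [opT, opZ, mul_add, add_mul, smul_mul_assoc, mul_smul_comm,
      mul_assoc, clifford_sort hΓ, clifford_sort_assoc hΓ, mul_zero, smul_zero, add_zero, zero_add]
    match_scalars
    field_simp
    linear_combination -hat
  have hR : opT Γ a * opR Γ w = opR Γ w * opT Γ a :=
    (((opR_commute_sigmaM hΓ).smul_right a).add_right
      ((opR_commute_sigmaP hΓ).smul_right a⁻¹)).eq.symm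
  simp only [opGen, mul_add, add_mul, mul_sub, sub_mul, Finset.mul_sum, Finset.sum_mul,
    smul_mul_assoc, mul_smul_comm, hN, hP, hZ, hR, smul_smul, lam_mul]
  congr 2
  · congr 2
    rw [mul_comm]
  · refine Finset.sum_congr rfl fun i _ => ?_
    congr 1
    field_simp

set_option linter.unusedSimpArgs false in
-- By the adjunction, conjugation multiplies a form pairing S₋ with itself by a² = t, one pairing S₊
-- with itself by t⁻¹, and mixed ones by 1. Combined with the scaling of λ, these are the weights in
-- `rescale_killField`.
theorem brKill_opT (hC : IsChargeConj Γ C) (hΓ : IsClifford Γ) {a : ℂ} {t : ℝ} (ht : t ≠ 0)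
    (hat : a ^ 2 = t) (s u : S) :
    rescale t (brKill Γ C α β s u) = brKill Γ C (t * α) (t * β) (opT Γ a s) (opT Γ a u) := by
  have ht' : (t : ℂ) ≠ 0 := by exact_mod_cast ht
  have ha : a ≠ 0 := by rintro rfl; exact ht' (by simpa using hat.symm)
  have hT : ∀ {X Y : S →L[ℂ] S} {z : ℂ}, (a • sigmaP Γ + a⁻¹ • sigmaM Γ) * X * opT Γ a = z • Y →
      C (opT Γ a s) (X (opT Γ a u)) = z * C s (Y u) := by
    intro X Y z h
    have h1 := (((isAdj_sigmaM hC).smul a).add ((isAdj_sigmaP hC).smul a⁻¹)) s (X (opT Γ a u))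
    have h2 := congrArg (fun T : S →L[ℂ] S => C s (T u)) h
    simp only [mul_apply_eq_comp, smul_apply, map_smul, smul_eq_mul] at h2
    rw [← h2]
    exact h1
  rw [brKill, rescale_killField ht, brKill]
  congr 1
  · rw [hT (z := t) (Y := Γ im)]
    simp only [opT, mul_add, add_mul, smul_mul_assoc, mul_smul_comm,
      mul_assoc, clifford_sort hΓ, clifford_sort_assoc hΓ, mul_zero, smul_zero, add_zero, zero_add, sub_zero, zero_sub]
    match_scalars
    linear_combination hat
  · rw [hT (z := (t : ℂ)⁻¹) (Y := Γ ip)]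
    simp only [opT, mul_add, add_mul, smul_mul_assoc, mul_smul_comm,
      mul_assoc, clifford_sort hΓ, clifford_sort_assoc hΓ, mul_zero, smul_zero, add_zero, zero_add, sub_zero, zero_sub]
    match_scalars
    field_simp
    linear_combination -hat
  · funext i
    rw [hT (z := 1) (Y := brP Γ i), one_mul]
    simp only [opT, brP, mul_add, add_mul, mul_sub, sub_mul, smul_mul_assoc, mul_smul_comm,
      mul_assoc, clifford_sort hΓ, clifford_sort_assoc hΓ, mul_zero, smul_zero, add_zero, zero_add, sub_zero, zero_sub]
    match_scalars <;> field_simp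
  · funext i
    rw [hT (z := (t : ℂ)⁻¹) (Y := brQ Γ α β i)]
    simp only [opT, brQ, lam_mul, mul_add, add_mul, smul_mul_assoc, mul_smul_comm, smul_add,
      mul_assoc, clifford_sort hΓ, clifford_sort_assoc hΓ, mul_zero, smul_zero, add_zero, zero_add, sub_zero, zero_sub]
    match_scalars <;> field_simp
  · funext i k
    rw [hT (z := 1) (Y := brW Γ α β i k), one_mul]
    simp only [opT, brW, lam_mul, mul_add, add_mul, mul_sub, sub_mul, smul_mul_assoc,
      mul_smul_comm, smul_sub, mul_assoc, clifford_sort hΓ, clifford_sort_assoc hΓ, mul_zero, smul_zero, add_zero, zero_add, sub_zero, zero_sub]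
    match_scalars
    · field_simp
      linear_combination -lam α β k * sgn k * hat
    · field_simp
      linear_combination lam α β k * sgn i * hat

/-- `opT` as an equivalence. -/
def opTEquiv (hΓ : IsClifford Γ) {a : ℂ} (ha : a ≠ 0) : S ≃ₗ[ℂ] S where
  toFun s := opT Γ a s
  map_add' := map_add _
  map_smul' := map_smul _
  invFun s := opT Γ a⁻¹ s
  left_inv s := by
    have h := opT_mul_inv hΓ (inv_ne_zero ha)
    rw [inv_inv] at h
    exact congrArg (fun T : S →L[ℂ] S => T s) h
  right_inv s := congrArg (fun T : S →L[ℂ] S => T s) (opT_mul_inv hΓ ha)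

theorem superalgebra_iso [FiniteDimensional ℂ S] (hC : IsChargeConj Γ C) (hΓ : IsClifford Γ)
    {t : ℝ} (h : Admissible α β) (h' : Admissible (t * α) (t * β)) :
    (superalgebra hC hΓ h).Iso (superalgebra hC hΓ h') := by
  have ht : t ≠ 0 := by
    rintro rfl
    exact h'.2.2.1 (by simp)
  have ht' : (t : ℂ) ≠ 0 := by exact_mod_cast ht
  -- A complex square root, so that negative t is covered as well.
  obtain ⟨a, hat⟩ : ∃ a : ℂ, a ^ 2 = t := IsAlgClosed.exists_pow_nat_eq _ two_pos
  have ha : a ≠ 0 := by rintro rfl; exact ht' (by simpa using hat.symm)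
  let e₁ : parallel (famD Γ α β) ≃ₗ[ℂ] parallel (famD Γ (t * α) (t * β)) :=
    (evalEquiv hΓ h).trans ((opTEquiv hΓ ha).trans (evalEquiv hΓ h').symm)
  have he : ∀ ξ : parallel (famD Γ α β), (e₁ ξ : Field S) 0 = opT Γ a ((ξ : Field S) 0) := by
    intro ξ
    rw [← evalEquiv_apply hΓ h']
    exact (evalEquiv hΓ h').apply_symm_apply _
  have hL : ∀ (X : killingAlg α β) (ξ : parallel (famD Γ α β)), e₁ (lieAction hΓ h X ξ)
      = lieAction hΓ h' (rescaleEquiv ht α β X) (e₁ ξ) := by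
    intro X ξ
    obtain ⟨c, b, p, q, w, hw, e⟩ := mem_killingAlg_iff.1 X.2
    have e' : (rescaleEquiv ht α β X : VField) = killField (lam (t * α) (t * β)) (t * c)
        ((t : ℂ)⁻¹ * b) p (fun i => (t : ℂ)⁻¹ * q i) w := by
      rw [← rescale_killField ht, ← e]; rfl
    refine parallel_ext hΓ h' ?_
    rw [he, lieAction_apply_zero hΓ h e, lieAction_apply_zero hΓ h' e', he]
    exact congrArg (fun T : S →L[ℂ] S => T ((ξ : Field S) 0)) (opT_mul_opGen hΓ ht' hat b p q w)
  have hB : ∀ ξ η : parallel (famD Γ α β), rescaleEquiv ht α β (oddBracket hC hΓ α β ξ η)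
      = oddBracket hC hΓ (t * α) (t * β) (e₁ ξ) (e₁ η) := by
    intro ξ η
    refine Subtype.ext ?_
    change rescale t (brKill Γ C α β ((ξ : Field S) 0) ((η : Field S) 0))
      = brKill Γ C (t * α) (t * β) ((e₁ ξ : Field S) 0) ((e₁ η : Field S) 0)
    rw [he, he]
    exact brKill_opT hC hΓ ht hat _ _
  exact ⟨rescaleEquiv ht α β, e₁, fun X Y => rescale_lieBr ht X.2 Y.2, hL, hB⟩

end Rescale

/-! ### Classification of the Killing fields -/

section Classification

variable {b : Fin 9 → ℝ} {X : VField}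

/-- A Killing field of a non-degenerate diagonal Cahen–Wallach metric has constant `∂₋`-component,
and its other components satisfy a simplified system of equations. -/
theorem killing_system (hb : ∀ i, b i ≠ 0) (hX : IsKilling (Matrix.diagonal b) X) :
    (∀ A x, pd A (fun y => X y im) x = 0) ∧
    (∀ i x, pd ip (fun y => X y (iv i)) x = 0) ∧
    (∀ i j A x, pd A (pd (iv j) fun y => X y (iv i)) x = 0) ∧
    (∀ i j x, pd (iv i) (fun y => X y (iv j)) x = -pd (iv j) (fun y => X y (iv i)) x) ∧
    (∀ i j x, b i * pd (iv j) (fun y => X y (iv i)) x = b j * pd (iv j) (fun y => X y (iv i)) x) ∧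
    (∀ i x, pd im (pd im fun y => X y (iv i)) x
      = -(b i * X x (iv i)) - ∑ j, b j * x (iv j) * pd (iv i) (fun y => X y (iv j)) x) ∧
    (∀ x, pd ip (fun y => X y ip) x = 0) ∧
    (∀ x, pd im (fun y => X y ip) x = ∑ i, b i * x (iv i) * X x (iv i)) ∧
    (∀ i x, pd (iv i) (fun y => X y ip) x = -pd im (fun y => X y (iv i)) x) := by
  rw [isKilling_diagonal_iff] at hX
  obtain ⟨hs, hX⟩ := hX
  have hs' := contDiff_pi.1 hs
  set F : Pt → ℂ := fun y => X y ip with hF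
  set M : Pt → ℂ := fun y => X y im with hM
  set V : Fin 9 → Pt → ℂ := fun i y => X y (iv i) with hV
  set H : Pt → ℂ := fun y => (quad (Matrix.diagonal b) y : ℂ) with hH
  have sF : ContDiff ℝ ∞ F := hs' ip
  have sM : ContDiff ℝ ∞ M := hs' im
  have sV : ∀ i, ContDiff ℝ ∞ (V i) := fun i => hs' (iv i)
  have sH : ContDiff ℝ ∞ H := Complex.ofRealCLM.contDiff.comp (contDiff_quad b)
  have d : ∀ {f : Pt → ℂ}, ContDiff ℝ ∞ f → ∀ x, DifferentiableAt ℝ f x :=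
    fun h x => differentiable_of_smooth h x
  have dd : ∀ {f : Pt → ℂ}, ContDiff ℝ ∞ f → ∀ A x, DifferentiableAt ℝ (pd A f) x :=
    fun h A x => differentiable_of_smooth (contDiff_pd h A) x
  have pH : ∀ A x, pd A H x = Sum.elim (fun _ => 0) (fun i => 2 * (b i : ℂ) * x (iv i)) A := by
    intro A x
    rw [hH, pd_ofReal (differentiable_of_smooth (contDiff_quad b) x), pd_quad]
    rcases A with k | i <;> simp
  have pdz : ∀ {f : Pt → ℂ}, (∀ x, f x = 0) → ∀ A x, pd A f x = 0 := by
    intro f hf A x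
    rw [show f = fun _ => 0 from funext hf, pd_const]
  have e1 : ∀ x, pd ip M x = 0 := fun x => (hX x).1
  have e2 : pd ip F = fun y => -pd im M y := funext fun x => eq_neg_of_add_eq_zero_left (hX x).2.1
  have e3 : ∀ i, pd ip (V i) = fun y => -pd (iv i) M y := fun i => funext fun x =>
    eq_neg_of_add_eq_zero_left ((hX x).2.2.1 i)
  have e4 : pd im F = fun y => H y * pd im M y + ∑ i, b i * y (iv i) * V i y :=
    funext fun x => by linear_combination (hX x).2.2.2.1
  have e5 : ∀ i, pd (iv i) F = fun y => H y * pd (iv i) M y - pd im (V i) y := fun i =>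
    funext fun x => by linear_combination (hX x).2.2.2.2.1 i
  have e6 : ∀ i j, pd (iv i) (V j) = fun y => -pd (iv j) (V i) y := fun i j =>
    funext fun x => eq_neg_of_add_eq_zero_left ((hX x).2.2.2.2.2 i j)
  have dS : ∀ x, DifferentiableAt ℝ (fun y : Pt => ∑ i, (b i : ℂ) * y (iv i) * V i y) x :=
    fun x => DifferentiableAt.fun_sum fun i _ => ((by fun_prop : DifferentiableAt ℝ
      (fun y : Pt => (b i : ℂ) * y (iv i)) x)).fun_mul (d (sV i) x)
  have pS : ∀ A x, pd A (fun y => ∑ i, (b i : ℂ) * y (iv i) * V i y) x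
      = ∑ i, (b i : ℂ) * x (iv i) * pd A (V i) x + ∑ i, if A = iv i then b i * V i x else 0 := by
    intro A x
    rw [pd_sum _ _ fun i _ => ((by fun_prop : DifferentiableAt ℝ
      (fun y : Pt => (b i : ℂ) * y (iv i)) x)).fun_mul (d (sV i) x), ← Finset.sum_add_distrib]
    refine Finset.sum_congr rfl fun i _ => ?_
    rw [pd_mul A (by fun_prop) (d (sV i) x), pd_const_mul A _ (by fun_prop), pd_coord_complex]
    split_ifs <;> ring
  -- the component `X⁻`
  have f1 : ∀ i j x, pd (iv i) (pd (iv j) M) x = 0 := by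
    intro i j x
    have h1 : ∀ i j, pd (iv i) (pd (iv j) M) x = -pd ip (pd (iv i) (V j)) x := fun i j => by
      rw [pd_comm (sV j), e3, pd_neg, neg_neg]
    have h2 := h1 i j
    have h3 := h1 j i
    rw [e6, pd_neg] at h2
    rw [pd_comm sM] at h3
    linear_combination (1 / 2 : ℂ) * (h2 + h3)
  -- Here ∂₊∂_i X⁺ is computed in two ways; `f3` does the same with ∂₊∂₋ X⁺.
  have f2 : ∀ i x, pd im (pd (iv i) M) x = 0 := by
    intro i x
    have h1 : pd ip (pd (iv i) F) x = -pd (iv i) (pd im M) x := by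
      rw [pd_comm sF, e2, pd_neg]
    have h2 : pd ip (pd (iv i) M) x = 0 := by rw [pd_comm sM]; exact pdz e1 _ _
    have h3 : pd ip (pd im (V i)) x = -pd im (pd (iv i) M) x := by
      rw [pd_comm (sV i), e3, pd_neg]
    rw [e5, pd_sub _ ((d sH x).fun_mul (dd sM _ x)) (dd (sV i) _ x), pd_mul _ (d sH x) (dd sM _ x), h2,
      pH, h3, pd_comm sM (iv i)] at h1
    simp only [ip, Sum.elim_inl] at h1
    linear_combination (1 / 2 : ℂ) * h1
  have f3 : pd im (pd im M) = fun y => ∑ i, (b i : ℂ) * y (iv i) * pd (iv i) M y := by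
    funext x
    have h1 : pd ip (pd im F) x = -pd im (pd im M) x := by rw [pd_comm sF, e2, pd_neg]
    have h2 : pd ip (pd im M) x = 0 := by rw [pd_comm sM]; exact pdz e1 _ _
    rw [e4, pd_add _ ((d sH x).fun_mul (dd sM _ x)) (dS x), pd_mul _ (d sH x) (dd sM _ x), h2, pH, pS] at h1
    simp only [e3] at h1
    simp [ip, iv] at h1
    exact h1.symm
  -- Differentiating `f3` in the direction ∂_k kills the left side by `f2` and leaves b_k ∂_k X⁻ on
  -- the right by `f1`; non-degeneracy finishes.
  have f4 : ∀ i x, pd (iv i) M x = 0 := by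
    intro k x
    have h1 : pd (iv k) (pd im (pd im M)) x = 0 := by
      rw [pd_comm (contDiff_pd sM im)]
      exact pdz (fun y => by rw [pd_comm sM]; exact f2 k y) _ _
    rw [f3, pd_sum _ _ fun i _ => ((by fun_prop : DifferentiableAt ℝ
      (fun y : Pt => (b i : ℂ) * y (iv i)) x)).fun_mul (dd sM (iv i) x)] at h1
    rw [Finset.sum_congr rfl fun i _ => by
      rw [pd_mul (iv k) (by fun_prop) (dd sM (iv i) x), pd_const_mul _ _ (by fun_prop),
        pd_coord_complex, f1]] at h1
    simp [iv] at h1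
    exact h1.resolve_left (hb k)
  have f5 : ∀ i x, pd ip (V i) x = 0 := fun i x => by simp only [e3, f4, neg_zero]
  have e5' : ∀ i, pd (iv i) F = fun y => -pd im (V i) y := fun i => by
    rw [e5]; funext y; rw [f4]; ring
  -- the components `X^i`
  have g1 : ∀ i j k x, pd (iv k) (pd (iv j) (V i)) x = 0 := by
    intro i j k x
    have a : ∀ i j k, pd (iv k) (pd (iv j) (V i)) x = -pd (iv k) (pd (iv i) (V j)) x := by
      intro i j k; rw [e6, pd_neg]
    -- As for Killing fields of flat space: alternating three skew exchanges with three exchanges of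
    -- derivatives returns the same expression with the opposite sign.
    linear_combination (1 / 2 : ℂ) * (a i j k - pd_comm (sV j) (iv k) (iv i) x - a j k i
      + pd_comm (sV k) (iv i) (iv j) x + a k i j - pd_comm (sV i) (iv j) (iv k) x)
  -- This is symmetric in i, j as a second derivative of X⁺ and skew by the Killing equation.
  have g2 : ∀ i j x, pd im (pd (iv j) (V i)) x = 0 := by
    intro i j x
    have h1 : ∀ i j, pd (iv j) (pd (iv i) F) x = -pd im (pd (iv j) (V i)) x := by
      intro i j; rw [e5', pd_neg, pd_comm (sV i)]
    have h2 := h1 i j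
    have h3 := h1 j i
    rw [e6, pd_neg, pd_comm sF] at h3
    linear_combination (1 / 2 : ℂ) * (h2 - h3)
  have g3 : ∀ i j A x, pd A (pd (iv j) (V i)) x = 0 := by
    intro i j A x
    rcases A with k | k
    · obtain rfl | rfl : k = 0 ∨ k = 1 := by omega
      · have h := pd_comm (sV i) ip (iv j) x
        rw [pdz (f5 i)] at h
        exact h
      · exact g2 i j x
    · exact g1 i j k x
  have g4 : ∀ k, pd im (pd im (V k)) = fun y => -(2 * b k * y (iv k) * pd im M y)
      - (b k * V k y) - ∑ i, b i * y (iv i) * pd (iv k) (V i) y := by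
    intro k
    funext x
    have h1 : pd (iv k) (pd im F) x = -pd im (pd im (V k)) x := by
      rw [pd_comm sF, e5', pd_neg]
    have h2 : pd (iv k) (pd im M) x = 0 := by rw [pd_comm sM]; exact f2 k x
    rw [e4, pd_add _ ((d sH x).fun_mul (dd sM _ x)) (dS x), pd_mul _ (d sH x) (dd sM _ x), h2, pH, pS] at h1
    simp [iv] at h1
    simp only [iv]
    linear_combination h1
  -- One further transverse derivative of `g4`, whose left side vanishes by `g2`. Off the diagonal
  -- it says that the rotation commutes with B.
  have g5 : ∀ j k x, b k * pd (iv j) (V k) x + b j * pd (iv k) (V j) x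
      = if j = k then -(2 * b k * pd im M x) else 0 := by
    intro j k x
    have h1 : pd (iv j) (pd im (pd im (V k))) x = 0 := by
      rw [pd_comm (contDiff_pd (sV k) im)]
      exact pdz (fun y => by rw [pd_comm (sV k)]; exact g2 k j y) _ _
    have h2 : pd (iv j) (pd im M) x = 0 := by rw [pd_comm sM]; exact f2 j x
    have s1 : DifferentiableAt ℝ (fun y : Pt => -(2 * (b k : ℂ) * y (iv k) * pd im M y)) x := by
      have := dd sM im x
      fun_prop
    have s2 : DifferentiableAt ℝ (fun y : Pt => (b k : ℂ) * V k y) x := by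
      have := d (sV k) x
      fun_prop
    have s3 : ∀ i, DifferentiableAt ℝ (fun y : Pt => (b i : ℂ) * y (iv i) * pd (iv k) (V i) y) x := by
      intro i
      have := dd (sV i) (iv k) x
      fun_prop
    rw [g4, pd_sub _ (s1.fun_sub s2) (DifferentiableAt.fun_sum fun i _ => s3 i), pd_sub _ s1 s2,
      pd_neg, pd_mul _ (by fun_prop) (dd sM im x), h2, pd_const_mul _ _ (by fun_prop),
      pd_coord_complex, pd_const_mul _ _ (d (sV k) x), pd_sum _ _ fun i _ => s3 i] at h1
    rw [Finset.sum_congr rfl fun i _ => by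
      rw [pd_mul (iv j) (by fun_prop) (dd (sV i) (iv k) x), pd_const_mul _ _ (by fun_prop),
        pd_coord_complex, g1]] at h1
    simp [iv] at h1
    simp only [iv]
    split_ifs at h1 ⊢ <;> linear_combination -h1
  -- On the diagonal of `g5` the left side vanishes by skewness, which leaves b₀ ∂₋ X⁻ = 0; any
  -- index would do.
  have f6 : ∀ x, pd im M x = 0 := by
    intro x
    have h1 := g5 0 0 x
    have h2 : pd (iv 0) (V 0) x = 0 := by
      have h3 := congrFun (e6 0 0) x
      exact self_eq_neg.1 h3
    have hb0 : (b 0 : ℂ) ≠ 0 := by exact_mod_cast hb 0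
    rw [h2, if_pos rfl] at h1
    have h4 : (b 0 : ℂ) * pd im M x = 0 := by linear_combination (1 / 2 : ℂ) * h1
    exact (mul_eq_zero.1 h4).resolve_left hb0
  refine ⟨fun A x => ?_, f5, g3, fun i j x => congrFun (e6 i j) x, fun i j x => ?_, fun i x => ?_,
    fun x => ?_, fun x => ?_, fun i x => congrFun (e5' i) x⟩
  · rcases A with k | i
    · obtain rfl | rfl : k = 0 ∨ k = 1 := by omega
      · exact e1 x
      · exact f6 x
    · exact f4 i x
  · have h := g5 j i x
    rw [congrFun (e6 i j) x] at h
    split_ifs at h with hij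
    · rw [hij]
    · linear_combination h
  · refine (congrFun (g4 i) x).trans ?_
    simp only [f6]; ring
  · refine (congrFun e2 x).trans ?_
    simp only [f6, neg_zero]
  · refine (congrFun e4 x).trans ?_
    simp only [f6]; ring

/-- After removal of the constant rotation, X^i depends on x⁻ only and satisfies v'' = -l_i² v. Its
two first integrals are p_i and, up to the factor -1/l_i, q_i. -/
theorem exists_eq_killField {l : Fin 9 → ℂ} (hb : ∀ i, b i ≠ 0) (hl : ∀ i, (b i : ℂ) = l i ^ 2)
    (hX : IsKilling (Matrix.diagonal b) X) : ∃ a c p q w, (∀ i j, w i j = -w j i) ∧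
      (∀ i j, (b i : ℂ) * w i j = b j * w i j) ∧ X = killField l a c p q w := by
  obtain ⟨hM, hV1, hV2, hV3, hV4, hV5, hF1, hF2, hF3⟩ := killing_system hb hX
  have hs := contDiff_pi.1 hX.1
  have hl0 : ∀ i, l i ≠ 0 := fun i h => hb i (by
    have e : (b i : ℂ) = 0 := by rw [hl, h]; simp
    exact_mod_cast e)
  have d : ∀ A x, DifferentiableAt ℝ (fun y => X y A) x :=
    fun A x => differentiable_of_smooth (hs A) x
  set w : Fin 9 → Fin 9 → ℂ := fun i j => pd (iv j) (fun y => X y (iv i)) 0 with hw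
  have hwx : ∀ i j x, pd (iv j) (fun y => X y (iv i)) x = w i j := fun i j x =>
    eq_of_pd_eq_zero (differentiable_of_smooth (contDiff_pd (hs (iv i)) (iv j)))
      (hV2 i j) x 0
  have hw1 : ∀ i j, w i j = -w j i := fun i j => hV3 j i 0
  have hw2 : ∀ i j, (b i : ℂ) * w i j = b j * w i j := fun i j => hV4 i j 0
  -- the part of `X^i` which depends on `x⁻` only
  set v : Fin 9 → Pt → ℂ := fun i y => X y (iv i) - ∑ j, w i j * y (iv j) with hv
  set u : Fin 9 → Pt → ℂ := fun i => pd im fun y => X y (iv i) with hu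
  have dv : ∀ i x, DifferentiableAt ℝ (v i) x := fun i x => by
    have := d (iv i) x
    simp only [hv]
    fun_prop
  have du : ∀ i x, DifferentiableAt ℝ (u i) x := fun i x =>
    differentiable_of_smooth (contDiff_pd (hs (iv i)) im) x
  have pv : ∀ i A x, pd A (v i) x = if A = im then u i x else 0 := by
    intro i A x
    rw [pd_sub A (d (iv i) x) (by fun_prop), pd_sum _ _ (by intros; fun_prop)]
    simp only [pd_const_mul A _ (differentiable_coord_complex _ x), pd_coord_complex]
    rcases A with k | j
    · obtain rfl | rfl : k = 0 ∨ k = 1 := by omega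
      · have h := hV1 i x
        simp only [ip, iv] at h
        simp [im, iv, h]
      · simp [hu, im, iv]
    · have h := hwx i j x
      simp only [iv] at h
      simp [im, iv, h]
  have pu : ∀ i A x, pd A (u i) x = if A = im then -(b i * v i x) else 0 := by
    intro i A x
    rcases A with k | j
    · obtain rfl | rfl : k = 0 ∨ k = 1 := by omega
      · have h : pd ip (u i) x = 0 := by
          rw [hu, pd_comm (hs (iv i)), show pd ip (fun y => X y (iv i)) = fun _ => 0 from
            funext (hV1 i), pd_const]
        simpa using h
      · have h := hV5 i x
        simp only [hwx] at h
        have e : ∑ j, (b j : ℂ) * x (iv j) * w j i = -(b i * ∑ j, w i j * x (iv j)) := by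
          rw [Finset.mul_sum, ← Finset.sum_neg_distrib]
          refine Finset.sum_congr rfl fun j _ => ?_
          rw [hw1 j i]
          linear_combination (x (iv j) : ℂ) * hw2 i j
        rw [e] at h
        simp only [if_true, hv]
        refine h.trans ?_
        ring
    · have h : pd (iv j) (u i) x = 0 := by
        rw [hu, pd_comm (hs (iv i))]
        exact hV2 i j im x
      simpa using h
  -- the constants of integration
  set f : Fin 9 → Pt → ℂ := fun i y => v i y * Complex.cos (l i * y im)
    - (l i)⁻¹ * (u i y * Complex.sin (l i * y im)) with hf
  set g : Fin 9 → Pt → ℂ := fun i y => v i y * Complex.sin (l i * y im)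
    + (l i)⁻¹ * (u i y * Complex.cos (l i * y im)) with hg
  have df : ∀ i, Differentiable ℝ (f i) := fun i x => by
    have := dv i x
    have := du i x
    simp only [hf]
    fun_prop
  have dg : ∀ i, Differentiable ℝ (g i) := fun i x => by
    have := dv i x
    have := du i x
    simp only [hg]
    fun_prop
  have pf : ∀ i A x, pd A (f i) x = 0 := by
    intro i A x
    have h1 := dv i x
    have h2 := du i x
    have h0 := hl0 i
    rw [pd_sub A (by fun_prop) (by fun_prop), pd_mul A h1 (by fun_prop),
      pd_const_mul A _ (by fun_prop), pd_mul A h2 (by fun_prop), pd_cos, pd_sin, pv, pu, hl]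
    split_ifs
    · field_simp
      ring
    · ring
  have pg : ∀ i A x, pd A (g i) x = 0 := by
    intro i A x
    have h1 := dv i x
    have h2 := du i x
    have h0 := hl0 i
    rw [pd_add A (by fun_prop) (by fun_prop), pd_mul A h1 (by fun_prop),
      pd_const_mul A _ (by fun_prop), pd_mul A h2 (by fun_prop), pd_cos, pd_sin, pv, pu, hl]
    split_ifs
    · field_simp
      ring
    · ring
  have hXv : ∀ i x, X x (iv i) = f i 0 * Complex.cos (l i * x im)
      - -(l i)⁻¹ * g i 0 * l i * Complex.sin (l i * x im) + ∑ j, w i j * x (iv j) := by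
    intro i x
    rw [eq_of_pd_eq_zero (df i) (pf i) 0 x, eq_of_pd_eq_zero (dg i) (pg i) 0 x]
    simp only [hf, hg, hv]
    have h0 := hl0 i
    have h1 := Complex.sin_sq_add_cos_sq (l i * x im)
    field_simp
    linear_combination (-(l i) * (X x (iv i) - ∑ j, w i j * x (iv j))) * h1
  -- The comparison field agrees with X in the transverse components. Since the derivatives of X⁺
  -- depend only on those, the two X⁺ components differ by a constant, which becomes the parameter
  -- a.
  set K := killField l 0 (-X 0 im) (fun i => f i 0) (fun i => -(l i)⁻¹ * g i 0) w with hK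
  have hKX : ∀ i, (fun y => K y (iv i)) = fun y => X y (iv i) := fun i => funext fun y => by
    rw [hK, killField_iv, hXv]
  obtain ⟨-, -, -, -, -, -, hG1, hG2, hG3⟩ := killing_system hb (X := K)
    (isKilling_killField 0 _ _ _ hl hw1 fun i j => by rw [← hl, ← hl]; exact hw2 i j)
  have dK : ∀ x, DifferentiableAt ℝ (fun y => K y ip) x := fun x =>
    differentiable_of_smooth (contDiff_pi.1 (contDiff_killField _ _ _ _ _ _) ip) x
  have hF : ∀ x, X x ip - K x ip = X 0 ip - K 0 ip := by
    intro x
    refine eq_of_pd_eq_zero (f := fun y => X y ip - K y ip) (fun y => (d ip y).fun_sub (dK y))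
      (fun A y => ?_) x 0
    rw [pd_sub A (d ip y) (dK y), sub_eq_zero]
    rcases A with k | j
    · obtain rfl | rfl : k = 0 ∨ k = 1 := by omega
      · exact (hF1 y).trans (hG1 y).symm
      · refine (hF2 y).trans (Eq.trans ?_ (hG2 y).symm)
        exact Finset.sum_congr rfl fun i _ => by rw [congrFun (hKX i) y]
    · refine (hF3 j y).trans (Eq.trans ?_ (hG3 j y).symm)
      rw [hKX]
  refine ⟨-(X 0 ip - K 0 ip), -X 0 im, fun i => f i 0, fun i => -(l i)⁻¹ * g i 0, w, hw1, hw2, ?_⟩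
  funext x
  refine Ix_ext ?_ ?_ fun i => ?_
  · have h1 : K x ip = _ := killField_ip _ _ _ _ _ _ x
    rw [killField_ip]
    linear_combination hF x + h1
  · rw [killField_im, neg_neg]
    exact eq_of_pd_eq_zero (fun x => d im x) hM x 0
  · rw [killField_iv, hXv]

/-- For `αβ ≠ 0` all Killing fields belong to `killingAlg`. -/
theorem mem_killingAlg_iff_isKilling {α β : ℂ} (h : Admissible α β) (hαβ : α * β ≠ 0) :
    X ∈ killingAlg α β ↔ IsKilling (famB α β) X := by
  refine ⟨isKilling_of_mem_killingAlg h, fun hX => ?_⟩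
  rw [famB_eq] at hX
  obtain ⟨a, c, p, q, w, hw1, hw2, rfl⟩ := exists_eq_killField (famDiag_ne_zero h)
    (famDiag_eq_lam_sq h) hX
  refine mem_killingAlg_iff.2 ⟨a, c, p, q, w, ⟨hw1, fun i j hij => ?_⟩, rfl⟩
  have h1 := hw2 i j
  rw [famDiag_eq_lam_sq h, famDiag_eq_lam_sq h, ← sub_eq_zero, ← sub_mul] at h1
  -- Across the blocks λ_i² - λ_j² = ±4αβ, so a mixed rotation coefficient would force αβ = 0.
  refine (mul_eq_zero.1 h1).resolve_left fun h2 => hαβ ?_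
  have hI := Complex.I_sq
  unfold lam at h2
  split_ifs at h2 with h3 h4 h4
  · exact absurd (iff_of_true h3 h4) hij
  · linear_combination (1 / 4 : ℂ) * h2 + α * β * hI
  · linear_combination -(1 / 4 : ℂ) * h2 + α * β * hI
  · exact absurd (iff_of_false h3 h4) hij

end Classification

/-! ### Isometries -/

section Isometries

theorem metric_form (B : Matrix (Fin 9) (Fin 9) ℝ) (x : Pt) (v w : Ix → ℝ) :
    v ⬝ᵥ (metric B x).mulVec w
      = v ip * w im + v im * w ip - quad B x * v im * w im + ∑ i, v (iv i) * w (iv i) := by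
  simp only [dotProduct, Matrix.mulVec, sum_Ix]
  simp [metric, Matrix.one_apply]
  ring

/-- In the application w is the preimage of ∂₊ under the differential of the isometry, and f, h, ψ,
K are differentials along Φ. The contraction isolates the coefficient of dh, which is twice a second
derivative of x⁻ ∘ Φ. -/
theorem koszul_contraction {w f h K : Ix → ℝ} {ψ : Fin 9 → Ix → ℝ} (hf : ∑ E, w E * f E = 0)
    (hh : ∑ E, w E * h E = 1) (hψ : ∀ k, ∑ E, w E * ψ k E = 0) (hK : ∑ E, w E * K E = 0)
    (c₁ c₂ c₃ c₄ : ℝ) (c₅ : Fin 9 → ℝ) :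
    ∑ E, w E * (c₁ * f E + c₂ * h E + c₃ * K E + c₄ * ∑ k, c₅ k * ψ k E) = c₂ := by
  have e : ∑ E, w E * ∑ k, c₅ k * ψ k E = 0 := by
    simp only [Finset.mul_sum]
    rw [Finset.sum_comm]
    refine Finset.sum_eq_zero fun k _ => ?_
    have := congrArg (c₅ k * ·) (hψ k)
    simp only [Finset.mul_sum, mul_zero] at this
    rw [← this]
    exact Finset.sum_congr rfl fun E _ => by ring
  calc _ = c₁ * ∑ E, w E * f E + c₂ * ∑ E, w E * h E + c₃ * ∑ E, w E * K E
        + c₄ * ∑ E, w E * ∑ k, c₅ k * ψ k E := by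
        rw [Finset.mul_sum, Finset.mul_sum, Finset.mul_sum, Finset.mul_sum (a := c₄),
          ← Finset.sum_add_distrib, ← Finset.sum_add_distrib, ← Finset.sum_add_distrib]
        exact Finset.sum_congr rfl fun E _ => by ring
    _ = c₂ := by rw [hf, hh, hK, e]; ring

variable {b b' : Fin 9 → ℝ} {Φ : Pt → Pt}

/-- The first order system satisfied by the components `h, f, ψ` of an isometry, together with the
Hessian of `f`, forces the transverse components to be an affine orthogonal map. -/
theorem exists_orthogonal_of_system (hb : ∀ i, b i ≠ 0) {f h : Pt → ℝ} {ψ : Fin 9 → Pt → ℝ}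
    (sh : ContDiff ℝ ∞ h) (sf : ContDiff ℝ ∞ f) (sψ : ∀ k, ContDiff ℝ ∞ (ψ k))
    (E : ∀ A C, (fun x => pd A h x * pd C f x + pd A f x * pd C h x
      - (∑ k, b' k * ψ k x ^ 2) * pd A f x * pd C f x + ∑ k, pd A (ψ k) x * pd C (ψ k) x)
      = fun x => metric (Matrix.diagonal b) x A C)
    (hess : ∀ A C x, 2 * pd A (pd C f) x = (if C = im then
        (Sum.elim (fun _ => 0) (fun i => -(2 * b i * x (iv i))) A) * pd ip f x else 0)
      + (if A = im then
        (Sum.elim (fun _ => 0) (fun i => -(2 * b i * x (iv i))) C) * pd ip f x else 0)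
      + (if A = im ∧ C = im then ∑ i, 2 * b i * x (iv i) * pd (iv i) f x else 0)) :
    ∃ s : ℝ, s ≠ 0 ∧ ∃ R : Matrix (Fin 9) (Fin 9) ℝ, R.transpose * R = 1 ∧
      s ^ 2 • (R.transpose * Matrix.diagonal b' * R) = Matrix.diagonal b := by
  have d : ∀ {F : Pt → ℝ}, ContDiff ℝ ∞ F → ∀ x, DifferentiableAt ℝ F x :=
    fun h x => differentiable_of_smooth h x
  have dd : ∀ {F : Pt → ℝ}, ContDiff ℝ ∞ F → ∀ A x, DifferentiableAt ℝ (pd A F) x :=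
    fun h A x => differentiable_of_smooth (contDiff_pd h A) x
  have const : ∀ {F : Pt → ℝ}, ContDiff ℝ ∞ F → (∀ A x, pd A F x = 0) → F = fun _ => F 0 :=
    fun h h' => funext fun x => eq_of_pd_eq_zero (differentiable_of_smooth h) h' x 0
  have swap : ∀ {F : Pt → ℝ}, ContDiff ℝ ∞ F → ∀ A C, pd A (pd C F) = pd C (pd A F) :=
    fun h A C => funext (pd_comm h A C)
  have pzero : ∀ A, pd A (fun _ : Pt => (0 : ℝ)) = fun _ => 0 :=
    fun A => funext fun x => pd_const A 0 x
  -- `f` depends on `x⁻` only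
  have f1 := const (contDiff_pd sf ip) fun A x => by
    have := hess A ip x
    rcases A with k | i
    · fin_cases k <;> simp [im, ip] at this <;> simpa using this
    · simpa [im, ip] using this
  -- By the Hessian, ∂_i∂₋f is -b_i x^i times the constant ∂₊f, while ∂_i∂_i f = 0. Commuting
  -- derivatives forces b_i ∂₊f = 0, here with the first index.
  have fp : pd ip f = fun _ => 0 := by
    have e1 : pd (iv 0) (pd im f) = fun x => -(b 0 * pd ip f 0) * x (iv 0) := by
      funext x
      have := hess (iv 0) im x
      rw [f1] at this
      simp [im, iv] at this
      simp only [im, iv]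
      linarith
    have e2 : pd (iv 0) (pd (iv 0) f) = fun _ => 0 := by
      funext x
      simpa [im, iv] using hess (iv 0) (iv 0) x
    have e3 : pd (iv 0) (pd (iv 0) (pd im f)) 0 = 0 := by
      rw [swap sf (iv 0) im, swap (contDiff_pd sf (iv 0)) (iv 0) im, e2, pzero]
    rw [e1, pd_const_mul _ _ (by fun_prop), pd_coord] at e3
    have : pd ip f 0 = 0 := by simpa [hb 0] using e3
    rw [f1, this]
  have f2 : ∀ i, pd (iv i) f = fun _ => pd (iv i) f 0 := fun i =>
    const (contDiff_pd sf (iv i)) fun A x => by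
      have := hess A (iv i) x
      rw [fp] at this
      simpa [im, iv] using this
  -- The same device: ∂₋∂₋f is a linear function of x with coefficients b_i ∂_i f, but its
  -- transverse derivatives vanish.
  have fi : ∀ i, pd (iv i) f = fun _ => 0 := by
    intro j
    have e1 : pd im (pd im f) = fun x => ∑ i, b i * pd (iv i) f 0 * x (iv i) := by
      funext x
      have := hess im im x
      rw [fp, Finset.sum_congr rfl fun i _ => by rw [f2 i]] at this
      simp only [mul_zero, ite_self, zero_add, and_self, if_true] at this
      have e : ∑ i, 2 * b i * x (iv i) * pd (iv i) f 0
          = 2 * ∑ i, b i * pd (iv i) f 0 * x (iv i) := by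
        rw [Finset.mul_sum]; exact Finset.sum_congr rfl fun i _ => by ring
      rw [e] at this
      linarith
    have e3 : pd (iv j) (pd im (pd im f)) 0 = 0 := by
      rw [swap (contDiff_pd sf im) (iv j) im, swap sf (iv j) im, f2 j]
      have : pd im (fun _ : Pt => pd (iv j) f 0) = fun _ => 0 := funext fun x => pd_const _ _ x
      rw [this, pzero]
    rw [e1, pd_sum _ _ fun i _ => by fun_prop, Finset.sum_congr rfl fun i _ => by
      rw [pd_const_mul _ _ (by fun_prop), pd_coord]] at e3
    have : pd (iv j) f 0 = 0 := by simpa [iv, hb j] using e3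
    rw [f2 j, this]
  have f3 := const (contDiff_pd sf im) fun A x => by
    have := hess A im x
    rw [fp, Finset.sum_congr rfl fun i _ => by rw [fi i]] at this
    simpa using this
  set s := pd im f 0 with hs
  -- the transverse components do not depend on `x⁺`
  have ψp : ∀ k, pd ip (ψ k) = fun _ => 0 := by
    intro k
    funext x
    have e := congrFun (E ip ip) x
    simp only [fp, mul_zero, zero_mul, sub_zero, zero_add] at e
    have e' : ∑ k, pd ip (ψ k) x * pd ip (ψ k) x = 0 := e.trans (by simp [metric])
    have := (Finset.sum_eq_zero_iff_of_nonneg fun k _ => mul_self_nonneg _).1 e' k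
      (Finset.mem_univ k)
    simpa using this
  -- Otherwise the +- component of the pulled back metric would be 0 instead of 1.
  have s0 : s ≠ 0 := by
    intro h0
    have e := congrFun (E ip im) 0
    simp only [fp, f3, h0, ψp] at e
    simp [metric] at e
  have ortho : ∀ i j, (fun x => ∑ k, pd (iv i) (ψ k) x * pd (iv j) (ψ k) x)
      = fun _ => (1 : Matrix (Fin 9) (Fin 9) ℝ) i j := by
    intro i j
    have e := E (iv i) (iv j)
    simp only [fi, mul_zero, zero_mul, sub_zero, zero_add] at e
    rw [e]
    funext x
    simp [metric]
  have dortho : ∀ D i j x, ∑ k, pd D (pd (iv i) (ψ k)) x * pd (iv j) (ψ k) x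
      + ∑ k, pd D (pd (iv j) (ψ k)) x * pd (iv i) (ψ k) x = 0 := by
    intro D i j x
    have e : pd D (fun x => ∑ k, pd (iv i) (ψ k) x * pd (iv j) (ψ k) x) x = 0 := by
      rw [ortho, pd_const]
    rw [pd_sum _ _ fun k _ => (dd (sψ k) _ x).fun_mul (dd (sψ k) _ x)] at e
    rw [← Finset.sum_add_distrib, ← e]
    refine Finset.sum_congr rfl fun k _ => ?_
    rw [pd_mul D (dd (sψ k) _ x) (dd (sψ k) _ x)]
    ring
  -- The transverse Jacobian is an orthogonal square matrix, so its rows can be cancelled.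
  have cancel : ∀ (x : Pt) (v : Fin 9 → ℝ), (∀ j, ∑ k, v k * pd (iv j) (ψ k) x = 0) →
      ∀ k, v k = 0 := by
    intro x v hv k
    have h1 : (Matrix.of fun k j => pd (iv j) (ψ k) x).transpose
        * (Matrix.of fun k j => pd (iv j) (ψ k) x) = 1 := by
      ext i j
      exact congrFun (ortho i j) x
    have h2 : Matrix.vecMul v (Matrix.of fun k j => pd (iv j) (ψ k) x) = 0 := funext hv
    have h3 := congrArg (fun u => Matrix.vecMul u
      (Matrix.of fun k j => pd (iv j) (ψ k) x).transpose) h2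
    simp only [Matrix.vecMul_vecMul, Matrix.zero_vecMul] at h3
    rw [mul_eq_one_comm.1 h1, Matrix.vecMul_one] at h3
    exact congrFun h3 k
  -- Three permutations of the differentiated orthogonality relation, as in the uniqueness of the
  -- Levi-Civita connection.
  have ψij : ∀ k i j, pd (iv i) (pd (iv j) (ψ k)) = fun _ => 0 := by
    intro k i j
    funext x
    have hsw : ∀ l i j, ∑ k, pd (iv l) (pd (iv i) (ψ k)) x * pd (iv j) (ψ k) x
        = ∑ k, pd (iv i) (pd (iv l) (ψ k)) x * pd (iv j) (ψ k) x := fun l i j =>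
      Finset.sum_congr rfl fun k _ => by rw [swap (sψ k) (iv l) (iv i)]
    refine cancel x (fun k => pd (iv i) (pd (iv j) (ψ k)) x) (fun l => ?_) k
    linarith [dortho (iv i) j l x, dortho (iv j) l i x, dortho (iv l) i j x, hsw i j l,
      hsw j l i, hsw l i j]
  have mixed : ∀ i, (fun x => s * pd (iv i) h x + ∑ k, pd im (ψ k) x * pd (iv i) (ψ k) x)
      = fun _ => 0 := by
    intro i
    have e := E im (iv i)
    simp only [fi, mul_zero, sub_zero, zero_add] at e
    rw [f3] at e
    rw [e]
    funext x
    simp [metric, im, iv]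
  have dmixed : ∀ i j x, s * pd (iv j) (pd (iv i) h) x
      + ∑ k, pd im (pd (iv j) (ψ k)) x * pd (iv i) (ψ k) x = 0 := by
    intro i j x
    have e : pd (iv j) (fun x => s * pd (iv i) h x
        + ∑ k, pd im (ψ k) x * pd (iv i) (ψ k) x) x = 0 := by
      rw [mixed, pd_const]
    have hd : ∀ k, DifferentiableAt ℝ (fun x => pd im (ψ k) x * pd (iv i) (ψ k) x) x :=
      fun k => (dd (sψ k) _ x).fun_mul (dd (sψ k) _ x)
    rw [pd_add _ ((dd sh _ x).const_mul s) (DifferentiableAt.fun_sum fun k _ => hd k),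
      pd_sum _ _ fun k _ => hd k, pd_const_mul _ _ (dd sh _ x)] at e
    rw [← e]
    congr 1
    refine Finset.sum_congr rfl fun k _ => ?_
    rw [pd_mul _ (dd (sψ k) _ x) (dd (sψ k) _ x), ψij, swap (sψ k) (iv j) im]
    ring
  -- Paired with ∂_iψ, this is symmetric in i, j by the mixed equations, where it is a second
  -- derivative of h, and skew by the differentiated orthogonality.
  have ψm : ∀ k j, pd im (pd (iv j) (ψ k)) = fun _ => 0 := by
    intro k j
    funext x
    refine cancel x (fun k => pd im (pd (iv j) (ψ k)) x) (fun i => ?_) k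
    have e := congrFun (swap sh (iv j) (iv i)) x
    have h1 := dmixed i j x
    rw [e] at h1
    linarith [dmixed j i x, dortho im i j x]
  have hij : ∀ i j, pd (iv j) (pd (iv i) h) = fun _ => 0 := by
    intro i j
    funext x
    have := dmixed i j x
    simp only [ψm, zero_mul, Finset.sum_const_zero, add_zero] at this
    simpa [s0] using this
  have ψc : ∀ k i, pd (iv i) (ψ k) = fun _ => pd (iv i) (ψ k) 0 := fun k i =>
    const (contDiff_pd (sψ k) (iv i)) fun A x => by
      rcases A with l | j
      · fin_cases l
        · have := congrFun (swap (sψ k) ip (iv i)) x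
          rw [ψp, pzero] at this
          exact this
        · exact congrFun (ψm k i) x
      · exact congrFun (ψij k j i) x
  refine ⟨s, s0, Matrix.of fun k i => pd (iv i) (ψ k) 0, ?_, ?_⟩
  · ext i j
    exact congrFun (ortho i j) 0
  -- the second derivatives of the `--` component
  have mm : (fun x => 2 * s * pd im h x - s ^ 2 * (∑ k, b' k * ψ k x ^ 2)
      + ∑ k, pd im (ψ k) x * pd im (ψ k) x) = fun x => metric (Matrix.diagonal b) x im im := by
    rw [← E im im, f3]
    funext x
    ring
  have dmm : ∀ i, (fun x => 2 * s * pd im (pd (iv i) h) x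
      - 2 * s ^ 2 * ∑ k, b' k * pd (iv i) (ψ k) 0 * ψ k x) = fun x => -(2 * b i) * x (iv i) := by
    intro i
    funext x
    have e := pd_metric (b := b) (iv i) im im x
    rw [← mm] at e
    have h1 := dd sh im x
    have h2 := fun k => d (sψ k) x
    have h3 := fun k => dd (sψ k) im x
    have h4 : ∀ k, pd (iv i) (fun x => pd im (ψ k) x * pd im (ψ k) x) x = 0 := fun k => by
      rw [pd_mul _ (h3 k) (h3 k), swap (sψ k) (iv i) im, ψm]; simp
    have h5 : ∀ k, pd (iv i) (fun x => b' k * ψ k x ^ 2) x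
        = 2 * (b' k * pd (iv i) (ψ k) 0 * ψ k x) := fun k => by
      have := h2 k
      rw [pd_const_mul _ _ (by fun_prop)]
      simp only [sq]
      rw [pd_mul _ this this, ψc]
      ring
    have h6 : ∀ k, DifferentiableAt ℝ (fun x => b' k * ψ k x ^ 2) x := fun k => by
      have := h2 k
      fun_prop
    have h7 : DifferentiableAt ℝ (fun x => ∑ k, b' k * ψ k x ^ 2) x :=
      DifferentiableAt.fun_sum fun k _ => h6 k
    rw [pd_add _ (by fun_prop) (DifferentiableAt.fun_sum fun k _ => (h3 k).fun_mul (h3 k)),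
      pd_sub _ (by fun_prop) (by fun_prop), pd_sum _ _ fun k _ => (h3 k).fun_mul (h3 k),
      pd_const_mul _ _ h1, pd_const_mul _ _ h7, pd_sum _ _ fun k _ => h6 k,
      Finset.sum_congr rfl fun k _ => h4 k, Finset.sum_congr rfl fun k _ => h5 k,
      ← Finset.mul_sum, swap sh (iv i) im] at e
    simp [im, iv] at e
    simp only [im, iv]
    linarith
  ext i j
  have e : pd (iv j) (fun x => 2 * s * pd im (pd (iv i) h) x
      - 2 * s ^ 2 * ∑ k, b' k * pd (iv i) (ψ k) 0 * ψ k x) 0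
      = -(2 * b i) * (if j = i then 1 else 0) := by
    rw [dmm, pd_const_mul _ _ (by fun_prop), pd_coord]
    simp [iv]
  have h2 := fun k => d (sψ k) 0
  have h6 : ∀ k, DifferentiableAt ℝ (fun x => b' k * pd (iv i) (ψ k) 0 * ψ k x) 0 := fun k =>
    (h2 k).const_mul _
  have h7 : DifferentiableAt ℝ (fun x => ∑ k, b' k * pd (iv i) (ψ k) 0 * ψ k x) 0 :=
    DifferentiableAt.fun_sum fun k _ => h6 k
  have h8 := dd (contDiff_pd sh (iv i)) im 0
  rw [pd_sub _ (by fun_prop) (by fun_prop), pd_const_mul _ _ h8, pd_const_mul _ _ h7,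
    pd_sum _ _ fun k _ => h6 k, Finset.sum_congr rfl fun k _ => pd_const_mul _ _ (h2 k),
    swap (contDiff_pd sh (iv i)) (iv j) im, hij, pzero] at e
  rw [Matrix.smul_apply, Matrix.mul_apply, Matrix.diagonal_apply, smul_eq_mul]
  simp only [Matrix.mul_diagonal, Matrix.transpose_apply, Matrix.of_apply]
  have e2 : ∑ k, pd (iv i) (ψ k) 0 * b' k * pd (iv j) (ψ k) 0
      = ∑ k, b' k * pd (iv i) (ψ k) 0 * pd (iv j) (ψ k) 0 :=
    Finset.sum_congr rfl fun k _ => by ring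
  rw [e2]
  by_cases hji : j = i
  · subst hji
    simp at e ⊢
    linarith
  · rw [if_neg hji] at e
    rw [if_neg fun h => hji h.symm]
    linarith

/-- The metric in components. -/
theorem metric_diagonal_apply (x : Pt) (A C : Ix) : metric (Matrix.diagonal b) x A C =
    (Pi.single A 1 : Ix → ℝ) ⬝ᵥ (metric (Matrix.diagonal b) x).mulVec (Pi.single C 1) := by
  simp

/-- An isometry maps the parallel null direction to the parallel null direction, and it is affine
in the other coordinates. -/
theorem exists_orthogonal_of_isometry (hb : ∀ i, b i ≠ 0) (hΦ : ContDiff ℝ ∞ Φ)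
    (hsurj : ∀ x, ∃ w, fderiv ℝ Φ x w = Pi.single ip 1)
    (hiso : ∀ (x : Pt) (v w : Ix → ℝ),
      fderiv ℝ Φ x v ⬝ᵥ (metric (Matrix.diagonal b') (Φ x)).mulVec (fderiv ℝ Φ x w)
        = v ⬝ᵥ (metric (Matrix.diagonal b) x).mulVec w) :
    ∃ s : ℝ, s ≠ 0 ∧ ∃ R : Matrix (Fin 9) (Fin 9) ℝ, R.transpose * R = 1 ∧
      s ^ 2 • (R.transpose * Matrix.diagonal b' * R) = Matrix.diagonal b := by
  have hc := contDiff_pi.1 hΦ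
  have hcomp : ∀ x A C, fderiv ℝ Φ x (Pi.single A 1) C = pd A (fun y => Φ y C) x := by
    intro x A C
    have h := hasFDerivAt_pi'.1 (differentiable_of_smooth hΦ x).hasFDerivAt C
    have h2 : fderiv ℝ (fun y => Φ y C) x = _ := h.fderiv
    rw [pd, h2]; rfl
  set h : Pt → ℝ := fun y => Φ y ip with hh
  set f : Pt → ℝ := fun y => Φ y im with hf
  set ψ : Fin 9 → Pt → ℝ := fun k y => Φ y (iv k) with hψ
  set K : Pt → ℝ := fun y => quad (Matrix.diagonal b') (Φ y) with hK
  have sh : ContDiff ℝ ∞ h := hc ip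
  have sf : ContDiff ℝ ∞ f := hc im
  have sψ : ∀ k, ContDiff ℝ ∞ (ψ k) := fun k => hc (iv k)
  have sK : ContDiff ℝ ∞ K := (contDiff_quad b').comp hΦ
  have d : ∀ {F : Pt → ℝ}, ContDiff ℝ ∞ F → ∀ x, DifferentiableAt ℝ F x :=
    fun h x => differentiable_of_smooth h x
  have dd : ∀ {F : Pt → ℝ}, ContDiff ℝ ∞ F → ∀ A x, DifferentiableAt ℝ (pd A F) x :=
    fun h A x => differentiable_of_smooth (contDiff_pd h A) x
  have hKψ : K = fun y => ∑ k, b' k * ψ k y ^ 2 := funext fun y => quad_diagonal b' (Φ y)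
  have pK : ∀ A x, pd A K x = ∑ k, 2 * b' k * ψ k x * pd A (ψ k) x := by
    intro A x
    rw [hKψ, pd_sum _ _ fun k _ => by have := d (sψ k) x; fun_prop]
    refine Finset.sum_congr rfl fun k _ => ?_
    have := d (sψ k) x
    rw [pd_const_mul A _ (by fun_prop)]
    simp only [sq]
    rw [pd_mul A this this]
    ring
  -- the components of the pulled back metric
  have E : ∀ A C, (fun x => pd A h x * pd C f x + pd A f x * pd C h x
      - K x * pd A f x * pd C f x + ∑ k, pd A (ψ k) x * pd C (ψ k) x)
      = fun x => metric (Matrix.diagonal b) x A C := by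
    intro A C
    funext x
    rw [metric_diagonal_apply, ← hiso, metric_form]
    simp only [hcomp]
    rfl
  have dE : ∀ A C D x, pd D (pd A h) x * pd C f x + pd A h x * pd D (pd C f) x
      + pd D (pd A f) x * pd C h x + pd A f x * pd D (pd C h) x
      - pd D K x * pd A f x * pd C f x - K x * pd D (pd A f) x * pd C f x
      - K x * pd A f x * pd D (pd C f) x + ∑ k, (pd D (pd A (ψ k)) x * pd C (ψ k) x
        + pd A (ψ k) x * pd D (pd C (ψ k)) x)
      = pd D (fun y => metric (Matrix.diagonal b) y A C) x := by
    intro A C D x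
    rw [← E A C]
    have h1 := dd sh A x
    have h2 := dd sh C x
    have h3 := dd sf A x
    have h4 := dd sf C x
    have h5 := d sK x
    have h6 := fun k => dd (sψ k) A x
    have h7 := fun k => dd (sψ k) C x
    rw [pd_add D (by fun_prop) (by fun_prop), pd_sub D (by fun_prop) (by fun_prop),
      pd_add D (by fun_prop) (by fun_prop), pd_mul D h1 h4, pd_mul D h3 h2,
      pd_mul D (by fun_prop) h4, pd_mul D h5 h3,
      pd_sum _ _ fun k _ => (h6 k).fun_mul (h7 k)]
    have e : ∀ k, pd D (fun y => pd A (ψ k) y * pd C (ψ k) y) x = pd D (pd A (ψ k)) x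
        * pd C (ψ k) x + pd A (ψ k) x * pd D (pd C (ψ k)) x := fun k => by
      rw [pd_mul D (h6 k) (h7 k)]; ring
    simp only [e]
    ring
  -- the differential of `x⁻ ∘ Φ` is parallel
  have hess : ∀ A C x, 2 * pd A (pd C f) x = (if C = im then
        (Sum.elim (fun _ => 0) (fun i => -(2 * b i * x (iv i))) A) * pd ip f x else 0)
      + (if A = im then
        (Sum.elim (fun _ => 0) (fun i => -(2 * b i * x (iv i))) C) * pd ip f x else 0)
      + (if A = im ∧ C = im then ∑ i, 2 * b i * x (iv i) * pd (iv i) f x else 0) := by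
    intro A C x
    -- The isometry maps w to the parallel null vector ∂₊, so w is the gradient of f, as `wg`
    -- records.
    obtain ⟨w, hw⟩ := hsurj x
    have hwC : ∀ C, ∑ D, w D * pd D (fun y => Φ y C) x = (Pi.single ip 1 : Ix → ℝ) C := by
      intro C
      rw [← hw, fderiv_eq_sum_pd, Finset.sum_apply]
      refine Finset.sum_congr rfl fun D _ => ?_
      rw [← hcomp]; rfl
    have wf : ∑ D, w D * pd D f x = 0 := (hwC im).trans (by simp)
    have wh : ∑ D, w D * pd D h x = 1 := (hwC ip).trans (by simp)
    have wψ : ∀ k, ∑ D, w D * pd D (ψ k) x = 0 := fun k => (hwC (iv k)).trans (by simp)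
    have wK : ∑ D, w D * pd D K x = 0 := by
      simp only [pK, Finset.mul_sum]
      rw [Finset.sum_comm]
      refine Finset.sum_eq_zero fun k _ => ?_
      have := congrArg (2 * b' k * ψ k x * ·) (wψ k)
      simp only [Finset.mul_sum, mul_zero] at this
      rw [← this]
      exact Finset.sum_congr rfl fun D _ => by ring
    have wg : ∀ A, pd A f x = (Pi.single A 1 : Ix → ℝ) ⬝ᵥ
        (metric (Matrix.diagonal b) x).mulVec w := by
      intro A
      rw [← hiso, hw, metric_form]
      simp only [ip, im, iv, hf, Pi.single_eq_same]
      simpa using (hcomp x A im).symm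
    have w1 : w im = pd ip f x := by
      rw [wg, metric_form]; simp [im, ip, iv]
    have w2 : ∀ i, w (iv i) = pd (iv i) f x := by
      intro i
      rw [wg, metric_form]; simp [im, ip, iv, Pi.single_apply]
    have key := koszul_contraction wf wh wψ wK
      (2 * pd A (pd C h) x - 2 * K x * pd A (pd C f) x - pd A K x * pd C f x
        - pd C K x * pd A f x) (2 * pd A (pd C f) x) (pd A f x * pd C f x) 2
      fun k => pd A (pd C (ψ k)) x
    rw [← key]
    -- The Koszul combination of derivatives of the pulled back metric. In it all second derivatives
    -- cancel except those in the directions A and C, so contraction with w gives 2 ∂_A∂_C f.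
    have term : ∀ D, (2 * pd A (pd C h) x - 2 * K x * pd A (pd C f) x - pd A K x * pd C f x
        - pd C K x * pd A f x) * pd D f x + 2 * pd A (pd C f) x * pd D h x
        + pd A f x * pd C f x * pd D K x + 2 * ∑ k, pd A (pd C (ψ k)) x * pd D (ψ k) x
        = pd A (fun y => metric (Matrix.diagonal b) y C D) x
          + pd C (fun y => metric (Matrix.diagonal b) y A D) x
          - pd D (fun y => metric (Matrix.diagonal b) y A C) x := by
      intro D
      rw [← dE, ← dE, ← dE]
      have e : 2 * ∑ k, pd A (pd C (ψ k)) x * pd D (ψ k) x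
          = ∑ k, (pd A (pd C (ψ k)) x * pd D (ψ k) x + pd C (ψ k) x * pd A (pd D (ψ k)) x)
          + ∑ k, (pd C (pd A (ψ k)) x * pd D (ψ k) x + pd A (ψ k) x * pd C (pd D (ψ k)) x)
          - ∑ k, (pd D (pd A (ψ k)) x * pd C (ψ k) x + pd A (ψ k) x * pd D (pd C (ψ k)) x) := by
        rw [Finset.mul_sum, ← Finset.sum_add_distrib, ← Finset.sum_sub_distrib]
        refine Finset.sum_congr rfl fun k _ => ?_
        rw [pd_comm (sψ k) A C, pd_comm (sψ k) D A, pd_comm (sψ k) D C]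
        ring
      rw [e, pd_comm sh A C, pd_comm sh D A, pd_comm sh D C, pd_comm sf A C, pd_comm sf D A,
        pd_comm sf D C]
      ring
    simp only [term, pd_metric]
    simp only [mul_sub, mul_add, Finset.sum_sub_distrib, Finset.sum_add_distrib]
    have s1 : ∀ (P : Prop) [Decidable P] (c : ℝ), (∑ D, w D * if P ∧ D = im then c else 0)
        = if P then c * pd ip f x else 0 := by
      intro P _ c
      by_cases hP : P
      · simp [hP, ← w1, mul_comm]
      · simp [hP]
    have s2 : (∑ D, w D * if A = im ∧ C = im then
        Sum.elim (fun _ => 0) (fun i => -(2 * b i * x (iv i))) D else 0)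
        = -(if A = im ∧ C = im then ∑ i, 2 * b i * x (iv i) * pd (iv i) f x else 0) := by
      split_ifs
      · rw [sum_Ix, ← Finset.sum_neg_distrib]
        simp only [Sum.elim_inl, Sum.elim_inr, mul_zero, zero_add, w2]
        exact Finset.sum_congr rfl fun i _ => by ring
      · simp
    rw [s1, s1, s2]
    ring
  refine exists_orthogonal_of_system hb sh sf sψ (fun A C => ?_) hess
  rw [← E A C, hKψ]

end Isometries

/-! ### Isometry classes within the family. -/

section IsometryClasses

/-- The two diagonal matrices are conjugate by an orthogonal matrix, so all their powers have equal
traces. Power sums avoid any matching of unordered spectra. -/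
theorem sum_pow_eq_of_orthogonal {b b' : Fin 9 → ℝ} {s : ℝ} {R : Matrix (Fin 9) (Fin 9) ℝ}
    (hR : R.transpose * R = 1)
    (h : s ^ 2 • (R.transpose * Matrix.diagonal b' * R) = Matrix.diagonal b) (n : ℕ) :
    ∑ i, b i ^ n = ∑ i, (s ^ 2 * b' i) ^ n := by
  have hR' := mul_eq_one_comm.1 hR
  have e : ∀ n : ℕ, R.transpose * Matrix.diagonal (fun i => (s ^ 2 * b' i) ^ n) * R
      = Matrix.diagonal fun i => b i ^ n := by
    intro n
    induction n with
    | zero => simpa using hR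
    | succ n ih =>
      have e1 : Matrix.diagonal (fun i => b i ^ (n + 1))
          = Matrix.diagonal (fun i => b i ^ n) * Matrix.diagonal b := by
        rw [Matrix.diagonal_mul_diagonal]; simp only [pow_succ]
      have e2 : Matrix.diagonal (fun i => (s ^ 2 * b' i) ^ (n + 1))
          = Matrix.diagonal (fun i => (s ^ 2 * b' i) ^ n) * (s ^ 2 • Matrix.diagonal b') := by
        rw [← Matrix.diagonal_smul, Matrix.diagonal_mul_diagonal]
        simp only [pow_succ, Pi.smul_apply, smul_eq_mul]
      rw [e1, ← ih, ← h, e2]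
      simp only [Matrix.mul_smul, Matrix.smul_mul]
      congr 1
      calc _ = R.transpose * Matrix.diagonal (fun i => (s ^ 2 * b' i) ^ n) * 1
            * Matrix.diagonal b' * R := by simp only [Matrix.mul_assoc, Matrix.one_mul]
        _ = _ := by rw [← hR']; simp only [Matrix.mul_assoc]
  have := congrArg Matrix.trace (e n)
  rw [Matrix.trace_mul_comm, ← Matrix.mul_assoc, hR', Matrix.one_mul, Matrix.trace_diagonal,
    Matrix.trace_diagonal] at this
  exact this.symm

/-- The weights 1 and 2 are the multiplicities 3 and 6 divided by 3. The first two sums leave one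
spurious solution besides the expected one, and the third excludes it unless both coincide. -/
theorem eq_of_weighted_power_sums {a d a' d' : ℝ} (h1 : a + 2 * d = a' + 2 * d')
    (h2 : a ^ 2 + 2 * d ^ 2 = a' ^ 2 + 2 * d' ^ 2)
    (h3 : a ^ 3 + 2 * d ^ 3 = a' ^ 3 + 2 * d' ^ 3) : a = a' ∧ d = d' := by
  obtain ⟨u, rfl⟩ : ∃ u, d = d' - u := ⟨d' - d, by ring⟩
  obtain rfl : a = a' + 2 * u := by linarith
  suffices u = 0 by subst this; simp
  have e : u * (4 * (a' - d') + 6 * u) = 0 := by linear_combination h2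
  rcases mul_eq_zero.1 e with e | e
  · exact e
  · obtain rfl : a' = d' - 3 / 2 * u := by linarith
    have : u ^ 3 = 0 := by linear_combination (2 / 3) * h3
    exact pow_eq_zero_iff three_ne_zero |>.1 this

theorem sum_famDiag_pow (α β : ℂ) (c : ℝ) (n : ℕ) : ∑ i, (c * famDiag α β i) ^ n
    = 3 * (-(c * ((α - β) ^ 2).re)) ^ n + 6 * (-(c * ((α + β) ^ 2).re)) ^ n := by
  simp [Fin.sum_univ_succ, famDiag]
  ring

theorem famB_real_smul (t : ℝ) (α β : ℂ) : famB (t * α) (t * β) = t ^ 2 • famB α β := by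
  have e : ∀ z : ℂ, ((t : ℂ) ^ 2 * z).re = t ^ 2 * z.re := fun z => by
    rw [← Complex.ofReal_pow, Complex.re_ofReal_mul]
  unfold famB
  rw [smul_neg, ← Matrix.diagonal_smul]
  congr 2
  funext i
  simp only [Pi.smul_apply, smul_eq_mul, mul_ite]
  rw [← e, ← e]
  ring_nf

theorem famB_swap (α β : ℂ) : famB β α = famB α β := by
  unfold famB
  rw [show (β - α) ^ 2 = (α - β) ^ 2 by ring, add_comm β α]

theorem quad_smul (c : ℝ) (B : Matrix (Fin 9) (Fin 9) ℝ) (x : Pt) :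
    quad (c • B) x = c * quad B x := by
  simp only [quad, Matrix.smul_apply, smul_eq_mul, Finset.mul_sum]
  exact Finset.sum_congr rfl fun i _ => Finset.sum_congr rfl fun j _ => by ring

/-- The map multiplies x⁺ by t and x⁻ by t⁻¹: dx⁺ dx⁻ is preserved, and (dx⁻)² acquires the factor
t⁻² that cancels t². -/
theorem isometric_smul (B : Matrix (Fin 9) (Fin 9) ℝ) {t : ℝ} (ht : t ≠ 0) :
    Isometric B (t ^ 2 • B) := by
  let c : Ix → ℝ := Sum.elim ![t, t⁻¹] fun _ => 1
  have hc : ∀ A, c A ≠ 0 := by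
    rintro (k | i)
    · fin_cases k <;> simp [c, ht]
    · simp [c]
  let Φ : Pt →L[ℝ] Pt := ContinuousLinearMap.pi fun A => c A • ContinuousLinearMap.proj A
  let Ψ : Pt →L[ℝ] Pt := ContinuousLinearMap.pi fun A => (c A)⁻¹ • ContinuousLinearMap.proj A
  refine ⟨⟨Φ, Ψ, fun x => ?_, fun x => ?_⟩, Φ.contDiff, Ψ.contDiff, fun x v w => ?_⟩
  · funext A; simp [Φ, Ψ, hc A]
  · funext A; simp [Φ, Ψ, hc A]
  · change fderiv ℝ Φ x v ⬝ᵥ (metric (t ^ 2 • B) (Φ x)).mulVec (fderiv ℝ Φ x w) = _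
    rw [Φ.fderiv, metric_form, metric_form, quad_smul]
    have hq : quad B (Φ x) = quad B x := by simp [quad, Φ, c]
    rw [hq]
    simp [Φ, c]
    field_simp

theorem isometric_famB_iff {α β α' β' : ℂ} (h : Admissible α β) (h' : Admissible α' β') :
    Isometric (famB α β) (famB α' β') ↔
      ∃ t : ℝ, t ≠ 0 ∧ ((α' = t * α ∧ β' = t * β) ∨ (α' = t * β ∧ β' = t * α)) := by
  constructor
  · rintro ⟨φ, hφ, hφ', hiso⟩
    rw [famB_eq, famB_eq] at hiso
    -- The preimage is found by differentiating φ ∘ φ⁻¹ = id.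
    have hsurj : ∀ x, ∃ w, fderiv ℝ φ x w = Pi.single ip 1 := by
      intro x
      refine ⟨fderiv ℝ φ.symm (φ x) (Pi.single ip 1), ?_⟩
      have h1 : HasFDerivAt φ (fderiv ℝ φ x) (φ.symm (φ x)) := by
        rw [φ.symm_apply_apply]; exact (hφ.differentiable (by simp) x).hasFDerivAt
      have h2 := h1.comp (φ x) (hφ'.differentiable (by simp) (φ x)).hasFDerivAt
      have h3 : (φ ∘ φ.symm : Pt → Pt) = id := funext φ.apply_symm_apply
      rw [h3] at h2
      exact congrArg (fun L : Pt →L[ℝ] Pt => L (Pi.single ip 1)) (h2.unique (hasFDerivAt_id _))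
    obtain ⟨s, hs, R, hR, e⟩ :=
      exists_orthogonal_of_isometry (famDiag_ne_zero h) hφ hsurj hiso
    have p := fun n => sum_pow_eq_of_orthogonal hR e n
    have p' : ∀ n : ℕ, _ := fun n => (sum_famDiag_pow α β 1 n).symm.trans
      ((Finset.sum_congr rfl fun i _ => by rw [one_mul]).trans
        ((p n).trans (sum_famDiag_pow α' β' (s ^ 2) n)))
    obtain ⟨ea, ed⟩ := eq_of_weighted_power_sums
      (a := ((α - β) ^ 2).re) (d := ((α + β) ^ 2).re) (a' := s ^ 2 * ((α' - β') ^ 2).re)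
      (d' := s ^ 2 * ((α' + β') ^ 2).re) (by linear_combination (-1 / 3) * p' 1)
      (by linear_combination (1 / 3) * p' 2) (by linear_combination (-1 / 3) * p' 3)
    have lift : ∀ z z' : ℂ, (z ^ 2).im = 0 → (z' ^ 2).im = 0 →
        (z ^ 2).re = s ^ 2 * (z' ^ 2).re → z = s * z' ∨ z = -(s * z') := by
      intro z z' hz hz' e
      apply sq_eq_sq_iff_eq_or_eq_neg.1
      rw [mul_pow, ← Complex.ofReal_pow]
      apply Complex.ext
      · rw [Complex.re_ofReal_mul, e]
      · rw [Complex.im_ofReal_mul, hz, hz', mul_zero]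
    have hsC : (s : ℂ) ≠ 0 := Complex.ofReal_ne_zero.2 hs
    -- Equal signs in the two square roots give a multiple of (α, β), opposite signs a multiple of
    -- (β, α).
    rcases lift _ _ h.1 h'.1 ea with e1 | e1 <;> rcases lift _ _ h.2.1 h'.2.1 ed with e2 | e2
    · refine ⟨s⁻¹, inv_ne_zero hs, Or.inl ⟨?_, ?_⟩⟩ <;> push_cast <;> field_simp
      · linear_combination (-1 / 2) * (e1 + e2)
      · linear_combination (1 / 2) * (e1 - e2)
    · refine ⟨-s⁻¹, neg_ne_zero.2 (inv_ne_zero hs), Or.inr ⟨?_, ?_⟩⟩ <;> push_cast <;> field_simp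
      · linear_combination (1 / 2) * (e2 - e1)
      · linear_combination (1 / 2) * (e1 + e2)
    · refine ⟨s⁻¹, inv_ne_zero hs, Or.inr ⟨?_, ?_⟩⟩ <;> push_cast <;> field_simp
      · linear_combination (1 / 2) * (e1 - e2)
      · linear_combination (-1 / 2) * (e1 + e2)
    · refine ⟨-s⁻¹, neg_ne_zero.2 (inv_ne_zero hs), Or.inl ⟨?_, ?_⟩⟩ <;> push_cast <;> field_simp
      · linear_combination (1 / 2) * (e1 + e2)
      · linear_combination (1 / 2) * (e2 - e1)
  · rintro ⟨t, ht, ⟨rfl, rfl⟩ | ⟨rfl, rfl⟩⟩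
    · rw [famB_real_smul]; exact isometric_smul _ ht
    · rw [famB_real_smul, famB_swap]; exact isometric_smul _ ht

end IsometryClasses

end CW

end

theorem proposition1 {S : Type*} [NormedAddCommGroup S] [NormedSpace ℂ S] [FiniteDimensional ℂ S]
    (Γ : CW.Ix → S →L[ℂ] S) (hΓ : CW.IsClifford Γ) (hirr : CW.IsIrred Γ)
    (C : S →ₗ[ℂ] S →ₗ[ℂ] ℂ) (hC : CW.IsChargeConj Γ C) :
    (∀ α β : ℂ, CW.Admissible α β →
      CW.IsFlat (CW.famD Γ α β) ∧
      (α * β ≠ 0 → ∀ X : CW.VField, X ∈ CW.killingAlg α β ↔ CW.IsKilling (CW.famB α β) X)) ∧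
    (∃ G : ∀ α β : ℂ, CW.Admissible α β → CW.GeomSuperalgebra (CW.famB α β) (CW.famD Γ α β),
      (∀ (α β : ℂ) (h : CW.Admissible α β),
        (G α β h).even = CW.killingAlg α β ∧
        (G α β h).NonRestricted ∧
        (G α β h).nu = 1 ∧
        (∀ (X : (G α β h).even) (ξ : (G α β h).odd),
          ((G α β h).L X ξ : CW.Field S) = CW.spinorLie (CW.famB α β) Γ X ξ) ∧
        (∀ ξ : (G α β h).odd,
          ((G α β h).br ξ ξ : CW.VField) =
            CW.brField Γ C α β (CW.sigmaM Γ ((ξ : CW.Field S) 0))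
              (CW.sigmaP Γ ((ξ : CW.Field S) 0)))) ∧
      (∀ (α β : ℂ) (t : ℝ) (h : CW.Admissible α β) (h' : CW.Admissible (t * α) (t * β)),
        (G α β h).Iso (G (t * α) (t * β) h'))) ∧
    (∀ α β α' β' : ℂ, CW.Admissible α β → CW.Admissible α' β' →
      (CW.Isometric (CW.famB α β) (CW.famB α' β') ↔
        ∃ t : ℝ, t ≠ 0 ∧ ((α' = t * α ∧ β' = t * β) ∨ (α' = t * β ∧ β' = t * α)))) := by
  -- Needed for ν: the quotient of dimensions is 1 only when S is non-zero.
  have : Nontrivial S := hirr.1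
  refine ⟨fun α β h => ⟨CW.isFlat_famD hΓ h, fun hαβ X => CW.mem_killingAlg_iff_isKilling h hαβ⟩,
    ⟨fun α β h => CW.superalgebra hC hΓ h, fun α β h => ⟨rfl, le_rfl,
      CW.superalgebra_nu hC hΓ h, fun X ξ => rfl, fun ξ => ?_⟩,
      fun α β t h h' => CW.superalgebra_iso hC hΓ h h'⟩,
    fun α β α' β' h h' => CW.isometric_famB_iff h h'⟩
  exact CW.brKill_self hC hΓ _
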